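/- **Setting.** Let $N\ge 1$, $C_0,C_1>0$, $p>2$, $m+p>3$, and $\alpha=\frac{m+p-2}{p-1}$. Let $E\subset\mathbb R^N$ be open, $T_1<T_2$, and consider $$\partial_t u-\operatorname{div}A(x,t,u,Du)=0\quad\text{in }E\times(T_1,T_2).\tag{1}$$ A function $u$ is a *positive weak supersolution* of (1) if $u>0$ a.e. in $E\times(T_1,T_2)$, $$u\in C_{loc}(T_1,T_2;L^2_{loc}(E)),\qquad u^\alpha\in L^p_{loc}(T_1,T_2;W^{1,p}_{loc}(E)),$$ and $-\iint u\,\partial_t\varphi\,dx\,dt+\iint A(x,t,u,Du)\cdot D\varphi\,dx\,dt\ge 0$ for all nonnegative $\varphi\in C_0^\infty(E\times(T_1,T_2))$. Here $Du:=\alpha^{-1}u^{1-\alpha}D(u^\alpha)$, the map $(x,t)\mapsto A(x,t,u,Du)$ is measurable, and for a.e. $(x,t)\in E\times(T_1,T_2)$ $$A(x,t,u,Du)\cdot Du\ge C_0|u|^{m-1}|Du|^p,\qquad |A(x,t,u,Du)|\le C_1|u|^{m-1}|Du|^{p-1}.$$ Write $(u-k)_-=\max\{k-u,0\}$ and $D(u-k)_-:=-\chi_{[u<k]}Du$.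 Let $Q$ be open with compact closure $\overline Q\subset E$, let $T>0$ with $T_1<0<T<T_2$, let $0\le t_1<t_2\le T$, $Q_{t_1,t_2}=Q\times(t_1,t_2)$ and $k>0$. Let $\zeta\ge0$ be a piecewise smooth (more generally, Lipschitz continuous) function on $\overline Q\times[t_1,t_2]$ which vanishes on $\partial Q\times[t_1,t_2]$. Write $dz=dx\,dt$. The constants $\gamma>0$ below depend only on $m,p,C_0,C_1$; in particular they are independent of $N,E,T_1,T_2,A,u,Q,T,t_1,t_2,k,\zeta$. **(1) The case $m>1$, $p>2$.** There is $\gamma=\gamma(m,p,C_0,C_1)>0$ such that for every positive weak supersolution $u$ and all $Q,T,t_1,t_2,k,\zeta$ as above, $$\operatorname*{ess\,sup}_{t_1\le\tau\le t_2}\Big\{\tfrac12\int_Q(u-k)_-^2\zeta^p(\cdot,\tau)\,dx+\tfrac{C_0}{2}\iint_{Q_{t_1,\tau}}u^{m-1}|D(u-k)_-|^p\zeta^p\,dz\Big\}$$ $$\le\tfrac12\iint_{Q_{t_1,t_2}}(u-k)_-^2\Big|\frac{\partial\zeta^p}{\partial t}\Big|dz+\tfrac12\int_Q(u-k)_-^2\zeta^p(\cdot,t_1)\,dx+\gamma\iint_{Q_{t_1,t_2}}u^{m-1}(u-k)_-^p|D\zeta|^p\,dz,$$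 and $$\tfrac12\operatorname*{ess\,sup}_{t_1\le\tau\le t_2}\int_Q(u-k)_-^2\zeta^p(\cdot,\tau)\,dx+\iint_{Q_{t_1,t_2}}u^{m-1}|D(u-k)_-|^p\zeta^p\,dz$$ $$\le\gamma\Big\{\tfrac12\iint_{Q_{t_1,t_2}}(u-k)_-^2\Big|\frac{\partial\zeta^p}{\partial t}\Big|dz+\tfrac12\int_Q(u-k)_-^2\zeta^p(\cdot,t_1)\,dx+\iint_{Q_{t_1,t_2}}u^{m-1}(u-k)_-^p|D\zeta|^p\,dz\Big\}.$$ **(2) The case $0<m<1$, $m+p>3$.** There is $\gamma=\gamma(m,p,C_0,C_1)>0$ such that for every positive weak supersolution $u$ and all $Q,T,t_1,t_2,k,\zeta$ as above, $$\operatorname*{ess\,sup}_{t_1\le\tau\le t_2}\int_Q(u-k)_-^2\zeta^p(\cdot,\tau)\,dx+k^{m-1}\iint_{Q_{t_1,t_2}}|D(u-k)_-|^p\zeta^p\,dz$$ $$\le\gamma k\int_Q(u-k)_-\zeta^p(\cdot,t_1)\,dx+\gamma k\iint_{Q_{t_1,t_2}}(u-k)_-\,\zeta^{p-1}\Big|\frac{\partial\zeta}{\partial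 t}\Big|dz+\gamma k^{m+p-1}\iint_{Q_{t_1,t_2}}\chi_{[u\le k]}|D\zeta|^p\,dz.$$ If moreover $\zeta\le1$, the same estimate holds with $\zeta^{p-1}|\partial\zeta/\partial t|$ replaced by $|\partial\zeta/\partial t|$. -/

import Mathlib

open MeasureTheory Set Filter Topology
open scoped ENNReal NNReal ContDiff

noncomputable section

namespace DoublyDegenerate

/-- The space `ℝ^N` with its Euclidean norm. -/
abbrev Space (N : ℕ) : Type := EuclideanSpace ℝ (Fin N)

/-- Space-time `ℝ^N × ℝ`, with points `z = (x, t)` and Lebesgue (product) measure. -/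
abbrev SpaceTime (N : ℕ) : Type := Space N × ℝ

/-- The spatial gradient `Dφ (x, t)` of a function on space-time. -/
def spaceGrad {N : ℕ} (φ : SpaceTime N → ℝ) (z : SpaceTime N) : Space N :=
  gradient (fun y : Space N => φ (y, z.2)) z.1

/-- The time derivative `∂φ/∂t (x, t)` of a function on space-time. -/
def timeDeriv {N : ℕ} (φ : SpaceTime N → ℝ) (z : SpaceTime N) : ℝ :=
  deriv (fun s : ℝ => φ (z.1, s)) z.2

/-- `φ ∈ C₀^∞(U)`. -/
structure IsTestFunction {X : Type*} [NormedAddCommGroup X] [NormedSpace ℝ X]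
    (U : Set X) (φ : X → ℝ) : Prop where
  smooth : ContDiff ℝ ∞ φ
  compactSupport : HasCompactSupport φ
  support_subset : tsupport φ ⊆ U

/-- `g` is the weak gradient of `f` in the open set `E ⊆ ℝ^N`. -/
structure HasWeakGradient {N : ℕ} (E : Set (Space N)) (f : Space N → ℝ)
    (g : Space N → Space N) : Prop where
  locInt : LocallyIntegrableOn f E
  locInt_grad : LocallyIntegrableOn g E
  integral_eq : ∀ ψ : Space N → ℝ, IsTestFunction E ψ →
    ∫ x in E, f x • gradient ψ x = -∫ x in E, ψ x • g x

/-- `u ∈ C_loc(T₁, T₂; L²_loc(E))`. -/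
def MemCLocL2Loc {N : ℕ} (E : Set (Space N)) (T₁ T₂ : ℝ) (u : SpaceTime N → ℝ) : Prop :=
  ∀ K : Set (Space N), IsCompact K → K ⊆ E →
    (∀ t ∈ Ioo T₁ T₂, MemLp (fun x => u (x, t)) 2 (volume.restrict K)) ∧
    ∀ t₀ ∈ Ioo T₁ T₂,
      Tendsto (fun t => eLpNorm (fun x => u (x, t) - u (x, t₀)) 2 (volume.restrict K))
        (𝓝 t₀) (𝓝 0)

/-- `v ∈ L^p_loc(T₁, T₂; W^{1,p}_loc(E))`, with (spatial) weak gradient `Dv = V`. -/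
structure MemLpLocW1pLoc {N : ℕ} (p : ℝ) (E : Set (Space N)) (T₁ T₂ : ℝ)
    (v : SpaceTime N → ℝ) (V : SpaceTime N → Space N) : Prop where
  weakGradient : ∀ᵐ t ∂(volume.restrict (Ioo T₁ T₂)),
    HasWeakGradient E (fun x => v (x, t)) (fun x => V (x, t))
  memLp : ∀ K : Set (Space N), IsCompact K → K ⊆ E → ∀ a b : ℝ, T₁ < a → b < T₂ →
    MemLp v (ENNReal.ofReal p) (volume.restrict (K ×ˢ Icc a b))
  memLp_grad : ∀ K : Set (Space N), IsCompact K → K ⊆ E → ∀ a b : ℝ, T₁ < a → b < T₂ →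
    MemLp V (ENNReal.ofReal p) (volume.restrict (K ×ˢ Icc a b))

/-- The exponent `α = (m + p - 2) / (p - 1)`. -/
def alpha (m p : ℝ) : ℝ := (m + p - 2) / (p - 1)

/-- The gradient of `u`, interpreted as `Du = α⁻¹ u^{1-α} D(u^α)`, where `V = D(u^α)`. -/
def gradU {N : ℕ} (m p : ℝ) (u : SpaceTime N → ℝ) (V : SpaceTime N → Space N)
    (z : SpaceTime N) : Space N :=
  ((alpha m p)⁻¹ * u z ^ (1 - alpha m p)) • V z

/-- The truncation `(s - k)₋ = max {-(s - k), 0}`. -/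
def truncMinus (s k : ℝ) : ℝ := max (-(s - k)) 0

/-- `D(u - k)₋ = -χ_{[u < k]} Du`, with `Du` interpreted as in `gradU`. -/
def gradTruncMinus {N : ℕ} (m p : ℝ) (u : SpaceTime N → ℝ) (V : SpaceTime N → Space N)
    (k : ℝ) (z : SpaceTime N) : Space N :=
  {w : SpaceTime N | u w < k}.indicator (fun w => -gradU m p u V w) z

/-- The structure conditions in `E × (T₁, T₂)`,
`A(x,t,u,Du) · Du ≥ C₀ |u|^{m-1} |Du|^p` and `|A(x,t,u,Du)| ≤ C₁ |u|^{m-1} |Du|^{p-1}`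
for almost all `(x, t)`, together with the measurability of `(x,t) ↦ A(x,t,u,Du)`. They are
only required along `u` and `Du`, which is weaker than to require them of `A(x,t,s,ξ)`
for all `s` and `ξ`. -/
structure StructureConditions {N : ℕ} (m p C₀ C₁ : ℝ) (E : Set (Space N)) (T₁ T₂ : ℝ)
    (A : SpaceTime N → ℝ → Space N → Space N) (u : SpaceTime N → ℝ)
    (V : SpaceTime N → Space N) : Prop where
  measurable : AEStronglyMeasurable (fun z => A z (u z) (gradU m p u V z))
    (volume.restrict (E ×ˢ Ioo T₁ T₂))
  coercive : ∀ᵐ z ∂(volume.restrict (E ×ˢ Ioo T₁ T₂)),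
    C₀ * |u z| ^ (m - 1) * ‖gradU m p u V z‖ ^ p ≤
      inner ℝ (A z (u z) (gradU m p u V z)) (gradU m p u V z)
  growth : ∀ᵐ z ∂(volume.restrict (E ×ˢ Ioo T₁ T₂)),
    ‖A z (u z) (gradU m p u V z)‖ ≤ C₁ * |u z| ^ (m - 1) * ‖gradU m p u V z‖ ^ (p - 1)

/-- `u` is a positive (local) weak supersolution of `∂u/∂t - div A(x,t,u,Du) = 0` in
`E × (T₁, T₂)`, and `V = D(u^α)`. -/
structure IsPositiveWeakSupersolution {N : ℕ} (m p : ℝ) (E : Set (Space N)) (T₁ T₂ : ℝ)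
    (A : SpaceTime N → ℝ → Space N → Space N) (u : SpaceTime N → ℝ)
    (V : SpaceTime N → Space N) : Prop where
  measurable : AEStronglyMeasurable u (volume.restrict (E ×ˢ Ioo T₁ T₂))
  pos : ∀ᵐ z ∂(volume.restrict (E ×ˢ Ioo T₁ T₂)), 0 < u z
  continuous_L2 : MemCLocL2Loc E T₁ T₂ u
  power_mem : MemLpLocW1pLoc p E T₁ T₂ (fun z => u z ^ alpha m p) V
  supersolution : ∀ φ : SpaceTime N → ℝ, IsTestFunction (E ×ˢ Ioo T₁ T₂) φ →
    (∀ z, 0 ≤ φ z) →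
    0 ≤ -(∫ z in E ×ˢ Ioo T₁ T₂, u z * timeDeriv φ z) +
      ∫ z in E ×ˢ Ioo T₁ T₂, inner ℝ (A z (u z) (gradU m p u V z)) (spaceGrad φ z)

/-- A nonnegative cutoff function on `Q × (t₁, t₂)` which vanishes on the lateral boundary
`∂Q × [t₁, t₂]`. Lipschitz regularity covers all (continuous) piecewise smooth functions. -/
structure IsCutoff {N : ℕ} (Q : Set (Space N)) (t₁ t₂ : ℝ) (ζ : SpaceTime N → ℝ) : Prop where
  lipschitz : ∃ L : ℝ≥0, LipschitzOnWith L ζ (closure Q ×ˢ Icc t₁ t₂)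
  nonneg : ∀ z ∈ closure Q ×ˢ Icc t₁ t₂, 0 ≤ ζ z
  lateral : ∀ z ∈ frontier Q ×ˢ Icc t₁ t₂, ζ z = 0

/-- `∫_Q (u - k)₋^q(·, τ) ζ^p(·, τ) dx`. -/
def sliceEnergy {N : ℕ} (q p k : ℝ) (Q : Set (Space N)) (u ζ : SpaceTime N → ℝ) (τ : ℝ) :
    ℝ≥0∞ :=
  ∫⁻ x in Q, ENNReal.ofReal (truncMinus (u (x, τ)) k ^ q * ζ (x, τ) ^ p)

/-- `∬_{Q × (t₁, t₂)} f dz` for a nonnegative integrand `f`, as an element of `[0, ∞]`. -/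
def cylInt {N : ℕ} (Q : Set (Space N)) (t₁ t₂ : ℝ) (f : SpaceTime N → ℝ) : ℝ≥0∞ :=
  ∫⁻ z in Q ×ˢ Ioo t₁ t₂, ENNReal.ofReal (f z)

end DoublyDegenerate

end

/-!
# Energy estimates for supersolutions of doubly degenerate equations

The estimates come from testing the equation with `ζ^p H(u^α)`, where `H` is nonincreasing and
vanishes above `k^α`. In terms of `V = D(u^α)` the structure conditions contain no power of `u`:
the flux is coercive of order `|V|^p` and grows at most like `|V|^{p-1}`
(`StructureConditions.le_inner_flux`, `StructureConditions.norm_flux_le`), so that the test function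
and its gradient pair well with `u` and the flux, although `Du` itself need not be integrable.

The solution is only continuous in time with values in `L²`, and has no time derivative. Let `U` and
`F` be the correlations of `u` and of the flux with the test function `w` and with its gradient. They
are continuous on space-time, and testing the equation with mollifications of `w` shows that
`∂U/∂t + F ≥ 0` near the origin in the sense of distributions (`correlation_distributional`). Hence
`U(0) - U(0, -h) ≥ -(F(0) + ε) h` for small `h > 0` (`eventually_le_sub_of_distributional`). The
left-hand side is an integral of `w (u(t) - u(t - h))`. As `H(u^α)` is a nonincreasing function of
`u`, it is bounded by the increments of the convex function `Φ(u) = ∫_u^k H(r^α) dr`, and the limit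
`h → 0` gives the energy inequality `IsPositiveWeakSupersolution.energy_inequality`. The gradient of
the test function is found by mollifying `u^α` in space (`HasWeakGradient.integral_comp_mul`).
Young's inequality then absorbs half of the coercive term
(`IsPositiveWeakSupersolution.lintegral_energy_le`).

For `m < 1` the choice is `H(σ) = k^{1-α} (k^α - σ)₊`. Concavity of the power `α < 1` gives
`Φ(s) ≥ (α/2) (k - s)²`, while `H ≤ k` gives `Φ(s) ≤ k (k - s)₊`
(`IsCutoff.singular_energy_le`). For `m > 1` the natural choice is `H(u^α) = (k - u)₊`, that is
`-H'(σ) = (1/α) σ^{1/α-1}`, which is unbounded at `σ = 0`. It is replaced by a bounded weight that is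
exact for `u ≥ δ`; this only decreases `Φ`, costs an error of order `δ^{m-1}`, and leaves the claim
in the limit `δ → 0` by monotone convergence, because `u > 0` (`IsCutoff.degenerate_energy_le`).
-/

namespace DoublyDegenerate

variable {N : ℕ}

/-! ### Translations and mollification in Lebesgue spaces -/

section Translation

variable {G F : Type*} [NormedAddCommGroup G] [NormedSpace ℝ G] [FiniteDimensional ℝ G]
  [MeasurableSpace G] [BorelSpace G] {μ : Measure G} [μ.IsAddHaarMeasure]
  [NormedAddCommGroup F]

/-- The translates `z ↦ f (z - y)` of a function `f ∈ L^p`, as elements of `L^p`, depend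
continuously on `y`. -/
theorem continuous_toLp_translate {p : ℝ≥0∞} [Fact (1 ≤ p)] (hp : p ≠ ⊤) {f : G → F}
    (hf : MemLp f p μ) :
    Continuous fun y : G =>
      (hf.comp_measurePreserving (measurePreserving_sub_right μ y)).toLp (fun z => f (z - y)) := by
  let g : C(G, C(G, G)) := (ContinuousMap.mk (fun a : G × G => a.2 - a.1) (by fun_prop)).curry
  have h := Continuous.compMeasurePreservingLp (f := fun _ : G => hf.toLp f) (g := fun y => g y)
    continuous_const g.continuous (fun y => measurePreserving_sub_right μ y) hp
  exact h

theorem tendsto_eLpNorm_translate_sub {p : ℝ≥0∞} [Fact (1 ≤ p)] (hp : p ≠ ⊤) {f : G → F}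
    (hf : MemLp f p μ) :
    Tendsto (fun y : G => eLpNorm (fun z => f (z - y) - f z) p μ) (𝓝 0) (𝓝 0) := by
  have h := (continuous_toLp_translate hp hf).tendsto 0
  rw [tendsto_iff_edist_tendsto_0] at h
  refine h.congr fun y => ?_
  rw [Lp.edist_toLp_toLp]
  congr 1
  ext z
  simp

/-- The correlation `y ↦ ∫ ⟪a z, W (z - y)⟫ dz` of functions in dual Lebesgue spaces is
continuous. -/
theorem continuous_integral_inner_translate [InnerProductSpace ℝ F] {p q : ℝ≥0∞}
    [p.HolderConjugate q] (hq : q ≠ ⊤) {a W : G → F} (ha : MemLp a p μ) (hW : MemLp W q μ) :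
    Continuous fun y : G => ∫ z, inner ℝ (a z) (W (z - y)) ∂μ := by
  have : Fact (1 ≤ p) := ⟨ENNReal.HolderConjugate.one_le p q⟩
  have : Fact (1 ≤ q) := ⟨ENNReal.HolderConjugate.one_le q p⟩
  have h := (((innerSL ℝ (E := F)).lpPairing μ p q) (ha.toLp a)).continuous.comp
    (continuous_toLp_translate hq hW)
  refine h.congr fun y => ?_
  simp only [Function.comp_apply, ContinuousLinearMap.lpPairing_eq_integral]
  refine integral_congr_ae ?_
  filter_upwards [ha.coeFn_toLp,
    (hW.comp_measurePreserving (measurePreserving_sub_right μ y)).coeFn_toLp] with z h1 h2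
  have h2' : ((hW.comp_measurePreserving (measurePreserving_sub_right μ y)).toLp
    (fun z => W (z - y))) z = W (z - y) := h2
  rw [h1, h2']
  rfl

/-- Mollifications converge in `L¹`. -/
theorem tendsto_eLpNorm_normed_convolution_sub [NormedSpace ℝ F] [CompleteSpace F] {f : G → F}
    (hf : Integrable f μ) {φ : ℕ → ContDiffBump (0 : G)}
    (hφ : Tendsto (fun i => (φ i).rOut) atTop (𝓝 0)) :
    Tendsto (fun i => eLpNorm
      (fun x => convolution ((φ i).normed μ) f (ContinuousLinearMap.lsmul ℝ ℝ) μ x - f x) 1 μ)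
      atTop (𝓝 0) := by
  have hT := tendsto_eLpNorm_translate_sub (p := 1) (by simp) (memLp_one_iff_integrable.2 hf)
  rw [ENNReal.tendsto_nhds_zero] at hT ⊢
  intro ε hε
  obtain ⟨r, hr, hball⟩ := Metric.eventually_nhds_iff.1 (hT ε hε)
  filter_upwards [hφ.eventually (gt_mem_nhds hr)] with i hi
  set ρ := (φ i).normed μ with hρ
  have hρc : Continuous ρ := (φ i).continuous_normed
  have hρs : HasCompactSupport ρ := (φ i).hasCompactSupport_normed
  have hρi : Integrable ρ μ := hρc.integrable_of_hasCompactSupport hρs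
  have hρ1 : ∫⁻ y, ‖ρ y‖ₑ ∂μ = 1 := by
    have h1 : ∫ y, ρ y ∂μ = 1 := (φ i).integral_normed
    have h2 : ∀ y, ‖ρ y‖ₑ = ENNReal.ofReal (ρ y) := fun y =>
      Real.enorm_of_nonneg ((φ i).nonneg_normed y)
    simp_rw [h2]
    rw [← ofReal_integral_eq_lintegral_ofReal hρi
      (Eventually.of_forall fun y => (φ i).nonneg_normed y), h1, ENNReal.ofReal_one]
  have hconv : ∀ x, convolution ρ f (ContinuousLinearMap.lsmul ℝ ℝ) μ x - f x =
      ∫ y, ρ y • (f (x - y) - f x) ∂μ := by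
    intro x
    have hex : Integrable (fun y => ρ y • f (x - y)) μ :=
      hρs.convolutionExists_left (ContinuousLinearMap.lsmul ℝ ℝ) hρc hf.locallyIntegrable x
    simp_rw [smul_sub]
    rw [integral_sub hex (hρi.smul_const _), integral_smul_const,
      show ∫ y, ρ y ∂μ = 1 from (φ i).integral_normed, one_smul]
    rfl
  have hmeas : AEMeasurable (fun z : G × G => ‖ρ z.2‖ₑ * ‖f (z.1 - z.2) - f z.1‖ₑ) (μ.prod μ) := by
    have h1 : AEStronglyMeasurable (fun z : G × G => f (z.1 - z.2)) (μ.prod μ) :=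
      hf.aestronglyMeasurable.comp_quasiMeasurePreserving
        (quasiMeasurePreserving_sub_of_right_invariant μ μ)
    have h2 : AEStronglyMeasurable (fun z : G × G => f z.1) (μ.prod μ) :=
      hf.aestronglyMeasurable.comp_fst
    exact (hρc.comp continuous_snd).measurable.enorm.aemeasurable.mul (h1.sub h2).enorm
  rw [eLpNorm_one_eq_lintegral_enorm]
  calc ∫⁻ x, ‖convolution ρ f (ContinuousLinearMap.lsmul ℝ ℝ) μ x - f x‖ₑ ∂μ
      ≤ ∫⁻ x, ∫⁻ y, ‖ρ y‖ₑ * ‖f (x - y) - f x‖ₑ ∂μ ∂μ := by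
        refine lintegral_mono fun x => ?_
        rw [hconv x]
        refine (enorm_integral_le_lintegral_enorm _).trans (le_of_eq ?_)
        simp [enorm_smul]
    _ = ∫⁻ y, ∫⁻ x, ‖ρ y‖ₑ * ‖f (x - y) - f x‖ₑ ∂μ ∂μ := lintegral_lintegral_swap hmeas
    _ ≤ ∫⁻ y, ‖ρ y‖ₑ * ε ∂μ := by
        refine lintegral_mono fun y => ?_
        rw [lintegral_const_mul' _ _ enorm_ne_top]
        by_cases hy : dist y 0 < (φ i).rOut
        · have := hball (hy.trans hi)
          rw [eLpNorm_one_eq_lintegral_enorm] at this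
          gcongr
        · have : ρ y = 0 := by
            have : y ∉ Function.support ρ := by
              rw [hρ, (φ i).support_normed_eq]; exact hy
            simpa using this
          simp [this]
    _ = ε := by rw [lintegral_mul_const _ hρc.measurable.enorm, hρ1, one_mul]

end Translation

/-! ### Weak gradients and mollification -/

theorem inner_gradient_eq_fderiv {ψ : Space N → ℝ} (x e : Space N) :
    inner ℝ (gradient ψ x) e = fderiv ℝ ψ x e := by
  simp [gradient]

/-- Mollification commutes with the weak gradient at points whose distance to the boundary exceeds
the radius of the mollifier. -/
theorem HasWeakGradient.fderiv_convolution {E : Set (Space N)}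
    {f : Space N → ℝ} {g : Space N → Space N} (h : HasWeakGradient E f g)
    {K : Set (Space N)} (hK : IsCompact K) (hKE : K ⊆ E) (φ : ContDiffBump (0 : Space N))
    {x : Space N} (hx : Metric.closedBall x φ.rOut ⊆ K) (e : Space N) :
    fderiv ℝ (convolution (φ.normed volume) (K.indicator f)
        (ContinuousLinearMap.lsmul ℝ ℝ) volume) x e =
      inner ℝ (convolution (φ.normed volume) (K.indicator g)
        (ContinuousLinearMap.lsmul ℝ ℝ) volume x) e := by
  set ρ := φ.normed (volume : Measure (Space N)) with hρ
  have hρsm : ContDiff ℝ ∞ ρ := φ.contDiff_normed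
  have hρs : HasCompactSupport ρ := φ.hasCompactSupport_normed
  have hfi : Integrable (K.indicator f) volume :=
    (integrable_indicator_iff hK.measurableSet).2 (h.locInt.integrableOn_compact_subset hKE hK)
  have hgi : Integrable (K.indicator g) volume :=
    (integrable_indicator_iff hK.measurableSet).2
      (h.locInt_grad.integrableOn_compact_subset hKE hK)
  have hρd : Continuous (fderiv ℝ ρ) := hρsm.continuous_fderiv (by simp)
  have hzero : ∀ y, y ∉ Metric.closedBall x φ.rOut → x - y ∉ tsupport ρ := by
    intro y hy hc
    rw [hρ, φ.tsupport_normed_eq] at hc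
    apply hy
    simpa [dist_eq_norm, norm_sub_rev] using hc
  -- the reflected mollifier centred at `x` is an admissible test function
  set ψ : Space N → ℝ := fun y => ρ (x - y) with hψ
  have hψt : tsupport ψ ⊆ Metric.closedBall x φ.rOut := by
    refine closure_minimal ?_ Metric.isClosed_closedBall
    intro y hy
    by_contra hc
    exact hy (show ρ (x - y) = 0 from image_eq_zero_of_notMem_tsupport (hzero y hc))
  have htest : IsTestFunction E ψ :=
    ⟨hρsm.comp (contDiff_const.sub contDiff_id),
      HasCompactSupport.of_support_subset_isCompact (isCompact_closedBall x φ.rOut)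
        (subset_closure.trans hψt), hψt.trans (hx.trans hKE)⟩
  have hψd : ∀ y, fderiv ℝ ψ y e = -fderiv ℝ ρ (x - y) e := by
    intro y
    have h1 : HasFDerivAt ρ (fderiv ℝ ρ (x - y)) (x - y) :=
      (hρsm.differentiable (by simp) _).hasFDerivAt
    have h2 : HasFDerivAt (fun y => x - y) (-ContinuousLinearMap.id ℝ (Space N)) y := by
      simpa using (hasFDerivAt_id y).const_sub x
    have h3 : fderiv ℝ ψ y = _ := (h1.comp y h2).fderiv
    rw [h3]
    simp
  have hd := (hρs.hasFDerivAt_convolution_left (ContinuousLinearMap.lsmul ℝ ℝ)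
    (hρsm.of_le (by simp)) hfi.locallyIntegrable x).fderiv
  have hint : Integrable (fun y => ((ContinuousLinearMap.lsmul ℝ ℝ (E := ℝ)).precompL (Space N))
      (fderiv ℝ ρ (x - y)) (K.indicator f y)) volume := by
    have := (hρs.fderiv (𝕜 := ℝ)).convolutionExists_left
      ((ContinuousLinearMap.lsmul ℝ ℝ (E := ℝ)).precompL (Space N)) hρd hfi.locallyIntegrable x
    exact this.integrable_swap
  have hgint : Integrable (fun y => ρ (x - y) • K.indicator g y) volume := by
    have := hρs.convolutionExists_left (ContinuousLinearMap.lsmul ℝ ℝ)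
      hρsm.continuous hgi.locallyIntegrable x
    exact this.integrable_swap
  have hfint : Integrable (fun y => f y • gradient ψ y) (volume.restrict E) := by
    have h1 : Integrable (fun y => K.indicator f y • gradient ψ y) volume := by
      refine hfi.smul_of_top_left ?_
      have hc : Continuous (gradient ψ) :=
        (LinearIsometryEquiv.continuous _).comp (htest.smooth.continuous_fderiv (by simp))
      refine hc.memLp_top_of_hasCompactSupport ?_ _
      exact (htest.compactSupport.fderiv (𝕜 := ℝ)).comp_left (by simp)
    refine (h1.restrict (s := E)).congr (Eventually.of_forall fun y => ?_)
    by_cases hy : y ∈ K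
    · simp [hy]
    · have : y ∉ tsupport ψ := fun hc => hy (hx (hψt hc))
      have h0 : fderiv ℝ ψ y = 0 :=
        image_eq_zero_of_notMem_tsupport fun hc => this (tsupport_fderiv_subset ℝ hc)
      simp [hy, gradient, h0]
  rw [hd, convolution_eq_swap, ContinuousLinearMap.integral_apply hint, convolution_lsmul_swap,
    real_inner_comm, ← integral_inner hgint]
  have hw := congrArg (fun v => inner ℝ e v) (h.integral_eq ψ htest)
  have hgE : Integrable (fun y => ψ y • g y) (volume.restrict E) := by
    refine (hgint.restrict (s := E)).congr (Eventually.of_forall fun y => ?_)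
    by_cases hy : y ∈ K
    · simp [hy, hψ]
    · have : ψ y = 0 := image_eq_zero_of_notMem_tsupport fun hc => hy (hx (hψt hc))
      simp [hy, this]
  simp only [inner_neg_right] at hw
  rw [← integral_inner hfint, ← integral_inner hgE] at hw
  have e1 : ∫ y in E, inner ℝ e (f y • gradient ψ y) =
      -∫ y, ((ContinuousLinearMap.lsmul ℝ ℝ (E := ℝ)).precompL (Space N))
      (fderiv ℝ ρ (x - y)) (K.indicator f y) e := by
    rw [← integral_neg]
    refine Eq.trans ?_ (setIntegral_eq_integral_of_forall_compl_eq_zero (s := E) ?_)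
    · refine integral_congr_ae (Eventually.of_forall fun y => ?_)
      simp only [inner_smul_right, ContinuousLinearMap.precompL_apply,
        ContinuousLinearMap.lsmul_apply, smul_eq_mul]
      rw [show inner ℝ e (gradient ψ y) = fderiv ℝ ψ y e by
        rw [real_inner_comm, inner_gradient_eq_fderiv], hψd]
      by_cases hy : y ∈ K
      · simp [hy]; ring
      · have : x - y ∉ tsupport ρ := hzero y fun hc => hy (hx hc)
        have h0 : fderiv ℝ ρ (x - y) = 0 :=
          image_eq_zero_of_notMem_tsupport fun hc => this (tsupport_fderiv_subset ℝ hc)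
        simp [h0]
    · intro y hy
      have hyK : y ∉ K := fun hc => hy (hKE hc)
      simp [hyK]
  have e2 : ∫ y in E, inner ℝ e (ψ y • g y) =
      ∫ y, inner ℝ e (ρ (x - y) • K.indicator g y) := by
    refine Eq.trans ?_ (setIntegral_eq_integral_of_forall_compl_eq_zero (s := E) ?_)
    · refine integral_congr_ae (Eventually.of_forall fun y => ?_)
      by_cases hy : y ∈ K
      · simp [hy, hψ]
      · have : ψ y = 0 := image_eq_zero_of_notMem_tsupport fun hc => hy (hx (hψt hc))
        simp [hy, this]
    · intro y hy
      have hyK : y ∉ K := fun hc => hy (hKE hc)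
      simp [hyK]
  rw [e1, e2] at hw
  linarith

/-! ### Chain and product rules for weak gradients -/

/-- The chain and product rules for `H(f) η`, where `f` has a weak gradient, `η` is a Lipschitz
cutoff function, and `H` is continuously differentiable with a bounded derivative. -/
theorem HasWeakGradient.integral_comp_mul_of_continuous_deriv {E : Set (Space N)} (hE : IsOpen E)
    {f : Space N → ℝ} {g : Space N → Space N} (h : HasWeakGradient E f g)
    {η : Space N → ℝ} {L : ℝ≥0} (hη : LipschitzWith L η) (hηs : HasCompactSupport η)
    (hηE : tsupport η ⊆ E) {H H' : ℝ → ℝ} {M : ℝ} (hH : ∀ s, HasDerivAt H (H' s) s)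
    (hH'c : Continuous H') (hH' : ∀ s, |H' s| ≤ M)
    {ψ : Space N → ℝ} (hψ : ContDiff ℝ ∞ ψ) (hψs : HasCompactSupport ψ) (e : Space N) :
    ∫ x, (H (f x) * (η x * fderiv ℝ ψ x e + ψ x * lineDeriv ℝ η x e) +
      H' (f x) * inner ℝ (g x) e * (η x * ψ x)) = 0 := by
  have hM : 0 ≤ M := (abs_nonneg _).trans (hH' 0)
  obtain ⟨δ, hδ, hδE⟩ := hηs.isCompact.exists_cthickening_subset_open hE hηE
  set K := Metric.cthickening δ (tsupport η) with hKdef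
  have hK : IsCompact K := hηs.isCompact.cthickening
  set f₁ := K.indicator f with hf₁
  set g₁ := K.indicator g with hg₁
  have hfi : Integrable f₁ volume :=
    (integrable_indicator_iff hK.measurableSet).2 (h.locInt.integrableOn_compact_subset hδE hK)
  have hgi : Integrable g₁ volume :=
    (integrable_indicator_iff hK.measurableSet).2
      (h.locInt_grad.integrableOn_compact_subset hδE hK)
  have hsub : tsupport η ⊆ K := Metric.self_subset_cthickening _
  have hn0 : ∀ n : ℕ, 0 < δ / (2 * ((n : ℝ) + 1)) := fun n => by positivity
  let φ : ℕ → ContDiffBump (0 : Space N) := fun n =>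
    ⟨δ / (2 * ((n : ℝ) + 1)), 2 * (δ / (2 * ((n : ℝ) + 1))), hn0 n, by linarith [hn0 n]⟩
  have hφ : Tendsto (fun i => (φ i).rOut) atTop (𝓝 0) := by
    have h1 := (tendsto_one_div_add_atTop_nhds_zero_nat (𝕜 := ℝ)).const_mul δ
    rw [mul_zero] at h1
    refine h1.congr fun n => ?_
    have : (n : ℝ) + 1 ≠ 0 := by positivity
    change _ = 2 * (δ / (2 * ((n : ℝ) + 1)))
    field_simp
  have hφδ : ∀ n, (φ n).rOut ≤ δ := by
    intro n
    change 2 * (δ / (2 * ((n : ℝ) + 1))) ≤ δ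
    rw [← mul_div_assoc, div_le_iff₀ (by positivity)]
    have : (0 : ℝ) ≤ n := n.cast_nonneg
    nlinarith
  set fn : ℕ → Space N → ℝ := fun n =>
    convolution ((φ n).normed volume) f₁ (ContinuousLinearMap.lsmul ℝ ℝ) volume with hfn
  set gn : ℕ → Space N → Space N := fun n =>
    convolution ((φ n).normed volume) g₁ (ContinuousLinearMap.lsmul ℝ ℝ) volume with hgn
  have hfnsm : ∀ n, ContDiff ℝ ∞ (fn n) := fun n =>
    (φ n).hasCompactSupport_normed.contDiff_convolution_left _ (φ n).contDiff_normed
      hfi.locallyIntegrable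
  have hgnc : ∀ n, Continuous (gn n) := fun n =>
    (φ n).hasCompactSupport_normed.continuous_convolution_left _ (φ n).continuous_normed
      hgi.locallyIntegrable
  have hfng : ∀ n, ∀ x ∈ tsupport η, fderiv ℝ (fn n) x e = inner ℝ (gn n x) e := by
    intro n x hx
    refine h.fderiv_convolution hK hδE (φ n) ?_ e
    exact (Metric.closedBall_subset_closedBall (hφδ n)).trans
      (Metric.closedBall_subset_cthickening hx δ)
  have hHc : Continuous H := continuous_iff_continuousAt.2 fun s => (hH s).continuousAt
  have hHlip : ∀ a b, |H a - H b| ≤ M * |a - b| := fun a b =>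
    Convex.norm_image_sub_le_of_norm_hasDerivWithin_le (f := H) (f' := H') (s := univ)
      (fun s _ => (hH s).hasDerivWithinAt) (fun s _ => hH' s) convex_univ (mem_univ b) (mem_univ a)
  set σ : Space N → ℝ := fun x => η x * fderiv ℝ ψ x e + ψ x * lineDeriv ℝ η x e with hσ
  set χ : Space N → ℝ := fun x => η x * ψ x with hχ
  have hψ' : Continuous fun x => fderiv ℝ ψ x e :=
    (hψ.continuous_fderiv (by simp)).clm_apply continuous_const
  have hσ_meas : Measurable σ :=
    (hη.continuous.measurable.mul hψ'.measurable).add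
      (hψ.continuous.measurable.mul (measurable_lineDeriv hη.continuous))
  have hχc : Continuous χ := hη.continuous.mul hψ.continuous
  have hη0 : ∀ x, x ∉ tsupport η → η x = 0 := fun x hx => image_eq_zero_of_notMem_tsupport hx
  have hηd0 : ∀ x, x ∉ tsupport η → lineDeriv ℝ η x e = 0 := by
    intro x hx
    have h1 : η =ᶠ[𝓝 x] fun _ => 0 := notMem_tsupport_iff_eventuallyEq.1 hx
    have h2 : HasFDerivAt η (0 : Space N →L[ℝ] ℝ) x :=
      (hasFDerivAt_const (0 : ℝ) x).congr_of_eventuallyEq h1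
    simpa using (h2.hasLineDerivAt e).lineDeriv
  have hσ0 : ∀ x, x ∉ tsupport η → σ x = 0 := fun x hx => by simp [hσ, hη0 x hx, hηd0 x hx]
  have hχ0 : ∀ x, x ∉ tsupport η → χ x = 0 := fun x hx => by simp [hχ, hη0 x hx]
  obtain ⟨B, hB⟩ : ∃ B, ∀ x, |σ x| ≤ B := by
    obtain ⟨B1, hB1⟩ := (hη.continuous.mul hψ').bounded_above_of_compact_support hηs.mul_right
    obtain ⟨B2, hB2⟩ := hψ.continuous.bounded_above_of_compact_support hψs
    refine ⟨B1 + B2 * (L * ‖e‖), fun x => (abs_add_le _ _).trans (add_le_add (hB1 x) ?_)⟩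
    rw [abs_mul]
    exact mul_le_mul (hB2 x) (norm_lineDeriv_le_of_lipschitz ℝ hη) (abs_nonneg _)
      ((norm_nonneg _).trans (hB2 x))
  obtain ⟨D, hD⟩ : ∃ D, ∀ x, |χ x| ≤ D := hχc.bounded_above_of_compact_support hηs.mul_right
  have hB0 : 0 ≤ B := (abs_nonneg _).trans (hB 0)
  have hD0 : 0 ≤ D := (abs_nonneg _).trans (hD 0)
  have hσi : Integrable σ volume := by
    have : IntegrableOn σ (tsupport η) volume :=
      IntegrableOn.of_bound hηs.isCompact.measure_lt_top hσ_meas.aestronglyMeasurable B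
        (Eventually.of_forall hB)
    refine this.integrable_of_forall_notMem_eq_zero hσ0
  have hσb : ∀ {q : Space N → ℝ}, Integrable q volume → Integrable (fun x => q x * σ x) volume :=
    fun {q} hq => hq.mul_bdd (c := B) hσ_meas.aestronglyMeasurable (Eventually.of_forall hB)
  have hHq : ∀ {q : Space N → ℝ}, Integrable q volume →
      Integrable (fun x => H (q x) * σ x) volume := by
    intro q hq
    have h1 : Integrable (fun x => |H 0| * |σ x| + M * B * |q x|) volume :=
      (hσi.abs.const_mul _).add (hq.abs.const_mul _)
    refine h1.mono' ((hHc.comp_aestronglyMeasurable hq.1).mul hσ_meas.aestronglyMeasurable) ?_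
    refine Eventually.of_forall fun x => ?_
    rw [Real.norm_eq_abs, abs_mul]
    have h2 : |H (q x)| ≤ |H 0| + M * |q x| := by
      have := hHlip (q x) 0
      rw [sub_zero] at this
      linarith [abs_sub_abs_le_abs_sub (H (q x)) (H 0)]
    nlinarith [mul_le_mul_of_nonneg_right h2 (abs_nonneg (σ x)),
      mul_le_mul_of_nonneg_left (hB x) (mul_nonneg hM (abs_nonneg (q x)))]
  have hH'q : ∀ {q : Space N → ℝ} {r : Space N → Space N}, AEStronglyMeasurable q volume →
      Integrable r volume → Integrable (fun x => H' (q x) * inner ℝ (r x) e * χ x) volume := by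
    intro q r hq hr
    have h1 : Integrable (fun x => inner ℝ (r x) e) volume := hr.inner_const e
    refine Integrable.mul_bdd (c := D) ?_ hχc.aestronglyMeasurable (Eventually.of_forall hD)
    exact h1.bdd_mul (c := M) (hH'c.comp_aestronglyMeasurable hq) (Eventually.of_forall fun x => hH' _)
  -- integration by parts for the mollified function
  have hzero : ∀ n, ∫ x, (H (fn n x) * σ x + H' (fn n x) * inner ℝ (gn n x) e * χ x) = 0 := by
    intro n
    have hHsm : ContDiff ℝ 1 H := by
      rw [contDiff_one_iff_deriv]
      refine ⟨fun s => (hH s).differentiableAt, ?_⟩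
      convert hH'c using 1
      ext s
      exact (hH s).deriv
    have hθsm : ContDiff ℝ 1 (fun x => H (fn n x) * ψ x) :=
      (hHsm.comp ((hfnsm n).of_le (by simp))).mul (hψ.of_le (by simp))
    have hθs : HasCompactSupport (fun x => H (fn n x) * ψ x) := hψs.mul_left
    obtain ⟨L', hL'⟩ := hθsm.lipschitzWith_of_hasCompactSupport hθs (by simp)
    have hip := hη.integral_lineDeriv_mul_eq (μ := volume) hL' hθs e
    have hθd : ∀ x, lineDeriv ℝ (fun x => H (fn n x) * ψ x) x (-e) =
        -(H' (fn n x) * fderiv ℝ (fn n) x e * ψ x + H (fn n x) * fderiv ℝ ψ x e) := by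
      intro x
      have h1 : HasFDerivAt (fn n) (fderiv ℝ (fn n) x) x :=
        ((hfnsm n).differentiable (by simp) x).hasFDerivAt
      have h2 : HasFDerivAt ψ (fderiv ℝ ψ x) x := (hψ.differentiable (by simp) x).hasFDerivAt
      have h3 : HasFDerivAt (fun x => H (fn n x) * ψ x) _ x :=
        ((hH (fn n x)).comp_hasFDerivAt x h1).mul h2
      rw [(h3.hasLineDerivAt (-e)).lineDeriv]
      simp
      ring
    simp_rw [hθd] at hip
    have hi1 : Integrable (fun x => H (fn n x) * (ψ x * lineDeriv ℝ η x e)) volume := by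
      have hc : Continuous fun x => H (fn n x) * ψ x := (hHc.comp (hfnsm n).continuous).mul
        hψ.continuous
      have := (hc.integrable_of_hasCompactSupport (μ := volume) hθs).mul_bdd (c := L * ‖e‖)
        (measurable_lineDeriv (𝕜 := ℝ) (v := e) hη.continuous).aestronglyMeasurable
        (Eventually.of_forall fun x => norm_lineDeriv_le_of_lipschitz ℝ hη)
      refine this.congr (Eventually.of_forall fun x => ?_)
      simp only []
      ring
    have hi2 : Integrable (fun x => H (fn n x) * (η x * fderiv ℝ ψ x e)) volume := by
      have hc : Continuous fun x => H (fn n x) * (η x * fderiv ℝ ψ x e) :=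
        (hHc.comp (hfnsm n).continuous).mul (hη.continuous.mul hψ')
      exact hc.integrable_of_hasCompactSupport hηs.mul_right.mul_left
    have hi3 : Integrable (fun x => H' (fn n x) * inner ℝ (gn n x) e * χ x) volume := by
      have hc : Continuous fun x => H' (fn n x) * inner ℝ (gn n x) e * χ x :=
        ((hH'c.comp (hfnsm n).continuous).mul ((hgnc n).inner continuous_const)).mul hχc
      exact hc.integrable_of_hasCompactSupport hηs.mul_right.mul_left
    have e1 : ∫ x, lineDeriv ℝ η x e * (H (fn n x) * ψ x) =
        ∫ x, H (fn n x) * (ψ x * lineDeriv ℝ η x e) :=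
      integral_congr_ae (Eventually.of_forall fun x => by simp only []; ring)
    have e2 : ∫ x, -(H' (fn n x) * fderiv ℝ (fn n) x e * ψ x + H (fn n x) * fderiv ℝ ψ x e) * η x =
        -∫ x, (H (fn n x) * (η x * fderiv ℝ ψ x e) +
          H' (fn n x) * inner ℝ (gn n x) e * χ x) := by
      rw [← integral_neg]
      refine integral_congr_ae (Eventually.of_forall fun x => ?_)
      by_cases hx : x ∈ tsupport η
      · simp only [hfng n x hx, hχ]; ring
      · simp [hη0 x hx, hχ]
    rw [e1, e2, integral_add hi2 hi3] at hip
    have e3 : ∫ x, (H (fn n x) * σ x + H' (fn n x) * inner ℝ (gn n x) e * χ x) =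
        ∫ x, ((H (fn n x) * (η x * fderiv ℝ ψ x e) + H (fn n x) * (ψ x * lineDeriv ℝ η x e)) +
          H' (fn n x) * inner ℝ (gn n x) e * χ x) :=
      integral_congr_ae (Eventually.of_forall fun x => by simp only [hσ]; ring)
    rw [e3, integral_add (hi2.fun_add hi1) hi3, integral_add hi2 hi1]
    linarith
  -- passage to the limit in the coefficient of the weak gradient
  have hae : ∀ᵐ x, Tendsto (fun n => fn n x) atTop (𝓝 (f₁ x)) :=
    ContDiffBump.ae_convolution_tendsto_right_of_locallyIntegrable (K := 2) hφ
      (Eventually.of_forall fun n => le_rfl) hfi.locallyIntegrable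
  have hlim1 : Tendsto (fun n => ∫ x, (H (f₁ x) * σ x + H' (fn n x) * inner ℝ (g₁ x) e * χ x))
      atTop (𝓝 (∫ x, (H (f₁ x) * σ x + H' (f₁ x) * inner ℝ (g₁ x) e * χ x))) := by
    refine tendsto_integral_of_dominated_convergence
      (fun x => |H (f₁ x) * σ x| + M * |inner ℝ (g₁ x) e| * D) (fun n => ?_) ?_ (fun n => ?_) ?_
    · exact ((hHq hfi).add (hH'q (hfnsm n).continuous.aestronglyMeasurable hgi)).1
    · exact (hHq hfi).abs.add (((hgi.inner_const e).abs.const_mul M).mul_const D)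
    · refine Eventually.of_forall fun x => (norm_add_le _ _).trans ?_
      refine add_le_add le_rfl ?_
      rw [Real.norm_eq_abs, abs_mul, abs_mul]
      gcongr
      exacts [hH' _, hD x]
    · filter_upwards [hae] with x hx
      exact tendsto_const_nhds.add
        ((((hH'c.tendsto _).comp hx).mul tendsto_const_nhds).mul tendsto_const_nhds)
  have hF := tendsto_eLpNorm_normed_convolution_sub hfi hφ
  have hG := tendsto_eLpNorm_normed_convolution_sub hgi hφ
  have hlim2 : Tendsto (fun n => (∫ x, (H (fn n x) * σ x + H' (fn n x) * inner ℝ (gn n x) e * χ x))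
      - ∫ x, (H (f₁ x) * σ x + H' (fn n x) * inner ℝ (g₁ x) e * χ x)) atTop (𝓝 0) := by
    have hfni : ∀ n, Integrable (fn n) volume := fun n =>
      ((φ n).continuous_normed.integrable_of_hasCompactSupport
        (φ n).hasCompactSupport_normed).integrable_convolution _ hfi
    have hgni : ∀ n, Integrable (gn n) volume := fun n =>
      ((φ n).continuous_normed.integrable_of_hasCompactSupport
        (φ n).hasCompactSupport_normed).integrable_convolution _ hgi
    have hfs : ∀ n, Integrable (fun x => fn n x - f₁ x) volume := fun n => (hfni n).sub hfi
    have hgs : ∀ n, Integrable (fun x => gn n x - g₁ x) volume := fun n => (hgni n).sub hgi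
    have hb : Tendsto (fun n => M * B * (eLpNorm (fun x => fn n x - f₁ x) 1 volume).toReal +
        M * ‖e‖ * D * (eLpNorm (fun x => gn n x - g₁ x) 1 volume).toReal) atTop (𝓝 0) := by
      have h1 := (ENNReal.tendsto_toReal ENNReal.zero_ne_top).comp hF
      have h2 := (ENNReal.tendsto_toReal ENNReal.zero_ne_top).comp hG
      simpa using (h1.const_mul (M * B)).add (h2.const_mul (M * ‖e‖ * D))
    refine squeeze_zero_norm (fun n => ?_) hb
    have hfd : (eLpNorm (fun x => fn n x - f₁ x) 1 volume).toReal = ∫ x, ‖fn n x - f₁ x‖ := by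
      rw [eLpNorm_one_eq_lintegral_enorm, integral_norm_eq_lintegral_enorm (hfs n).1]
    have hgd : (eLpNorm (fun x => gn n x - g₁ x) 1 volume).toReal = ∫ x, ‖gn n x - g₁ x‖ := by
      rw [eLpNorm_one_eq_lintegral_enorm, integral_norm_eq_lintegral_enorm (hgs n).1]
    rw [hfd, hgd, ← integral_sub
      ((hHq (hfni n)).fun_add (hH'q (hfni n).1 (hgni n))) ((hHq hfi).fun_add (hH'q (hfni n).1 hgi)),
      ← integral_const_mul, ← integral_const_mul,
      ← integral_add ((hfs n).norm.const_mul _) ((hgs n).norm.const_mul _)]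
    refine norm_integral_le_of_norm_le
      (((hfs n).norm.const_mul _).add ((hgs n).norm.const_mul _))
      (Eventually.of_forall fun x => ?_)
    have e1 : H (fn n x) * σ x + H' (fn n x) * inner ℝ (gn n x) e * χ x -
        (H (f₁ x) * σ x + H' (fn n x) * inner ℝ (g₁ x) e * χ x) =
        (H (fn n x) - H (f₁ x)) * σ x + H' (fn n x) * inner ℝ (gn n x - g₁ x) e * χ x := by
      rw [inner_sub_left]; ring
    rw [e1]
    refine (norm_add_le _ _).trans (add_le_add ?_ ?_)
    · rw [norm_mul, mul_right_comm]
      exact mul_le_mul (hHlip _ _) (hB x) (norm_nonneg _) (by positivity)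
    · rw [norm_mul, norm_mul]
      calc ‖H' (fn n x)‖ * ‖inner ℝ (gn n x - g₁ x) e‖ * ‖χ x‖
          ≤ M * (‖gn n x - g₁ x‖ * ‖e‖) * D :=
            mul_le_mul (mul_le_mul (hH' _) (norm_inner_le_norm _ _) (norm_nonneg _) hM) (hD x)
              (norm_nonneg _) (by positivity)
        _ = M * ‖e‖ * D * ‖gn n x - g₁ x‖ := by ring
  have hlim := hlim2.add hlim1
  simp only [sub_add_cancel, hzero, zero_add] at hlim
  refine Eq.trans ?_ (tendsto_nhds_unique hlim tendsto_const_nhds)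
  refine integral_congr_ae (Eventually.of_forall fun x => ?_)
  by_cases hx : x ∈ tsupport η
  · simp [hf₁, hg₁, hsub hx, hσ, hχ]
  · simp [hη0 x hx, hηd0 x hx, hσ0 x hx, hχ0 x hx]

/-- The chain and product rules for `H(f) η`, where `H` is a primitive of a bounded pointwise limit
`h` of continuous functions. No information on the weak gradient on level sets of `f` is needed,
because every such limit is an admissible representative of the derivative of `H`. -/
theorem HasWeakGradient.integral_comp_mul {E : Set (Space N)} (hE : IsOpen E)
    {f : Space N → ℝ} {g : Space N → Space N} (h : HasWeakGradient E f g)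
    {η : Space N → ℝ} {L : ℝ≥0} (hη : LipschitzWith L η) (hηs : HasCompactSupport η)
    (hηE : tsupport η ⊆ E) {d : ℝ → ℝ} {dn : ℕ → ℝ → ℝ} {M : ℝ} (hdnc : ∀ n, Continuous (dn n))
    (hdnb : ∀ n s, |dn n s| ≤ M) (hdn : ∀ s, Tendsto (fun n => dn n s) atTop (𝓝 (d s))) (K : ℝ)
    {ψ : Space N → ℝ} (hψ : ContDiff ℝ ∞ ψ) (hψs : HasCompactSupport ψ) (e : Space N) :
    ∫ x, ((∫ r in K..f x, d r) * (η x * fderiv ℝ ψ x e + ψ x * lineDeriv ℝ η x e) +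
      d (f x) * inner ℝ (g x) e * (η x * ψ x)) = 0 := by
  have hψ' : Continuous fun x => fderiv ℝ ψ x e :=
    (hψ.continuous_fderiv (by simp)).clm_apply continuous_const
  set σ : Space N → ℝ := fun x => η x * fderiv ℝ ψ x e + ψ x * lineDeriv ℝ η x e with hσ
  have hσ_meas : Measurable σ :=
    (hη.continuous.measurable.mul hψ'.measurable).add
      (hψ.continuous.measurable.mul (measurable_lineDeriv hη.continuous))
  have hχc : Continuous fun x => η x * ψ x := hη.continuous.mul hψ.continuous
  have hKc : IsCompact (tsupport η) := hηs.isCompact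
  have hη0 : ∀ x, x ∉ tsupport η → η x = 0 := fun x hx => image_eq_zero_of_notMem_tsupport hx
  have hηd0 : ∀ x, x ∉ tsupport η → lineDeriv ℝ η x e = 0 := by
    intro x hx
    have h1 : η =ᶠ[𝓝 x] fun _ => 0 := notMem_tsupport_iff_eventuallyEq.1 hx
    have h2 : HasFDerivAt η (0 : Space N →L[ℝ] ℝ) x :=
      (hasFDerivAt_const (0 : ℝ) x).congr_of_eventuallyEq h1
    simpa using (h2.hasLineDerivAt e).lineDeriv
  have hσ0 : ∀ x, x ∉ tsupport η → σ x = 0 := fun x hx => by simp [hσ, hη0 x hx, hηd0 x hx]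
  obtain ⟨B, hB⟩ : ∃ B, ∀ x, |σ x| ≤ B := by
    obtain ⟨B1, hB1⟩ := (hη.continuous.mul hψ').bounded_above_of_compact_support hηs.mul_right
    obtain ⟨B2, hB2⟩ := hψ.continuous.bounded_above_of_compact_support hψs
    refine ⟨B1 + B2 * (L * ‖e‖), fun x => (abs_add_le _ _).trans (add_le_add (hB1 x) ?_)⟩
    rw [abs_mul]
    exact mul_le_mul (hB2 x) (norm_lineDeriv_le_of_lipschitz ℝ hη) (abs_nonneg _)
      ((norm_nonneg _).trans (hB2 x))
  obtain ⟨D, hD⟩ : ∃ D, ∀ x, |η x * ψ x| ≤ D :=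
    hχc.bounded_above_of_compact_support hηs.mul_right
  have hM : 0 ≤ M := (abs_nonneg _).trans (hdnb 0 0)
  have hfi : IntegrableOn f (tsupport η) volume := h.locInt.integrableOn_compact_subset hηE hKc
  have hgi : IntegrableOn g (tsupport η) volume :=
    h.locInt_grad.integrableOn_compact_subset hηE hKc
  have hHn : ∀ n s, HasDerivAt (fun s => ∫ r in K..s, dn n r) (dn n s) s := fun n s =>
    intervalIntegral.integral_hasDerivAt_right ((hdnc n).intervalIntegrable _ _)
      ((hdnc n).stronglyMeasurableAtFilter _ _) (hdnc n).continuousAt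
  have hstep := fun n => h.integral_comp_mul_of_continuous_deriv hE hη hηs hηE (hHn n) (hdnc n)
    (hdnb n) hψ hψs e
  have hloc : ∀ q : ℝ → ℝ, ∀ d' : ℝ → ℝ,
      ∫ x, (q (f x) * σ x + d' (f x) * inner ℝ (g x) e * (η x * ψ x)) =
      ∫ x in tsupport η, (q (f x) * σ x + d' (f x) * inner ℝ (g x) e * (η x * ψ x)) := by
    intro q d'
    rw [setIntegral_eq_integral_of_forall_compl_eq_zero]
    intro x hx
    simp [hσ0 x hx, hη0 x hx]
  have hlim : Tendsto (fun n => ∫ x in tsupport η, ((∫ r in K..f x, dn n r) * σ x +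
      dn n (f x) * inner ℝ (g x) e * (η x * ψ x))) atTop
      (𝓝 (∫ x in tsupport η, ((∫ r in K..f x, d r) * σ x +
        d (f x) * inner ℝ (g x) e * (η x * ψ x)))) := by
    have : IsFiniteMeasure (volume.restrict (tsupport η)) := ⟨by simpa using hKc.measure_lt_top⟩
    refine tendsto_integral_of_dominated_convergence
      (fun x => M * |f x - K| * B + M * |inner ℝ (g x) e| * D) (fun n => ?_) ?_ (fun n => ?_) ?_
    · have hc : Continuous fun s => ∫ r in K..s, dn n r :=
        continuous_iff_continuousAt.2 fun s => (hHn n s).continuousAt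
      exact ((hc.comp_aestronglyMeasurable hfi.1).mul hσ_meas.aestronglyMeasurable).add
        ((((hdnc n).comp_aestronglyMeasurable hfi.1).mul
          (hgi.1.inner aestronglyMeasurable_const)).mul hχc.aestronglyMeasurable)
    · exact (((hfi.sub (integrable_const K)).abs.const_mul M).mul_const B).add
        (((hgi.inner_const e).abs.const_mul M).mul_const D)
    · refine Eventually.of_forall fun x => (norm_add_le _ _).trans (add_le_add ?_ ?_)
      · rw [norm_mul]
        refine mul_le_mul ?_ (hB x) (norm_nonneg _) (by positivity)
        exact intervalIntegral.norm_integral_le_of_norm_le_const fun r _ => hdnb n r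
      · rw [norm_mul, norm_mul]
        exact mul_le_mul (mul_le_mul (hdnb n _) le_rfl (norm_nonneg _) hM) (hD x)
          (norm_nonneg _) (by positivity)
    · refine Eventually.of_forall fun x => ?_
      have h1 : Tendsto (fun n => ∫ r in K..f x, dn n r) atTop (𝓝 (∫ r in K..f x, d r)) := by
        refine intervalIntegral.tendsto_integral_filter_of_dominated_convergence (fun _ => M)
          (Eventually.of_forall fun n => (hdnc n).aestronglyMeasurable)
          (Eventually.of_forall fun n => Eventually.of_forall fun r _ => hdnb n r)
          (by simp) (Eventually.of_forall fun r _ => hdn r)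
      exact (h1.mul tendsto_const_nhds).add
        (((hdn _).mul tendsto_const_nhds).mul tendsto_const_nhds)
  have e1 := hloc (fun s => ∫ r in K..s, d r) d
  rw [e1]
  refine tendsto_nhds_unique hlim ?_
  refine tendsto_const_nhds.congr fun n => ?_
  exact ((hloc (fun s => ∫ r in K..s, dn n r) (dn n)).symm.trans (hstep n)).symm

/-! ### Slice gradients in space-time -/

section Mollification

variable {G F : Type*} [NormedAddCommGroup G] [NormedSpace ℝ G] [FiniteDimensional ℝ G]
  [MeasurableSpace G] [BorelSpace G] {μ : Measure G} [μ.IsAddHaarMeasure]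
  [NormedAddCommGroup F] [InnerProductSpace ℝ F] [CompleteSpace F]

/-- Pairing with a mollification amounts to averaging the correlation function. -/
theorem integral_inner_convolution {p q : ℝ≥0∞} [p.HolderConjugate q] (hq : q ≠ ⊤) {a W : G → F}
    (ha : MemLp a p μ) (hW : MemLp W q μ) {κ : G → ℝ} (hκ : Continuous κ)
    (hκs : HasCompactSupport κ) :
    ∫ z, inner ℝ (a z) (convolution κ W (ContinuousLinearMap.lsmul ℝ ℝ) μ z) ∂μ =
      ∫ y, κ y * ∫ z, inner ℝ (a z) (W (z - y)) ∂μ ∂μ := by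
  have hq1 : 1 ≤ q := ENNReal.HolderConjugate.one_le q p
  have hmeas : AEStronglyMeasurable (fun zy : G × G => κ zy.2 * inner ℝ (a zy.1) (W (zy.1 - zy.2)))
      (μ.prod μ) :=
    (hκ.comp continuous_snd).aestronglyMeasurable.mul
      ((ha.1.comp_fst).inner (hW.1.comp_quasiMeasurePreserving
        (quasiMeasurePreserving_sub_of_right_invariant μ μ)))
  have hWy : ∀ y, MemLp (fun z => W (z - y)) q μ := fun y =>
    hW.comp_measurePreserving (measurePreserving_sub_right μ y)
  have hprod : ∀ y, Integrable (fun z => ‖a z‖ * ‖W (z - y)‖) μ := fun y =>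
    MemLp.integrable_mul (f := fun z => ‖a z‖) (g := fun z => ‖W (z - y)‖) (p := p) (q := q)
      ha.norm (hWy y).norm
  have hint : Integrable (fun zy : G × G => κ zy.2 * inner ℝ (a zy.1) (W (zy.1 - zy.2)))
      (μ.prod μ) := by
    rw [integrable_prod_iff' hmeas]
    constructor
    · refine Eventually.of_forall fun y => ?_
      have h1 : Integrable (fun z => inner ℝ (a z) (W (z - y))) μ :=
        (hprod y).mono' (ha.1.inner (hWy y).1)
          (Eventually.of_forall fun z => norm_inner_le_norm _ _)
      exact h1.const_mul (κ y)
    · have hc : Continuous fun y => ∫ z, inner ℝ ‖a z‖ ‖W (z - y)‖ ∂μ :=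
        continuous_integral_inner_translate (p := p) (q := q) hq (a := fun z => ‖a z‖)
          (W := fun z => ‖W z‖) ha.norm hW.norm
      have hd : Integrable (fun y => |κ y| * ∫ z, inner ℝ ‖a z‖ ‖W (z - y)‖ ∂μ) μ :=
        (hκ.abs.mul hc).integrable_of_hasCompactSupport (hκs.comp_left abs_zero).mul_right
      refine hd.mono' hmeas.norm.prod_swap.integral_prod_right' (Eventually.of_forall fun y => ?_)
      rw [Real.norm_of_nonneg (integral_nonneg fun z => norm_nonneg _), ← integral_const_mul]
      refine integral_mono_of_nonneg (Eventually.of_forall fun z => norm_nonneg _) ?_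
        (Eventually.of_forall fun z => ?_)
      · refine ((hprod y).const_mul |κ y|).congr (Eventually.of_forall fun z => ?_)
        simp [mul_comm]
      · simp only [norm_mul, Real.norm_eq_abs]
        gcongr
        refine (abs_real_inner_le_norm _ _).trans (le_of_eq ?_)
        simp [mul_comm]
  have hex : ∀ z, Integrable (fun y => κ y • W (z - y)) μ := fun z =>
    hκs.convolutionExists_left (ContinuousLinearMap.lsmul ℝ ℝ) hκ
      (hW.locallyIntegrable hq1) z
  calc ∫ z, inner ℝ (a z) (convolution κ W (ContinuousLinearMap.lsmul ℝ ℝ) μ z) ∂μ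
      = ∫ z, ∫ y, κ y * inner ℝ (a z) (W (z - y)) ∂μ ∂μ := by
        refine integral_congr_ae (Eventually.of_forall fun z => ?_)
        simp only [convolution_lsmul]
        rw [← integral_inner (hex z)]
        simp [inner_smul_right]
    _ = ∫ y, ∫ z, κ y * inner ℝ (a z) (W (z - y)) ∂μ ∂μ := integral_integral_swap hint
    _ = _ := by simp_rw [integral_const_mul]

end Mollification

instance isAddHaarMeasure_volume_spaceTime : (volume : Measure (SpaceTime N)).IsAddHaarMeasure :=
  inferInstanceAs ((volume : Measure (Space N)).prod (volume : Measure ℝ)).IsAddHaarMeasure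

theorem timeDeriv_eq_fderiv {φ : SpaceTime N → ℝ} {z : SpaceTime N}
    (h : DifferentiableAt ℝ φ z) : timeDeriv φ z = fderiv ℝ φ z (0, 1) := by
  have h1 : HasFDerivAt φ (fderiv ℝ φ z) (z.1, z.2) := h.hasFDerivAt
  have h2 : HasDerivAt (fun s : ℝ => (z.1, s)) ((0 : Space N), (1 : ℝ)) z.2 :=
    (hasDerivAt_const z.2 z.1).prodMk (hasDerivAt_id z.2)
  exact (h1.comp_hasDerivAt z.2 h2).deriv

theorem inner_spaceGrad_eq_fderiv {φ : SpaceTime N → ℝ} {z : SpaceTime N}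
    (h : DifferentiableAt ℝ φ z) (e : Space N) :
    inner ℝ (spaceGrad φ z) e = fderiv ℝ φ z (e, 0) := by
  have h1 : HasFDerivAt φ (fderiv ℝ φ z) (z.1, z.2) := h.hasFDerivAt
  have h2 : HasFDerivAt (fun y : Space N => (y, z.2))
      ((ContinuousLinearMap.id ℝ (Space N)).prod 0) z.1 :=
    (hasFDerivAt_id z.1).prodMk (hasFDerivAt_const z.2 z.1)
  have h3 := (h1.comp z.1 h2).fderiv
  rw [spaceGrad, inner_gradient_eq_fderiv]
  have h4 : fderiv ℝ (fun y => φ (y, z.2)) z.1 = _ := h3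
  rw [h4]
  simp

/-- `W` is the spatial weak gradient of `w`, in the whole space and on almost every time slice, tested
in each direction `e`. Only the integral identity is recorded; the integrability that gives it a
meaning is assumed separately where it is used. -/
def HasSliceGradient (w : SpaceTime N → ℝ) (W : SpaceTime N → Space N) : Prop :=
  ∀ᵐ s : ℝ, ∀ ψ : Space N → ℝ, ContDiff ℝ ∞ ψ → HasCompactSupport ψ → ∀ e : Space N,
    ∫ x, (w (x, s) * fderiv ℝ ψ x e + ψ x * inner ℝ (W (x, s)) e) = 0

theorem fderiv_convolution_apply {κ : SpaceTime N → ℝ} (hκ : ContDiff ℝ ∞ κ)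
    (hκs : HasCompactSupport κ) {w : SpaceTime N → ℝ} (hw : LocallyIntegrable w)
    (z b : SpaceTime N) :
    fderiv ℝ (convolution κ w (ContinuousLinearMap.lsmul ℝ ℝ) volume) z b =
      ∫ y, fderiv ℝ κ (z - y) b * w y := by
  have hd := (hκs.hasFDerivAt_convolution_left (ContinuousLinearMap.lsmul ℝ ℝ)
    (hκ.of_le (by simp)) hw z).fderiv
  have hint : Integrable (fun y => ((ContinuousLinearMap.lsmul ℝ ℝ (E := ℝ)).precompL (SpaceTime N))
      (fderiv ℝ κ (z - y)) (w y)) volume := by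
    have := (hκs.fderiv (𝕜 := ℝ)).convolutionExists_left
      ((ContinuousLinearMap.lsmul ℝ ℝ (E := ℝ)).precompL (SpaceTime N))
      (hκ.continuous_fderiv (by simp)) hw z
    exact this.integrable_swap
  rw [hd, convolution_eq_swap, ContinuousLinearMap.integral_apply hint]
  refine integral_congr_ae (Eventually.of_forall fun y => ?_)
  simp [ContinuousLinearMap.precompL_apply]

/-- Mollification in space-time commutes with the spatial weak gradient. -/
theorem HasSliceGradient.spaceGrad_convolution {w : SpaceTime N → ℝ} {W : SpaceTime N → Space N}
    (h : HasSliceGradient w W) (hw : LocallyIntegrable w) (hW : LocallyIntegrable W)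
    {κ : SpaceTime N → ℝ} (hκ : ContDiff ℝ ∞ κ) (hκs : HasCompactSupport κ) (z : SpaceTime N) :
    spaceGrad (convolution κ w (ContinuousLinearMap.lsmul ℝ ℝ) volume) z =
      convolution κ W (ContinuousLinearMap.lsmul ℝ ℝ) volume z := by
  refine ext_inner_right ℝ fun e => ?_
  have hdiff : DifferentiableAt ℝ
      (convolution κ w (ContinuousLinearMap.lsmul ℝ ℝ) volume) z :=
    (hκs.hasFDerivAt_convolution_left (ContinuousLinearMap.lsmul ℝ ℝ)
      (hκ.of_le (by simp)) hw z).differentiableAt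
  have hκd : Continuous (fderiv ℝ κ) := hκ.continuous_fderiv (by simp)
  have hWint : Integrable (fun y => κ (z - y) • W y) volume :=
    (hκs.convolutionExists_left (ContinuousLinearMap.lsmul ℝ ℝ) hκ.continuous hW z).integrable_swap
  have hwint : Integrable (fun y => fderiv ℝ κ (z - y) (e, 0) * w y) volume := by
    have hc : Continuous fun y => fderiv ℝ κ y (e, 0) := hκd.clm_apply continuous_const
    have hs : HasCompactSupport fun y => fderiv ℝ κ y (e, 0) :=
      (hκs.fderiv (𝕜 := ℝ)).comp_left (g := fun l : SpaceTime N →L[ℝ] ℝ => l (e, 0)) (by simp)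
    exact (hs.convolutionExists_left (ContinuousLinearMap.lsmul ℝ ℝ) hc hw z).integrable_swap
  rw [inner_spaceGrad_eq_fderiv hdiff, fderiv_convolution_apply hκ hκs hw, convolution_lsmul_swap,
    real_inner_comm, ← integral_inner hWint]
  rw [← sub_eq_zero, ← integral_sub hwint (hWint.const_inner e)]
  have hI := hwint.sub (hWint.const_inner e)
  have hI' : Integrable (fun y : SpaceTime N => fderiv ℝ κ (z - y) (e, 0) * w y -
      inner ℝ e (κ (z - y) • W y)) (volume.prod volume) := hI
  change ∫ y : SpaceTime N, (fderiv ℝ κ (z - y) (e, 0) * w y -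
      inner ℝ e (κ (z - y) • W y)) ∂(volume.prod volume) = 0
  rw [integral_prod_symm _ hI']
  refine integral_eq_zero_of_ae ?_
  filter_upwards [h] with s hs
  -- the slice of the reflected mollifier is the test function
  set ψ : Space N → ℝ := fun x => κ (z - (x, s)) with hψ
  have hψsm : ContDiff ℝ ∞ ψ := hκ.comp (contDiff_const.sub (contDiff_id.prodMk contDiff_const))
  have hψs : HasCompactSupport ψ := by
    refine HasCompactSupport.of_support_subset_isCompact
      ((hκs.isCompact.image (f := fun y : SpaceTime N => z.1 - y.1) (by fun_prop))) ?_
    intro x hx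
    refine ⟨z - (x, s), subset_tsupport _ hx, ?_⟩
    simp
  have hψd : ∀ x, fderiv ℝ ψ x e = -fderiv ℝ κ (z - (x, s)) (e, 0) := by
    intro x
    have h1 : HasFDerivAt κ (fderiv ℝ κ (z - (x, s))) (z - (x, s)) :=
      (hκ.differentiable (by simp) _).hasFDerivAt
    have h2 : HasFDerivAt (fun x : Space N => z - (x, s))
        (-((ContinuousLinearMap.id ℝ (Space N)).prod (0 : Space N →L[ℝ] ℝ))) x :=
      ((hasFDerivAt_id x).prodMk (hasFDerivAt_const s x)).const_sub z
    have h3 : fderiv ℝ ψ x = _ := (h1.comp x h2).fderiv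
    rw [h3]
    simp
  have := hs ψ hψsm hψs e
  rw [← neg_eq_zero, ← integral_neg] at this
  refine Eq.trans (integral_congr_ae (Eventually.of_forall fun x => ?_)) this
  simp only [hψd, inner_smul_right, real_inner_comm e]
  simp only [hψ]
  rw [real_inner_comm]
  ring

/-! ### From distributional to pointwise inequalities -/

/-- A continuous function `U` with `∂U/∂t + F ≥ 0` in the sense of distributions near the origin,
for a continuous `F`, decreases in time no faster than `F` allows. -/
theorem eventually_le_sub_of_distributional {U F : SpaceTime N → ℝ} (hU : Continuous U)
    (hF : Continuous F) {r : ℝ} (hr : 0 < r)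
    (h : ∀ κ : SpaceTime N → ℝ, ContDiff ℝ ∞ κ → HasCompactSupport κ →
      tsupport κ ⊆ Metric.closedBall 0 r → (∀ z, 0 ≤ κ z) →
      0 ≤ -(∫ z, fderiv ℝ κ z (0, 1) * U z) + ∫ z, κ z * F z) {ε : ℝ} (hε : 0 < ε) :
    ∀ᶠ s : ℝ in 𝓝[>] 0, -(F 0 + ε) * s ≤ U 0 - U (0, -s) := by
  obtain ⟨δ, hδ, hδF⟩ : ∃ δ > 0, ∀ z : SpaceTime N, dist z 0 < δ → F z < F 0 + ε :=
    Metric.eventually_nhds_iff.1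
      ((hF.tendsto 0).eventually (gt_mem_nhds (by linarith : F 0 < F 0 + ε)))
  set d := min δ r / 2 with hd
  have hd0 : 0 < d := by positivity
  have hdδ : 2 * d ≤ δ := by rw [hd]; linarith [min_le_left δ r]
  have hdr : 2 * d ≤ r := by rw [hd]; linarith [min_le_right δ r]
  filter_upwards [Ioo_mem_nhdsGT hd0] with s hs
  have hn0 : ∀ n : ℕ, 0 < d / (2 * ((n : ℝ) + 2)) := fun n => by positivity
  let φ : ℕ → ContDiffBump (0 : SpaceTime N) := fun n =>
    ⟨d / (2 * ((n : ℝ) + 2)), 2 * (d / (2 * ((n : ℝ) + 2))), hn0 n, by linarith [hn0 n]⟩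
  have hφe : ∀ n, (φ n).rOut = d * (1 / ((n : ℝ) + 2)) := fun n => by
    change 2 * (d / (2 * ((n : ℝ) + 2))) = _
    field_simp
  have hφ : Tendsto (fun i => (φ i).rOut) atTop (𝓝 0) := by
    have h1 := (tendsto_const_div_atTop_nhds_zero_nat (1 : ℝ)).comp (tendsto_add_atTop_nat 2)
    have h2 := h1.const_mul d
    rw [mul_zero] at h2
    refine h2.congr fun n => ?_
    rw [hφe]
    simp
  have hφd : ∀ n, (φ n).rOut < d := by
    intro n
    rw [hφe]
    have h1 : 1 / ((n : ℝ) + 2) < 1 := by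
      rw [div_lt_one (by positivity)]
      linarith [(n.cast_nonneg : (0 : ℝ) ≤ n)]
    nlinarith
  have hlim : ∀ z, Tendsto (fun n => convolution ((φ n).normed volume) U
      (ContinuousLinearMap.lsmul ℝ ℝ) volume z) atTop (𝓝 (U z)) := fun z =>
    ContDiffBump.convolution_tendsto_right_of_continuous hφ hU z
  refine ge_of_tendsto ((hlim 0).sub (hlim (0, -s))) (Eventually.of_forall fun n => ?_)
  set ρ := (φ n).normed (volume : Measure (SpaceTime N)) with hρ
  have hρsm : ContDiff ℝ ∞ ρ := (φ n).contDiff_normed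
  have hρs : HasCompactSupport ρ := (φ n).hasCompactSupport_normed
  set g : ℝ → ℝ := fun t =>
    convolution ρ U (ContinuousLinearMap.lsmul ℝ ℝ) volume ((0 : Space N), t) with hg
  have hgd : ∀ t, HasDerivAt g (∫ y, fderiv ℝ ρ ((0, t) - y) (0, 1) * U y) t := by
    intro t
    have h1 := (hρs.hasFDerivAt_convolution_left (ContinuousLinearMap.lsmul ℝ ℝ)
      (hρsm.of_le (by simp)) (hU.locallyIntegrable (μ := volume)) ((0 : Space N), t)).differentiableAt.hasFDerivAt
    have h2 : HasDerivAt (fun s : ℝ => ((0 : Space N), s)) ((0 : Space N), (1 : ℝ)) t :=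
      (hasDerivAt_const t (0 : Space N)).prodMk (hasDerivAt_id t)
    have h3 := h1.comp_hasDerivAt t h2
    rw [fderiv_convolution_apply hρsm hρs hU.locallyIntegrable] at h3
    exact h3
  have hbound : ∀ t ∈ Icc (-s) 0, -(F 0 + ε) ≤ deriv g t := by
    intro t ht
    rw [(hgd t).deriv]
    have htn : ‖((0 : Space N), t)‖ ≤ d := by
      rw [Prod.norm_def]
      simp only [norm_zero, Real.norm_eq_abs]
      refine max_le hd0.le (abs_le.2 ⟨?_, ?_⟩) <;> linarith [ht.1, ht.2, hs.2]
    -- the reflected mollifier centred at `(0, t)` is an admissible test function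
    set κ : SpaceTime N → ℝ := fun z => ρ ((0, t) - z) with hκ
    have hκball : ∀ z, κ z ≠ 0 → z ∈ Metric.closedBall (0 : SpaceTime N) (2 * d) ∧
        dist z 0 < δ := by
      intro z hz
      have h1 : ((0 : Space N), t) - z ∈ Function.support ρ := hz
      rw [hρ, (φ n).support_normed_eq, mem_ball_zero_iff] at h1
      have h2 : ‖z‖ < 2 * d := by
        have := norm_sub_norm_le z ((0 : Space N), t)
        rw [norm_sub_rev] at this
        linarith [hφd n]
      rw [dist_zero_right, mem_closedBall_zero_iff]
      exact ⟨h2.le, by linarith⟩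
    have hκsm : ContDiff ℝ ∞ κ := hρsm.comp (contDiff_const.sub contDiff_id)
    have hκt : tsupport κ ⊆ Metric.closedBall 0 (2 * d) :=
      closure_minimal (fun z hz => (hκball z hz).1) Metric.isClosed_closedBall
    have hκs : HasCompactSupport κ :=
      HasCompactSupport.of_support_subset_isCompact (isCompact_closedBall 0 (2 * d))
        (subset_closure.trans hκt)
    have hκ0 : ∀ z, 0 ≤ κ z := fun z => (φ n).nonneg_normed _
    have hκd : ∀ z, fderiv ℝ κ z (0, 1) = -fderiv ℝ ρ ((0, t) - z) (0, 1) := by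
      intro z
      have h1 : HasFDerivAt ρ (fderiv ℝ ρ ((0, t) - z)) ((0, t) - z) :=
        (hρsm.differentiable (by simp) _).hasFDerivAt
      have h2 : HasFDerivAt (fun z : SpaceTime N => ((0 : Space N), t) - z)
          (-ContinuousLinearMap.id ℝ (SpaceTime N)) z := by
        simpa using (hasFDerivAt_id z).const_sub ((0 : Space N), t)
      have h3 : fderiv ℝ κ z = _ := (h1.comp z h2).fderiv
      rw [h3]
      simp only [ContinuousLinearMap.comp_neg, ContinuousLinearMap.comp_id,
        neg_apply]
    have hk := h κ hκsm hκs (hκt.trans (Metric.closedBall_subset_closedBall hdr)) hκ0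
    simp_rw [hκd, neg_mul] at hk
    rw [integral_neg, neg_neg] at hk
    have h1 : ∫ z, κ z = 1 := by
      rw [hκ, integral_sub_left_eq_self ρ volume ((0 : Space N), t)]
      exact (φ n).integral_normed
    have h2 : ∫ z, κ z * F z ≤ ∫ z, κ z * (F 0 + ε) := by
      refine integral_mono
        ((hκsm.continuous.mul hF).integrable_of_hasCompactSupport hκs.mul_right)
        ((hκsm.continuous.integrable_of_hasCompactSupport hκs).mul_const _) fun z => ?_
      by_cases hz : κ z = 0
      · simp [hz]
      · exact mul_le_mul_of_nonneg_left (hδF z (hκball z hz).2).le (hκ0 z)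
    rw [integral_mul_const, h1, one_mul] at h2
    linarith
  have hfin := (convex_Icc (-s) 0).mul_sub_le_image_sub_of_le_deriv
    (fun t _ => (hgd t).continuousAt.continuousWithinAt)
    (fun t _ => (hgd t).differentiableAt.differentiableWithinAt)
    (fun t ht => hbound t (interior_subset ht)) (-s) ⟨le_rfl, by linarith [hs.1]⟩ 0
    ⟨by linarith [hs.1], le_rfl⟩ (by linarith [hs.1])
  rw [sub_neg_eq_add, zero_add] at hfin
  exact hfin

/-- Testing a supersolution with the translates of `w`: if `U` and `F` are the correlations of the
solution and of its flux with `w` and its gradient, then `∂U/∂t + F ≥ 0` near the origin, in the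
sense of distributions. -/
theorem correlation_distributional {p q : ℝ≥0∞} [q.HolderConjugate p] (hp : p ≠ ⊤)
    {u w : SpaceTime N → ℝ} {a W : SpaceTime N → Space N} (hu : MemLp u 2) (hw : MemLp w 2)
    (ha : MemLp a q) (hW : MemLp W p) (hwW : HasSliceGradient w W) (hw0 : ∀ z, 0 ≤ w z)
    {K O : Set (SpaceTime N)} (hK : IsCompact K) (hwK : Function.support w ⊆ K) {r : ℝ}
    (hO : Metric.cthickening r K ⊆ O)
    (hsuper : ∀ φ : SpaceTime N → ℝ, IsTestFunction O φ → (∀ z, 0 ≤ φ z) →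
      0 ≤ -(∫ z, u z * timeDeriv φ z) + ∫ z, inner ℝ (a z) (spaceGrad φ z))
    {κ : SpaceTime N → ℝ} (hκ : ContDiff ℝ ∞ κ) (hκs : HasCompactSupport κ)
    (hκr : tsupport κ ⊆ Metric.closedBall 0 r) (hκ0 : ∀ z, 0 ≤ κ z) :
    0 ≤ -(∫ y, fderiv ℝ κ y (0, 1) * ∫ z, inner ℝ (u z) (w (z - y))) +
      ∫ y, κ y * ∫ z, inner ℝ (a z) (W (z - y)) := by
  have hwl : LocallyIntegrable w := hw.locallyIntegrable (by norm_num)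
  have hWl : LocallyIntegrable W := hW.locallyIntegrable (ENNReal.HolderConjugate.one_le p q)
  set φ := convolution κ w (ContinuousLinearMap.lsmul ℝ ℝ) volume with hφ
  have hws : HasCompactSupport w := HasCompactSupport.of_support_subset_isCompact hK hwK
  have hφsm : ContDiff ℝ ∞ φ := hκs.contDiff_convolution_left _ hκ hwl
  have hsupp : Function.support φ ⊆ Metric.cthickening r K := by
    refine (support_convolution_subset _).trans ?_
    rintro _ ⟨y, hy, x, hx, rfl⟩
    refine Metric.mem_cthickening_of_dist_le _ x _ _ (hwK hx) ?_
    have := hκr (subset_tsupport _ hy)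
    simpa [dist_eq_norm] using this
  have htest : IsTestFunction O φ :=
    ⟨hφsm, HasCompactSupport.convolution _ hκs hws,
      (closure_minimal hsupp Metric.isClosed_cthickening).trans hO⟩
  have hφ0 : ∀ z, 0 ≤ φ z := fun z =>
    integral_nonneg fun y => mul_nonneg (hκ0 y) (hw0 _)
  have h1 := hsuper φ htest hφ0
  have e1 : ∀ z, timeDeriv φ z = convolution (fun y => fderiv ℝ κ y (0, 1)) w
      (ContinuousLinearMap.lsmul ℝ ℝ) volume z := by
    intro z
    rw [timeDeriv_eq_fderiv (hφsm.differentiable (by simp) z), hφ,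
      fderiv_convolution_apply hκ hκs hwl, convolution_lsmul_swap]
    rfl
  have e2 : ∀ z, u z * timeDeriv φ z = inner ℝ (u z) (convolution (fun y => fderiv ℝ κ y (0, 1)) w
      (ContinuousLinearMap.lsmul ℝ ℝ) volume z) := by
    intro z
    rw [e1]
    simp [mul_comm]
  simp_rw [e2, hφ, hwW.spaceGrad_convolution hwl hWl hκ hκs] at h1
  rw [integral_inner_convolution (p := 2) (q := 2) (by simp) hu hw
    ((hκ.continuous_fderiv (by simp)).clm_apply continuous_const)
    ((hκs.fderiv (𝕜 := ℝ)).comp_left (g := fun l : SpaceTime N →L[ℝ] ℝ => l (0, 1)) (by simp)),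
    integral_inner_convolution (p := q) (q := p) hp ha hW hκ.continuous hκs] at h1
  exact h1

/-! ### Difference quotients in time -/

theorem ae_snd_ne (t : ℝ) : ∀ᵐ z : SpaceTime N, z.2 ≠ t := by
  have h : ∀ᵐ s : ℝ, s ≠ t := Measure.ae_ne volume t
  exact (Measure.quasiMeasurePreserving_snd (μ := (volume : Measure (Space N)))
    (ν := (volume : Measure ℝ))).ae h

theorem integrable_mul_of_continuous_bounded {P ξ : SpaceTime N → ℝ} (hP : Integrable P)
    (hξ : Continuous ξ) {B : ℝ} (hB : ∀ z, |ξ z| ≤ B) : Integrable fun z => ξ z * P z :=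
  hP.bdd_mul (c := B) hξ.aestronglyMeasurable (Eventually.of_forall hB)

/-- Differentiation of the difference quotients in time of `∬ ξ P` over `t₁ < t < τ`, with all
increments moved to the Lipschitz weight `ξ` and to the endpoints. -/
theorem tendsto_timeQuotient {P ξ : SpaceTime N → ℝ} (hP : Integrable P) {L : ℝ≥0}
    (hξ : LipschitzWith L ξ) {B : ℝ} (hB : ∀ z, |ξ z| ≤ B) {t₁ τ : ℝ}
    (htau : t₁ ≤ τ)
    (h1 : ContinuousAt (fun t => ∫ x, ξ (x, t) * P (x, t)) t₁)
    (h2 : ContinuousAt (fun t => ∫ x, ξ (x, t) * P (x, t)) τ) :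
    Tendsto (fun h : ℝ => h⁻¹ * ∫ z : SpaceTime N,
        ((Ioo t₁ τ).indicator 1 (z.2 + h) * ξ (z + (0, h)) - (Ioo t₁ τ).indicator 1 z.2 * ξ z) * P z)
      (𝓝[>] 0)
      (𝓝 ((∫ x, ξ (x, t₁) * P (x, t₁)) - (∫ x, ξ (x, τ) * P (x, τ)) +
        ∫ z : SpaceTime N, (Ioo t₁ τ).indicator 1 z.2 * timeDeriv ξ z * P z)) := by
  set m : ℝ → ℝ := fun t => ∫ x, ξ (x, t) * P (x, t) with hm
  set χ : ℝ → ℝ := (Ioo t₁ τ).indicator 1 with hχ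
  have hχm : Measurable χ := measurable_one.indicator measurableSet_Ioo
  have hχb : ∀ t, |χ t| ≤ 1 := by
    intro t
    by_cases ht : t ∈ Ioo t₁ τ <;> simp [hχ, ht]
  have hξP := integrable_mul_of_continuous_bounded hP hξ.continuous hB
  have hmi : Integrable m := by
    have h : Integrable (fun z : SpaceTime N => ξ z * P z)
      ((volume : Measure (Space N)).prod (volume : Measure ℝ)) := hξP
    exact h.integral_prod_right
  have hχh : ∀ h : ℝ, Integrable fun z : SpaceTime N => χ (z.2 + h) * (ξ z * P z) := fun h =>
    hξP.bdd_mul (c := 1) ((hχm.comp (measurable_snd.add_const h)).aestronglyMeasurable)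
      (Eventually.of_forall fun z => hχb _)
  -- the increments of the characteristic function of the time interval
  have hend : ∀ h : ℝ, ∫ z : SpaceTime N, χ (z.2 + h) * (ξ z * P z) =
      ∫ t, χ (t + h) * m t := by
    intro h
    have e : Integrable (fun z : SpaceTime N => χ (z.2 + h) * (ξ z * P z))
      ((volume : Measure (Space N)).prod (volume : Measure ℝ)) := hχh h
    refine (integral_prod_symm _ e).trans ?_
    simp only [hm, integral_const_mul]
  have hJ : ∀ h : ℝ, ∫ t, χ (t + h) * m t = ∫ t in (t₁ - h)..(τ - h), m t := by
    intro h
    rw [intervalIntegral.integral_of_le (by linarith), integral_Ioc_eq_integral_Ioo,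
      ← integral_indicator measurableSet_Ioo]
    refine integral_congr_ae (Eventually.of_forall fun t => ?_)
    have e : t + h ∈ Ioo t₁ τ ↔ t ∈ Ioo (t₁ - h) (τ - h) := by
      simp only [mem_Ioo]
      constructor <;> rintro ⟨h1, h2⟩ <;> constructor <;> linarith
    by_cases ht : t + h ∈ Ioo t₁ τ
    · simp [hχ, ht, e.1 ht]
    · simp only [hχ]
      rw [indicator_of_notMem ht, indicator_of_notMem fun hc => ht (e.2 hc), zero_mul]
  have hJd : Tendsto (fun h : ℝ => h⁻¹ * ((∫ t, χ (t + h) * m t) - ∫ t, χ t * m t)) (𝓝[>] 0)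
      (𝓝 (m t₁ - m τ)) := by
    have hM : ∀ s, ContinuousAt m s → HasDerivAt (fun x => ∫ t in t₁..x, m t) (m s) s := fun s hs =>
      intervalIntegral.integral_hasDerivAt_right hmi.intervalIntegrable
        hmi.1.stronglyMeasurableAtFilter hs
    have hsub : ∀ s : ℝ, HasDerivAt (fun h : ℝ => s - h) (-1) 0 := fun s => by
      simpa using (hasDerivAt_id (0 : ℝ)).const_sub s
    have d1 : HasDerivAt (fun h : ℝ => ∫ t in t₁..(τ - h), m t) (m τ * -1) 0 :=
      HasDerivAt.comp (0 : ℝ) (h₂ := fun x => ∫ t in t₁..x, m t)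
        (by simpa using hM τ h2) (hsub τ)
    have d2 : HasDerivAt (fun h : ℝ => ∫ t in t₁..(t₁ - h), m t) (m t₁ * -1) 0 :=
      HasDerivAt.comp (0 : ℝ) (h₂ := fun x => ∫ t in t₁..x, m t)
        (by simpa using hM t₁ h1) (hsub t₁)
    have d3 := hasDerivAt_iff_tendsto_slope_zero.1 (d1.sub d2)
    have d4 := d3.mono_left (nhdsGT_le_nhdsNE 0)
    refine (d4.congr fun h => ?_).trans (le_of_eq (by congr 1; ring))
    have e0 := hJ 0
    simp only [add_zero] at e0
    rw [hJ h, e0]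
    simp only [zero_add, smul_eq_mul, Pi.sub_apply]
    rw [intervalIntegral.integral_interval_sub_left hmi.intervalIntegrable
      hmi.intervalIntegrable, intervalIntegral.integral_interval_sub_left hmi.intervalIntegrable
      hmi.intervalIntegrable]
  -- the difference quotients of the weight
  have hD : Tendsto (fun h : ℝ => ∫ z : SpaceTime N,
      χ (z.2 + h) * (h⁻¹ * (ξ (z + (0, h)) - ξ z)) * P z) (𝓝[>] 0)
      (𝓝 (∫ z : SpaceTime N, χ z.2 * timeDeriv ξ z * P z)) := by
    refine tendsto_integral_filter_of_dominated_convergence (fun z => L * |P z|)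
      (Eventually.of_forall fun h => ?_) ?_ (hP.abs.const_mul _) ?_
    · have hc : Continuous fun z : SpaceTime N => h⁻¹ * (ξ (z + (0, h)) - ξ z) :=
        continuous_const.mul ((hξ.continuous.comp (continuous_add_const _)).sub hξ.continuous)
      exact ((hχm.comp (measurable_snd.add_const h)).aestronglyMeasurable.mul
        hc.aestronglyMeasurable).mul hP.1
    · filter_upwards [self_mem_nhdsWithin] with h hh
      refine Eventually.of_forall fun z => ?_
      rw [norm_mul, norm_mul, norm_mul, norm_inv, Real.norm_eq_abs (P z)]
      have hh0 : 0 < h := hh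
      have hd : ‖ξ (z + (0, h)) - ξ z‖ ≤ L * h := by
        have := hξ.dist_le_mul (z + (0, h)) z
        rw [dist_eq_norm, dist_eq_norm, add_sub_cancel_left] at this
        refine this.trans (le_of_eq ?_)
        simp [Prod.norm_def, abs_of_pos hh0, hh0.le]
      have h3 : ‖h‖⁻¹ * ‖ξ (z + (0, h)) - ξ z‖ ≤ L := by
        rw [Real.norm_of_nonneg hh0.le, inv_mul_le_iff₀ hh0, mul_comm]
        exact hd
      have h4 : ‖χ (z.2 + h)‖ * (‖h‖⁻¹ * ‖ξ (z + (0, h)) - ξ z‖) ≤ 1 * L :=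
        mul_le_mul (hχb _) h3 (by positivity) zero_le_one
      rw [one_mul] at h4
      exact mul_le_mul_of_nonneg_right h4 (abs_nonneg _)
    · filter_upwards [hξ.ae_differentiableAt (μ := volume), ae_snd_ne (N := N) t₁,
        ae_snd_ne (N := N) τ] with z hz hz1 hz2
      refine Tendsto.mul (Tendsto.mul ?_ ?_) tendsto_const_nhds
      · have hc : ContinuousAt χ z.2 := by
          by_cases hz3 : z.2 ∈ Ioo t₁ τ
          · have : χ =ᶠ[𝓝 z.2] fun _ => 1 := by
              filter_upwards [isOpen_Ioo.mem_nhds hz3] with t ht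
              simp [hχ, ht]
            exact continuousAt_const.congr this.symm
          · have : χ =ᶠ[𝓝 z.2] fun _ => 0 := by
              have hz4 : z.2 ∈ (Icc t₁ τ)ᶜ := by
                intro hc
                exact hz3 ⟨lt_of_le_of_ne hc.1 (Ne.symm hz1), lt_of_le_of_ne hc.2 hz2⟩
              filter_upwards [isClosed_Icc.isOpen_compl.mem_nhds hz4] with t ht
              have : t ∉ Ioo t₁ τ := fun hc => ht (Ioo_subset_Icc_self hc)
              simp [hχ, this]
            exact continuousAt_const.congr this.symm
        have ht : Tendsto (fun h : ℝ => z.2 + h) (𝓝[>] 0) (𝓝 z.2) := by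
          have : Continuous fun h : ℝ => z.2 + h := by fun_prop
          simpa using (this.tendsto 0).mono_left nhdsWithin_le_nhds
        exact hc.tendsto.comp ht
      · have hd : HasDerivAt (fun s : ℝ => ξ (z.1, s)) (timeDeriv ξ z) z.2 := by
          have h1 : DifferentiableAt ℝ ξ (z.1, z.2) := hz
          have h2 : DifferentiableAt ℝ (fun s : ℝ => (z.1, s)) z.2 := by fun_prop
          exact (h1.comp z.2 h2).hasDerivAt
        have := (hasDerivAt_iff_tendsto_slope_zero.1 hd).mono_left (nhdsGT_le_nhdsNE 0)
        refine this.congr fun h => ?_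
        have e : z + (0, h) = (z.1, z.2 + h) := by ext1 <;> simp
        rw [e]
        rfl
  refine (hJd.add hD).congr fun h => ?_
  have hξh : Integrable fun z : SpaceTime N => ξ (z + (0, h)) * P z :=
    integrable_mul_of_continuous_bounded hP (hξ.continuous.comp (continuous_add_const _))
      fun z => hB _
  have hχξh : Integrable fun z : SpaceTime N => χ (z.2 + h) * (ξ (z + (0, h)) * P z) :=
    hξh.bdd_mul (c := 1) ((hχm.comp (measurable_snd.add_const h)).aestronglyMeasurable)
      (Eventually.of_forall fun z => hχb _)
  have e0 := hend 0
  simp only [add_zero] at e0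
  have i0 := hχh 0
  simp only [add_zero] at i0
  rw [← hend h, ← e0, ← integral_sub (hχh h) i0, ← integral_const_mul, ← integral_const_mul,
    ← integral_add]
  · refine integral_congr_ae (Eventually.of_forall fun z => ?_)
    simp only []
    ring
  · exact ((hχh h).sub i0).const_mul _
  · refine ((hχξh.sub (hχh h)).const_mul h⁻¹).congr (Eventually.of_forall fun z => ?_)
    simp only [Pi.sub_apply]
    ring

/-! ### Time slices of a supersolution -/

theorem volume_restrict_prod (K : Set (Space N)) (I : Set ℝ) :
    (volume : Measure (SpaceTime N)).restrict (K ×ˢ I) =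
      (volume.restrict K).prod (volume.restrict I) :=
  (Measure.prod_restrict K I).symm

/-- The `L²` norms of the time slices are bounded on compact time intervals, since they are locally
bounded. -/
theorem MemCLocL2Loc.exists_eLpNorm_le {E : Set (Space N)} {T₁ T₂ : ℝ} {u : SpaceTime N → ℝ}
    (h : MemCLocL2Loc E T₁ T₂ u) {K : Set (Space N)} (hK : IsCompact K) (hKE : K ⊆ E) {a b : ℝ}
    (ha : T₁ < a) (hb : b < T₂) :
    ∃ C : ℝ≥0∞, C ≠ ⊤ ∧ ∀ t ∈ Icc a b,
      eLpNorm (fun x => u (x, t)) 2 (volume.restrict K) ≤ C := by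
  refine isCompact_Icc.induction_on
    (p := fun s => ∃ C : ℝ≥0∞, C ≠ ⊤ ∧ ∀ t ∈ s,
      eLpNorm (fun x => u (x, t)) 2 (volume.restrict K) ≤ C) ?_ ?_ ?_ ?_
  · exact ⟨0, by simp, by simp⟩
  · rintro s t hst ⟨C, hC, hC'⟩
    exact ⟨C, hC, fun r hr => hC' r (hst hr)⟩
  · rintro s t ⟨C, hC, hC'⟩ ⟨D, hD, hD'⟩
    refine ⟨max C D, by simp [hC, hD], ?_⟩
    rintro r (hr | hr)
    exacts [(hC' r hr).trans (le_max_left _ _), (hD' r hr).trans (le_max_right _ _)]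
  · intro t₀ ht₀
    have ht₀' : t₀ ∈ Ioo T₁ T₂ := ⟨ha.trans_le ht₀.1, ht₀.2.trans_lt hb⟩
    obtain ⟨hL2, hcont⟩ := h K hK hKE
    have h1 := (ENNReal.tendsto_nhds_zero.1 (hcont t₀ ht₀')) 1 one_pos
    have h2 : ∀ᶠ t in 𝓝 t₀, t ∈ Ioo T₁ T₂ := isOpen_Ioo.mem_nhds ht₀'
    refine ⟨_, mem_nhdsWithin_of_mem_nhds (h1.and h2),
      eLpNorm (fun x => u (x, t₀)) 2 (volume.restrict K) + 1, ?_, ?_⟩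
    · simpa using (hL2 t₀ ht₀').2.ne
    · rintro t ⟨ht1, ht2⟩
      have e : (fun x => u (x, t)) = (fun x => u (x, t₀)) + fun x => u (x, t) - u (x, t₀) := by
        ext x; simp
      rw [e]
      refine (eLpNorm_add_le (hL2 t₀ ht₀').1 ((hL2 t ht2).1.sub (hL2 t₀ ht₀').1)
        (by norm_num)).trans ?_
      gcongr
      exact ht1

theorem MemCLocL2Loc.memLp {E : Set (Space N)} {T₁ T₂ : ℝ} {u : SpaceTime N → ℝ}
    (h : MemCLocL2Loc E T₁ T₂ u)
    (hm : AEStronglyMeasurable u (volume.restrict (E ×ˢ Ioo T₁ T₂))) {K : Set (Space N)}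
    (hK : IsCompact K) (hKE : K ⊆ E) {a b : ℝ} (ha : T₁ < a) (hb : b < T₂) :
    MemLp u 2 (volume.restrict (K ×ˢ Icc a b)) := by
  have hsub : K ×ˢ Icc a b ⊆ E ×ˢ Ioo T₁ T₂ :=
    prod_mono hKE fun t ht => ⟨ha.trans_le ht.1, ht.2.trans_lt hb⟩
  have hm' : AEStronglyMeasurable u (volume.restrict (K ×ˢ Icc a b)) := hm.mono_set hsub
  refine ⟨hm', ?_⟩
  obtain ⟨C, hC, hC'⟩ := h.exists_eLpNorm_le hK hKE ha hb
  rw [eLpNorm_lt_top_iff_lintegral_rpow_enorm_lt_top (by norm_num) (by norm_num)]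
  have hm2 : AEMeasurable (fun z => ‖u z‖ₑ ^ (2 : ℝ≥0∞).toReal)
      ((volume.restrict K).prod (volume.restrict (Icc a b))) := by
    rw [← volume_restrict_prod]
    exact hm'.enorm.pow_const _
  rw [volume_restrict_prod, lintegral_prod_symm _ hm2]
  calc ∫⁻ t in Icc a b, ∫⁻ x in K, ‖u (x, t)‖ₑ ^ (2 : ℝ≥0∞).toReal
      ≤ ∫⁻ _t in Icc a b, C ^ (2 : ℝ) := by
        refine setLIntegral_mono measurable_const fun t ht => ?_
        have := hC' t ht
        rw [eLpNorm_eq_lintegral_rpow_enorm_toReal (by norm_num) (by norm_num)] at this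
        have h2 := ENNReal.rpow_le_rpow this (z := 2) (by norm_num)
        rwa [← ENNReal.rpow_mul, ENNReal.toReal_ofNat, one_div, inv_mul_cancel₀ two_ne_zero,
          ENNReal.rpow_one] at h2
    _ < ⊤ := by
        rw [setLIntegral_const]
        exact ENNReal.mul_lt_top (ENNReal.rpow_lt_top_of_nonneg (by norm_num) hC) (by simp)

theorem MemCLocL2Loc.integrableOn_slice {E : Set (Space N)} {T₁ T₂ : ℝ}
    {u : SpaceTime N → ℝ} (h : MemCLocL2Loc E T₁ T₂ u) {K : Set (Space N)} (hK : IsCompact K)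
    (hKE : K ⊆ E) {Φ : ℝ → ℝ} {D : ℝ≥0} (hΦ : LipschitzWith D Φ) {t : ℝ} (ht : t ∈ Ioo T₁ T₂) :
    IntegrableOn (fun x => Φ (u (x, t))) K := by
  have hfin : IsFiniteMeasure (volume.restrict K) := ⟨by simpa using hK.measure_lt_top⟩
  have hi : Integrable (fun x => u (x, t)) (volume.restrict K) :=
    ((h K hK hKE).1 t ht).integrable (by norm_num)
  refine ((integrable_const |Φ 0|).add (hi.abs.const_mul (D : ℝ))).mono'
    (hΦ.continuous.comp_aestronglyMeasurable hi.1) (Eventually.of_forall fun x => ?_)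
  have := hΦ.dist_le_mul (u (x, t)) 0
  rw [Real.dist_eq, Real.dist_eq, sub_zero] at this
  rw [Real.norm_eq_abs]
  simp only [Pi.add_apply]
  linarith [abs_sub_abs_le_abs_sub (Φ (u (x, t))) (Φ 0)]

/-- Weighted integrals of a Lipschitz function of `u` over the time slices of `u` depend
continuously on time. -/
theorem MemCLocL2Loc.continuousAt_integral_slice {E : Set (Space N)} {T₁ T₂ : ℝ}
    {u : SpaceTime N → ℝ} (h : MemCLocL2Loc E T₁ T₂ u) {K : Set (Space N)} (hK : IsCompact K)
    (hKE : K ⊆ E) {Φ : ℝ → ℝ} {D : ℝ≥0} (hΦ : LipschitzWith D Φ) {ξ : SpaceTime N → ℝ} {L : ℝ≥0}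
    (hξ : LipschitzWith L ξ) {B : ℝ} (hB : ∀ z, |ξ z| ≤ B) {t₀ : ℝ} (ht₀ : t₀ ∈ Ioo T₁ T₂) :
    ContinuousAt (fun t => ∫ x in K, ξ (x, t) * Φ (u (x, t))) t₀ := by
  obtain ⟨hL2, hcont⟩ := h K hK hKE
  have hfin : IsFiniteMeasure (volume.restrict K) := ⟨by simpa using hK.measure_lt_top⟩
  have hB0 : 0 ≤ B := (abs_nonneg _).trans (hB 0)
  have hi : ∀ t ∈ Ioo T₁ T₂, Integrable (fun x => u (x, t)) (volume.restrict K) := fun t ht =>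
    (hL2 t ht).integrable (by norm_num)
  have hΦi : ∀ t ∈ Ioo T₁ T₂, Integrable (fun x => Φ (u (x, t))) (volume.restrict K) :=
    fun t ht => h.integrableOn_slice hK hKE hΦ ht
  set δ : ℝ → ℝ := fun t => ∫ x in K, |u (x, t) - u (x, t₀)| with hδ
  have hδ0 : Tendsto δ (𝓝 t₀) (𝓝 0) := by
    have h1 := hcont t₀ ht₀
    have h2 := ENNReal.Tendsto.mul_const h1
      (b := (volume.restrict K) univ ^ (1 / (1 : ℝ≥0∞).toReal - 1 / (2 : ℝ≥0∞).toReal))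
      (Or.inr (by
        refine ENNReal.rpow_ne_top_of_nonneg ?_ (measure_ne_top _ _)
        norm_num))
    rw [zero_mul] at h2
    have h3 := (ENNReal.tendsto_toReal ENNReal.zero_ne_top).comp h2
    refine squeeze_zero' (Eventually.of_forall fun t => integral_nonneg fun x => abs_nonneg _) ?_
      h3
    filter_upwards [isOpen_Ioo.mem_nhds ht₀, h1.eventually (gt_mem_nhds ENNReal.zero_lt_top)]
      with t ht hlt
    have hm : Integrable (fun x => u (x, t) - u (x, t₀)) (volume.restrict K) :=
      (hi t ht).sub (hi t₀ ht₀)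
    have e : δ t = (eLpNorm (fun x => u (x, t) - u (x, t₀)) 1 (volume.restrict K)).toReal := by
      rw [eLpNorm_one_eq_lintegral_enorm, ← integral_norm_eq_lintegral_enorm hm.1]
      rfl
    rw [e]
    refine ENNReal.toReal_mono ?_ (eLpNorm_le_eLpNorm_mul_rpow_measure_univ (by norm_num) hm.1)
    refine ENNReal.mul_ne_top hlt.ne ?_
    refine ENNReal.rpow_ne_top_of_nonneg ?_ (measure_ne_top _ _)
    norm_num
  set C := ∫ x in K, |Φ (u (x, t₀))| with hC
  have hbound : Tendsto (fun t => L * |t - t₀| * (C + D * δ t) + B * (D * δ t)) (𝓝 t₀) (𝓝 0) := by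
    have h1 : Tendsto (fun t : ℝ => |t - t₀|) (𝓝 t₀) (𝓝 0) := by
      have : Continuous fun t : ℝ => |t - t₀| := by fun_prop
      simpa using this.tendsto t₀
    simpa using ((h1.const_mul (L : ℝ)).mul ((hδ0.const_mul (D : ℝ)).const_add C)).add
      ((hδ0.const_mul (D : ℝ)).const_mul B)
  rw [ContinuousAt, tendsto_iff_norm_sub_tendsto_zero]
  refine squeeze_zero' (Eventually.of_forall fun t => norm_nonneg _) ?_ hbound
  filter_upwards [isOpen_Ioo.mem_nhds ht₀] with t ht
  have hw : ∀ s ∈ Ioo T₁ T₂, Integrable (fun x => ξ (x, s) * Φ (u (x, s))) (volume.restrict K) :=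
    fun s hs => (hΦi s hs).bdd_mul (c := B)
      (hξ.continuous.comp (by fun_prop : Continuous fun x : Space N => (x, s))).aestronglyMeasurable
      (Eventually.of_forall fun x => hB _)
  have hd : Integrable (fun x => |u (x, t) - u (x, t₀)|) (volume.restrict K) :=
    ((hi t ht).sub (hi t₀ ht₀)).abs
  have hpw : ∀ x, ‖ξ (x, t) * Φ (u (x, t)) - ξ (x, t₀) * Φ (u (x, t₀))‖ ≤
      L * |t - t₀| * (|Φ (u (x, t₀))| + D * |u (x, t) - u (x, t₀)|) +
        B * (D * |u (x, t) - u (x, t₀)|) := by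
    intro x
    have h1 : |ξ (x, t) - ξ (x, t₀)| ≤ L * |t - t₀| := by
      have := hξ.dist_le_mul (x, t) (x, t₀)
      rwa [Real.dist_eq, dist_eq_norm, Prod.mk_sub_mk, sub_self, Prod.norm_def, norm_zero,
        max_eq_right (norm_nonneg _)] at this
    have h2 : |Φ (u (x, t)) - Φ (u (x, t₀))| ≤ D * |u (x, t) - u (x, t₀)| := hΦ.dist_le_mul _ _
    have h3 : |Φ (u (x, t))| ≤ |Φ (u (x, t₀))| + D * |u (x, t) - u (x, t₀)| := by
      linarith [abs_sub_abs_le_abs_sub (Φ (u (x, t))) (Φ (u (x, t₀)))]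
    have e : ξ (x, t) * Φ (u (x, t)) - ξ (x, t₀) * Φ (u (x, t₀)) =
        (ξ (x, t) - ξ (x, t₀)) * Φ (u (x, t)) +
          ξ (x, t₀) * (Φ (u (x, t)) - Φ (u (x, t₀))) := by ring
    rw [e]
    refine (norm_add_le _ _).trans ?_
    rw [norm_mul, norm_mul]
    exact add_le_add (mul_le_mul h1 h3 (abs_nonneg _) (by positivity))
      (mul_le_mul (hB _) h2 (abs_nonneg _) hB0)
  rw [← integral_sub (hw t ht) (hw t₀ ht₀)]
  refine (norm_integral_le_of_norm_le ?_ (Eventually.of_forall hpw)).trans (le_of_eq ?_)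
  · exact ((((hΦi t₀ ht₀).abs).add (hd.const_mul _)).const_mul _).add
      ((hd.const_mul _).const_mul _)
  · rw [integral_add ((((hΦi t₀ ht₀).abs).fun_add (hd.const_mul _)).const_mul _)
      ((hd.const_mul _).const_mul _), integral_const_mul, integral_add ((hΦi t₀ ht₀).abs)
      (hd.const_mul _), integral_const_mul, integral_const_mul, integral_const_mul]

/-! ### The flux and convex primitives -/

theorem ae_ae_slice {P : SpaceTime N → Prop} (h : ∀ᵐ z, P z) : ∀ᵐ t : ℝ, ∀ᵐ x, P (x, t) := by
  have h' : ∀ᵐ z ∂(volume : Measure (Space N)).prod (volume : Measure ℝ), P z := h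
  have h2 := (Measure.measurePreserving_swap (μ := (volume : Measure ℝ))
    (ν := (volume : Measure (Space N)))).quasiMeasurePreserving.ae h'
  exact Measure.ae_ae_of_ae_prod h2

/-- The weight in `Du = g V` satisfies `u^{m-1} g^{p-1} = α^{1-p}`, which is the reason for the
choice of `α`. -/
theorem rpow_mul_weight_rpow {m p s : ℝ} (hp : 1 < p) (hα : 0 < alpha m p) (hs : 0 < s) :
    s ^ (m - 1) * ((alpha m p)⁻¹ * s ^ (1 - alpha m p)) ^ (p - 1) = alpha m p ^ (1 - p) := by
  rw [Real.mul_rpow (by positivity) (by positivity), ← Real.rpow_mul hs.le, mul_left_comm,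
    ← Real.rpow_add hs]
  have e : m - 1 + (1 - alpha m p) * (p - 1) = 0 := by
    have : p - 1 ≠ 0 := by linarith
    rw [alpha]
    field_simp
    ring
  rw [e, Real.rpow_zero, mul_one, Real.inv_rpow hα.le, ← Real.rpow_neg hα.le, neg_sub]

/-- The growth condition, in terms of `V = D(u^α)` only: the powers of `u` cancel. -/
theorem StructureConditions.norm_flux_le {m p C₀ C₁ : ℝ} {E : Set (Space N)} {T₁ T₂ : ℝ}
    {A : SpaceTime N → ℝ → Space N → Space N} {u : SpaceTime N → ℝ} {V : SpaceTime N → Space N}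
    (h : StructureConditions m p C₀ C₁ E T₁ T₂ A u V)
    (hu : ∀ᵐ z ∂(volume.restrict (E ×ˢ Ioo T₁ T₂)), 0 < u z) (hp : 1 < p)
    (hα : 0 < alpha m p) :
    ∀ᵐ z ∂(volume.restrict (E ×ˢ Ioo T₁ T₂)),
      ‖A z (u z) (gradU m p u V z)‖ ≤ C₁ * alpha m p ^ (1 - p) * ‖V z‖ ^ (p - 1) := by
  filter_upwards [h.growth, hu] with z hz hpos
  refine hz.trans (le_of_eq ?_)
  rw [gradU, norm_smul, Real.norm_of_nonneg (by positivity), abs_of_pos hpos,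
    Real.mul_rpow (by positivity) (norm_nonneg _), ← rpow_mul_weight_rpow hp hα hpos]
  ring

/-- The coercivity condition, in terms of `V = D(u^α)` only: the powers of `u` cancel. -/
theorem StructureConditions.le_inner_flux {m p C₀ C₁ : ℝ} {E : Set (Space N)} {T₁ T₂ : ℝ}
    {A : SpaceTime N → ℝ → Space N → Space N} {u : SpaceTime N → ℝ} {V : SpaceTime N → Space N}
    (h : StructureConditions m p C₀ C₁ E T₁ T₂ A u V)
    (hu : ∀ᵐ z ∂(volume.restrict (E ×ˢ Ioo T₁ T₂)), 0 < u z) (hp : 1 < p)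
    (hα : 0 < alpha m p) :
    ∀ᵐ z ∂(volume.restrict (E ×ˢ Ioo T₁ T₂)),
      C₀ * alpha m p ^ (1 - p) * ‖V z‖ ^ p ≤ inner ℝ (A z (u z) (gradU m p u V z)) (V z) := by
  filter_upwards [h.coercive, hu] with z hz hpos
  set w := (alpha m p)⁻¹ * u z ^ (1 - alpha m p) with hw
  have hw0 : 0 < w := by positivity
  have e1 : ‖gradU m p u V z‖ ^ p = w * (w ^ (p - 1) * ‖V z‖ ^ p) := by
    rw [gradU, norm_smul, Real.norm_of_nonneg hw0.le, Real.mul_rpow hw0.le (norm_nonneg _),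
      ← mul_assoc]
    congr 1
    rw [← Real.rpow_one_add' hw0.le (by linarith)]
    congr 1
    ring
  have e2 : inner ℝ (A z (u z) (gradU m p u V z)) (gradU m p u V z) =
      w * inner ℝ (A z (u z) (gradU m p u V z)) (V z) := by
    conv_lhs => rw [show gradU m p u V z = w • V z from rfl]
    rw [inner_smul_right]
    rfl
  rw [e1, e2, abs_of_pos hpos] at hz
  refine le_of_mul_le_mul_left (le_trans (le_of_eq ?_) hz) hw0
  rw [← rpow_mul_weight_rpow hp hα hpos]
  ring

/-- The flux is locally in the dual Lebesgue space. -/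
theorem memLp_flux {m p C₀ C₁ : ℝ} {E : Set (Space N)} {T₁ T₂ : ℝ}
    {A : SpaceTime N → ℝ → Space N → Space N} {u : SpaceTime N → ℝ} {V : SpaceTime N → Space N}
    (hA : StructureConditions m p C₀ C₁ E T₁ T₂ A u V)
    (hu : ∀ᵐ z ∂(volume.restrict (E ×ˢ Ioo T₁ T₂)), 0 < u z) (hp : 1 < p) (hα : 0 < alpha m p)
    {S : Set (SpaceTime N)} (hS : S ⊆ E ×ˢ Ioo T₁ T₂)
    (hV : MemLp V (ENNReal.ofReal p) (volume.restrict S)) :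
    MemLp (fun z => A z (u z) (gradU m p u V z)) (ENNReal.ofReal (p / (p - 1)))
      (volume.restrict S) := by
  have h1 := hV.norm_rpow_div (ENNReal.ofReal (p - 1))
  rw [ENNReal.toReal_ofReal (by linarith), ← ENNReal.ofReal_div_of_pos (by linarith)] at h1
  refine (h1.const_mul (C₁ * alpha m p ^ (1 - p))).of_le (hA.measurable.mono_set hS) ?_
  filter_upwards [ae_restrict_of_ae_restrict_of_subset hS (hA.norm_flux_le hu hp hα)] with z hz
  exact hz.trans (le_abs_self _)

/-- Convexity of the primitive of a nonincreasing function. -/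
theorem mul_sub_le_integral_of_antitone {G : ℝ → ℝ} (hG : Antitone G) (a b : ℝ) :
    G b * (b - a) ≤ ∫ r in a..b, G r := by
  rcases le_total a b with hab | hab
  · have h := intervalIntegral.integral_mono_on (μ := volume) hab
      (intervalIntegrable_const (c := G b)) hG.intervalIntegrable
      (fun x hx => hG hx.2)
    simpa [mul_comm] using h
  · have h := intervalIntegral.integral_mono_on (μ := volume) hab
      hG.intervalIntegrable (intervalIntegrable_const (c := G b)) (fun x hx => hG hx.1)
    rw [intervalIntegral.integral_symm]
    simp only [intervalIntegral.integral_const, smul_eq_mul] at h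
    linarith

theorem lipschitzWith_integral_of_abs_le {G : ℝ → ℝ} (hG : Antitone G) {D : ℝ≥0}
    (hD : ∀ s, |G s| ≤ D) (k : ℝ) : LipschitzWith D fun s => ∫ r in s..k, G r := by
  refine LipschitzWith.of_dist_le_mul fun a b => ?_
  rw [Real.dist_eq, intervalIntegral.integral_interval_sub_interval_comm hG.intervalIntegrable
    hG.intervalIntegrable hG.intervalIntegrable]
  simp only [intervalIntegral.integral_same, sub_zero]
  rw [dist_comm]
  exact intervalIntegral.norm_integral_le_of_norm_le_const (f := G) (C := D) fun r _ => hD r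

/-- A nonnegative function has a minimum at each of its zeros; where it is not differentiable, the
gradient is zero by convention. -/
theorem spaceGrad_eq_zero_of_nonneg {ξ : SpaceTime N → ℝ} (hξ : ∀ z, 0 ≤ ξ z) {z : SpaceTime N}
    (hz : ξ z = 0) : spaceGrad ξ z = 0 := by
  have hmin : IsLocalMin (fun y : Space N => ξ (y, z.2)) z.1 :=
    Eventually.of_forall fun y => by
      simp only [Prod.mk.eta]
      rw [hz]
      exact hξ _
  simp [spaceGrad, gradient, hmin.fderiv_eq_zero]

theorem timeDeriv_eq_zero_of_nonneg {ξ : SpaceTime N → ℝ} (hξ : ∀ z, 0 ≤ ξ z) {z : SpaceTime N}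
    (hz : ξ z = 0) : timeDeriv ξ z = 0 := by
  have hmin : IsLocalMin (fun s : ℝ => ξ (z.1, s)) z.2 :=
    Eventually.of_forall fun y => by
      simp only [Prod.mk.eta]
      rw [hz]
      exact hξ _
  exact hmin.deriv_eq_zero

theorem measurable_spaceGrad {ξ : SpaceTime N → ℝ} (hξ : Continuous ξ) :
    Measurable (spaceGrad ξ) := by
  have h1 : Continuous (Function.uncurry fun (t : ℝ) (x : Space N) => ξ (x, t)) := by
    have : Continuous fun z : ℝ × Space N => ξ (z.2, z.1) := by fun_prop
    exact this
  have h2 := measurable_fderiv_with_param ℝ h1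
  have h3 : Measurable fun z : SpaceTime N => fderiv ℝ (fun y : Space N => ξ (y, z.2)) z.1 :=
    h2.comp measurable_swap
  exact (LinearIsometryEquiv.continuous _).measurable.comp h3

theorem norm_spaceGrad_le {ξ : SpaceTime N → ℝ} {L : ℝ≥0} (hξ : LipschitzWith L ξ)
    (z : SpaceTime N) : ‖spaceGrad ξ z‖ ≤ L := by
  rw [spaceGrad, gradient, LinearIsometryEquiv.norm_map]
  refine norm_fderiv_le_of_lipschitz ℝ (LipschitzWith.of_dist_le_mul fun x y => ?_)
  refine (hξ.dist_le_mul _ _).trans (le_of_eq ?_)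
  simp [Prod.dist_eq]

/-! ### The energy inequality -/

/-- The spatial gradient of the test function `χ ξ G(u)`, where `G(u) = H(u^α)` and `H' = d`. -/
theorem hasSliceGradient_truncation {α : ℝ} {E : Set (Space N)} (hE : IsOpen E) {T₁ T₂ : ℝ}
    {u : SpaceTime N → ℝ} {V : SpaceTime N → Space N}
    (hu : ∀ᵐ z ∂(volume.restrict (E ×ˢ Ioo T₁ T₂)), 0 < u z)
    (hV : ∀ᵐ t ∂(volume.restrict (Ioo T₁ T₂)),
      HasWeakGradient E (fun x => u (x, t) ^ α) (fun x => V (x, t)))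
    {Q : Set (Space N)} (hQ : IsCompact (closure Q)) (hQE : closure Q ⊆ E)
    {ξ : SpaceTime N → ℝ} {L : ℝ≥0} (hξ : LipschitzWith L ξ) (hξ0 : ∀ z, 0 ≤ ξ z)
    (hξQ : ∀ z : SpaceTime N, z.1 ∉ Q → ξ z = 0)
    {d G : ℝ → ℝ} {dn : ℕ → ℝ → ℝ} {M : ℝ} (hdnc : ∀ n, Continuous (dn n))
    (hdnb : ∀ n s, |dn n s| ≤ M) (hdn : ∀ s, Tendsto (fun n => dn n s) atTop (𝓝 (d s))) (K : ℝ)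
    (hG : ∀ s, 0 < s → ∫ r in K..s ^ α, d r = G s) {t₁ τ : ℝ} (ht₁ : T₁ < t₁) (hτ : τ < T₂) :
    HasSliceGradient (fun z => (Ioo t₁ τ).indicator 1 z.2 * (ξ z * G (u z)))
      (fun z => ((Ioo t₁ τ).indicator 1 z.2 : ℝ) •
        ((d (u z ^ α) * ξ z) • V z + G (u z) • spaceGrad ξ z)) := by
  have hQm : MeasurableSet (closure Q) := isClosed_closure.measurableSet
  have hu' : ∀ᵐ z : SpaceTime N, z.2 ∈ Ioo T₁ T₂ → z.1 ∈ closure Q → 0 < u z := by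
    have h1 := ae_restrict_of_ae_restrict_of_subset
      (prod_mono hQE (subset_refl (Ioo T₁ T₂))) hu
    rw [ae_restrict_iff' (hQm.prod measurableSet_Ioo)] at h1
    filter_upwards [h1] with z hz h2 h3 using hz ⟨h3, h2⟩
  rw [ae_restrict_iff' measurableSet_Ioo] at hV
  filter_upwards [ae_ae_slice hu', hV] with s hs hsV ψ hψ hψs e
  by_cases hst : s ∈ Ioo t₁ τ
  swap
  · simp [indicator_of_notMem hst]
  have hsT : s ∈ Ioo T₁ T₂ := ⟨ht₁.trans hst.1, hst.2.trans hτ⟩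
  have hlip : LipschitzWith L fun x : Space N => ξ (x, s) :=
    LipschitzWith.of_dist_le_mul fun x y =>
      (hξ.dist_le_mul _ _).trans (le_of_eq (by simp [Prod.dist_eq]))
  have hts : tsupport (fun x : Space N => ξ (x, s)) ⊆ closure Q := by
    refine closure_mono fun x hx => ?_
    by_contra hc
    exact hx (hξQ (x, s) hc)
  have hcs : HasCompactSupport fun x : Space N => ξ (x, s) :=
    hQ.of_isClosed_subset (isClosed_tsupport _) hts
  have hmain := (hsV hsT).integral_comp_mul hE hlip hcs (hts.trans hQE) hdnc hdnb hdn K hψ hψs e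
  refine Eq.trans (integral_congr_ae ?_) hmain
  filter_upwards [hs, hlip.ae_differentiableAt (μ := volume)] with x hx hxd
  have hld : lineDeriv ℝ (fun x : Space N => ξ (x, s)) x e = inner ℝ (spaceGrad ξ (x, s)) e := by
    rw [hxd.lineDeriv_eq_fderiv, spaceGrad, inner_gradient_eq_fderiv]
  rw [hld]
  simp only [indicator_of_mem hst, Pi.one_apply, one_mul, one_smul, inner_add_left,
    real_inner_smul_left]
  by_cases hxQ : x ∈ closure Q
  · rw [hG _ (hx hsT hxQ)]
    ring
  · have h0 : ξ (x, s) = 0 := hξQ (x, s) fun hc => hxQ (subset_closure hc)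
    simp [h0, spaceGrad_eq_zero_of_nonneg hξ0 h0]

/-- The energy inequality for a positive supersolution, tested with `ξ G(u)` on the time interval
`(t₁, τ)`, where `G` is nonincreasing and `G(u)` is a Lipschitz function of `u^α`. -/
theorem IsPositiveWeakSupersolution.energy_inequality {m p C₀ C₁ : ℝ} (hp : 1 < p)
    (hα : 0 < alpha m p) {E : Set (Space N)} (hE : IsOpen E) {T₁ T₂ : ℝ}
    {A : SpaceTime N → ℝ → Space N → Space N} {u : SpaceTime N → ℝ} {V : SpaceTime N → Space N}
    (hA : StructureConditions m p C₀ C₁ E T₁ T₂ A u V)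
    (hu : IsPositiveWeakSupersolution m p E T₁ T₂ A u V)
    {Q : Set (Space N)} (hQo : IsOpen Q) (hQ : IsCompact (closure Q)) (hQE : closure Q ⊆ E)
    {ξ : SpaceTime N → ℝ} {L : ℝ≥0} (hξ : LipschitzWith L ξ) (hξ0 : ∀ z, 0 ≤ ξ z)
    (hξQ : ∀ z : SpaceTime N, z.1 ∉ Q → ξ z = 0) {B : ℝ} (hB : ∀ z, ξ z ≤ B)
    {d G : ℝ → ℝ} {dn : ℕ → ℝ → ℝ} {M : ℝ} (hdnc : ∀ n, Continuous (dn n))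
    (hdnb : ∀ n s, |dn n s| ≤ M) (hdn : ∀ s, Tendsto (fun n => dn n s) atTop (𝓝 (d s))) (K : ℝ)
    (hGd : ∀ s, 0 < s → ∫ r in K..s ^ alpha m p, d r = G s) (hG : Antitone G)
    (hG0 : ∀ s, 0 ≤ G s) {D : ℝ≥0} (hGD : ∀ s, G s ≤ D) (k : ℝ)
    {t₁ τ : ℝ} (ht₁ : T₁ < t₁) (htau : t₁ < τ) (hτ : τ < T₂) :
    IntegrableOn (fun z => inner ℝ (A z (u z) (gradU m p u V z))
      ((d (u z ^ alpha m p) * ξ z) • V z + G (u z) • spaceGrad ξ z)) (Q ×ˢ Ioo t₁ τ) ∧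
    ∫ x in Q, ξ (x, τ) * ∫ r in u (x, τ)..k, G r ≤
      (∫ x in Q, ξ (x, t₁) * ∫ r in u (x, t₁)..k, G r) +
      (∫ z in Q ×ˢ Ioo t₁ τ, timeDeriv ξ z * ∫ r in u z..k, G r) +
      ∫ z in Q ×ˢ Ioo t₁ τ, inner ℝ (A z (u z) (gradU m p u V z))
        ((d (u z ^ alpha m p) * ξ z) • V z + G (u z) • spaceGrad ξ z) := by
  have hM : 0 ≤ M := (abs_nonneg _).trans (hdnb 0 0)
  have hBabs : ∀ z, |ξ z| ≤ B := fun z => by rw [abs_of_nonneg (hξ0 z)]; exact hB z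
  have hB0 : 0 ≤ B := (hξ0 0).trans (hB 0)
  -- compact and open neighbourhoods of the support of the test function
  obtain ⟨a, ha1, ha2⟩ := exists_between ht₁
  obtain ⟨b, hb1, hb2⟩ := exists_between hτ
  obtain ⟨r₁, hr₁, hr₁E⟩ := hQ.exists_cthickening_subset_open hE hQE
  set K₁ := Metric.cthickening r₁ (closure Q) with hK₁
  have hK₁c : IsCompact K₁ := hQ.cthickening
  set O : Set (SpaceTime N) := Metric.thickening r₁ (closure Q) ×ˢ Ioo a b with hO
  set K' : Set (SpaceTime N) := K₁ ×ˢ Icc a b with hK'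
  have hOo : IsOpen O := Metric.isOpen_thickening.prod isOpen_Ioo
  have hOK' : O ⊆ K' := prod_mono (Metric.thickening_subset_cthickening _ _) Ioo_subset_Icc_self
  have hIcc : Icc a b ⊆ Ioo T₁ T₂ := fun t ht => ⟨ha1.trans_le ht.1, ht.2.trans_lt hb2⟩
  have hK'E : K' ⊆ E ×ˢ Ioo T₁ T₂ := prod_mono hr₁E hIcc
  have hK'm : MeasurableSet K' := hK₁c.measurableSet.prod measurableSet_Icc
  set K₀ : Set (SpaceTime N) := closure Q ×ˢ Icc t₁ τ with hK₀
  have hK₀c : IsCompact K₀ := hQ.prod isCompact_Icc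
  have hK₀O : K₀ ⊆ O := prod_mono (Metric.self_subset_thickening hr₁ _)
    fun t ht => ⟨ha2.trans_le ht.1, ht.2.trans_lt hb1⟩
  obtain ⟨r, hr, hrO⟩ := hK₀c.exists_cthickening_subset_open hOo hK₀O
  have hQK : ∀ x ∈ Q, ∀ t ∈ Icc a b, ((x, t) : SpaceTime N) ∈ K' := fun x hx t ht =>
    ⟨Metric.self_subset_cthickening _ (subset_closure hx), ht⟩
  set χ : ℝ → ℝ := (Ioo t₁ τ).indicator 1 with hχ
  have hχm : Measurable χ := measurable_one.indicator measurableSet_Ioo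
  have hχ0 : ∀ t, 0 ≤ χ t := fun t => indicator_nonneg (fun _ _ => zero_le_one) t
  have hχ1 : ∀ t, |χ t| ≤ 1 := by
    intro t
    by_cases ht : t ∈ Ioo t₁ τ <;> simp [hχ, ht]
  set Φ : ℝ → ℝ := fun s => ∫ r in s..k, G r with hΦ
  have hΦl : LipschitzWith D Φ :=
    lipschitzWith_integral_of_abs_le hG (fun s => by rw [abs_of_nonneg (hG0 s)]; exact hGD s) k
  -- the localized solution and flux
  set a' : SpaceTime N → Space N := K'.indicator fun z => A z (u z) (gradU m p u V z) with ha'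
  set u' : SpaceTime N → ℝ := K'.indicator u with hu'
  set P : SpaceTime N → ℝ := K'.indicator fun z => Φ (u z) with hP
  have hV : MemLp V (ENNReal.ofReal p) (volume.restrict K') :=
    hu.power_mem.memLp_grad K₁ hK₁c hr₁E a b ha1 hb2
  have hv : AEStronglyMeasurable (fun z => u z ^ alpha m p) (volume.restrict K') :=
    (hu.power_mem.memLp K₁ hK₁c hr₁E a b ha1 hb2).1
  have hu2 : MemLp u 2 (volume.restrict K') :=
    hu.continuous_L2.memLp hu.measurable hK₁c hr₁E ha1 hb2
  have hu'2 : MemLp u' 2 := (memLp_indicator_iff_restrict hK'm).2 hu2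
  have ha'q : MemLp a' (ENNReal.ofReal (p / (p - 1))) := (memLp_indicator_iff_restrict hK'm).2
    (memLp_flux hA hu.pos hp hα hK'E hV)
  have hK'fin : IsFiniteMeasure (volume.restrict K') :=
    ⟨by simpa using (hK₁c.prod isCompact_Icc).measure_lt_top⟩
  have hPi : Integrable P := by
    rw [hP, integrable_indicator_iff hK'm]
    refine ((integrable_const |Φ 0|).add ((hu2.integrable (by norm_num)).abs.const_mul
      (D : ℝ))).mono' (hΦl.continuous.comp_aestronglyMeasurable hu2.1)
      (Eventually.of_forall fun z => ?_)
    have := hΦl.dist_le_mul (u z) 0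
    rw [Real.dist_eq, Real.dist_eq, sub_zero] at this
    rw [Real.norm_eq_abs]
    simp only [Pi.add_apply]
    linarith [abs_sub_abs_le_abs_sub (Φ (u z)) (Φ 0)]
  have hGu : AEStronglyMeasurable (fun z => G (u z)) (volume.restrict K') :=
    (hG.measurable.comp_aemeasurable hu2.1.aemeasurable).aestronglyMeasurable
  have hd_meas : Measurable d := measurable_of_tendsto_metrizable (fun n => (hdnc n).measurable)
    (tendsto_pi_nhds.2 hdn)
  have hdM : ∀ s, |d s| ≤ M := fun s =>
    le_of_tendsto (hdn s).abs (Eventually.of_forall fun n => hdnb n s)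
  -- the test function and its gradient
  set w : SpaceTime N → ℝ := fun z => χ z.2 * (ξ z * G (u z)) with hw
  set W : SpaceTime N → Space N := fun z => χ z.2 •
    ((d (u z ^ alpha m p) * ξ z) • V z + G (u z) • spaceGrad ξ z) with hW
  have hoff : ∀ z : SpaceTime N, z ∉ Q ×ˢ Ioo t₁ τ → χ z.2 = 0 ∨ (ξ z = 0 ∧ spaceGrad ξ z = 0) := by
    intro z hz
    by_cases hzt : z.2 ∈ Ioo t₁ τ
    · have : z.1 ∉ Q := fun hc => hz ⟨hc, hzt⟩
      exact Or.inr ⟨hξQ z this, spaceGrad_eq_zero_of_nonneg hξ0 (hξQ z this)⟩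
    · exact Or.inl (indicator_of_notMem hzt _)
  have hw_off : ∀ z, z ∉ Q ×ˢ Ioo t₁ τ → w z = 0 := by
    intro z hz
    rcases hoff z hz with h | ⟨h, -⟩ <;> simp [hw, h]
  have hW_off : ∀ z, z ∉ Q ×ˢ Ioo t₁ τ → W z = 0 := by
    intro z hz
    rcases hoff z hz with h | ⟨h, h'⟩
    · simp [hW, h]
    · simp [hW, h, h']
  have hQK₀ : Q ×ˢ Ioo t₁ τ ⊆ K₀ := prod_mono subset_closure Ioo_subset_Icc_self
  have hQK' : Q ×ˢ Ioo t₁ τ ⊆ K' := hQK₀.trans (hK₀O.trans hOK')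
  have hwK' : K'.indicator w = w := indicator_eq_self.2 fun z hz => by
    by_contra hc
    exact hz (hw_off z fun h => hc (hQK' h))
  have hWK' : K'.indicator W = W := indicator_eq_self.2 fun z hz => by
    by_contra hc
    exact hz (hW_off z fun h => hc (hQK' h))
  have hχm' : AEStronglyMeasurable (fun z : SpaceTime N => χ z.2) (volume.restrict K') :=
    (hχm.comp measurable_snd).aestronglyMeasurable
  have hw2 : MemLp w 2 := by
    rw [← hwK', memLp_indicator_iff_restrict hK'm]
    refine MemLp.of_bound (hχm'.mul (hξ.continuous.aestronglyMeasurable.mul hGu)) (1 * (B * D))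
      (Eventually.of_forall fun z => ?_)
    rw [norm_mul, norm_mul]
    have hg : ‖G (u z)‖ ≤ D := by rw [Real.norm_of_nonneg (hG0 _)]; exact hGD _
    exact mul_le_mul (hχ1 _) (mul_le_mul (hBabs z) hg (norm_nonneg _) hB0) (by positivity)
      zero_le_one
  have hWp : MemLp W (ENNReal.ofReal p) := by
    rw [← hWK', memLp_indicator_iff_restrict hK'm]
    refine ((hV.norm.const_mul (M * B)).add (memLp_const (D * L : ℝ))).of_le
      (hχm'.smul (((hd_meas.comp_aemeasurable hv.aemeasurable).aestronglyMeasurable.mul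
        hξ.continuous.aestronglyMeasurable).smul hV.1 |>.add
        (hGu.smul (measurable_spaceGrad hξ.continuous).aestronglyMeasurable)))
      (Eventually.of_forall fun z => ?_)
    have hg : ‖G (u z)‖ ≤ D := by rw [Real.norm_of_nonneg (hG0 _)]; exact hGD _
    refine le_trans ?_ (le_abs_self _)
    rw [norm_smul]
    have h1 : ‖(d (u z ^ alpha m p) * ξ z) • V z + G (u z) • spaceGrad ξ z‖ ≤
        M * B * ‖V z‖ + D * L := by
      refine (norm_add_le _ _).trans ?_
      rw [norm_smul, norm_smul, norm_mul]
      exact add_le_add (mul_le_mul_of_nonneg_right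
        (mul_le_mul (hdM _) (hBabs z) (norm_nonneg _) hM) (norm_nonneg _))
        (mul_le_mul hg (norm_spaceGrad_le hξ z) (norm_nonneg _) D.2)
    calc ‖χ z.2‖ * _ ≤ 1 * (M * B * ‖V z‖ + D * L) :=
          mul_le_mul (hχ1 _) h1 (norm_nonneg _) zero_le_one
      _ = _ := by simp
  have hwW : HasSliceGradient w W :=
    hasSliceGradient_truncation hE hu.pos hu.power_mem.weakGradient hQ hQE hξ hξ0 hξQ hdnc hdnb hdn
      K hGd ht₁ hτ
  have hw0 : ∀ z, 0 ≤ w z := fun z => mul_nonneg (hχ0 _) (mul_nonneg (hξ0 z) (hG0 _))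
  have hwsupp : Function.support w ⊆ K₀ := by
    intro z hz
    by_contra hc
    exact hz (hw_off z fun h => hc (hQK₀ h))
  have hsuper : ∀ φ : SpaceTime N → ℝ, IsTestFunction O φ → (∀ z, 0 ≤ φ z) →
      0 ≤ -(∫ z, u' z * timeDeriv φ z) + ∫ z, inner ℝ (a' z) (spaceGrad φ z) := by
    intro φ hφ hφ0
    have h1 := hu.supersolution φ
      ⟨hφ.smooth, hφ.compactSupport, hφ.support_subset.trans (hOK'.trans hK'E)⟩ hφ0
    have hzero : ∀ z, z ∉ K' → timeDeriv φ z = 0 ∧ spaceGrad φ z = 0 := by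
      intro z hz
      have : φ z = 0 := by
        refine image_eq_zero_of_notMem_tsupport fun hc => hz (hOK' (hφ.support_subset hc))
      exact ⟨timeDeriv_eq_zero_of_nonneg hφ0 this, spaceGrad_eq_zero_of_nonneg hφ0 this⟩
    have e1 : ∫ z in E ×ˢ Ioo T₁ T₂, u z * timeDeriv φ z = ∫ z, u' z * timeDeriv φ z := by
      rw [setIntegral_eq_integral_of_forall_compl_eq_zero]
      · refine integral_congr_ae (Eventually.of_forall fun z => ?_)
        by_cases hz : z ∈ K'
        · simp [hu', hz]
        · simp [(hzero z hz).1]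
      · intro z hz
        simp [(hzero z fun hc => hz (hK'E hc)).1]
    have e2 : ∫ z in E ×ˢ Ioo T₁ T₂, inner ℝ (A z (u z) (gradU m p u V z)) (spaceGrad φ z) =
        ∫ z, inner ℝ (a' z) (spaceGrad φ z) := by
      rw [setIntegral_eq_integral_of_forall_compl_eq_zero]
      · refine integral_congr_ae (Eventually.of_forall fun z => ?_)
        by_cases hz : z ∈ K'
        · simp [ha', hz]
        · simp [(hzero z hz).2]
      · intro z hz
        simp [(hzero z fun hc => hz (hK'E hc)).2]
    rwa [e1, e2] at h1
  have hconj : (p / (p - 1)).HolderConjugate p :=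
    (Real.HolderConjugate.conjExponent hp).symm
  have : (ENNReal.ofReal (p / (p - 1))).HolderConjugate (ENNReal.ofReal p) :=
    hconj.ennrealOfReal
  have hUc := continuous_integral_inner_translate (p := 2) (q := 2) (by simp) hu'2 hw2
  have hFc := continuous_integral_inner_translate (p := ENNReal.ofReal (p / (p - 1)))
    (q := ENNReal.ofReal p) (by simp) ha'q hWp
  set U : SpaceTime N → ℝ := fun y => ∫ z, inner ℝ (u' z) (w (z - y)) with hU
  set F : SpaceTime N → ℝ := fun y => ∫ z, inner ℝ (a' z) (W (z - y)) with hF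
  have hdist : ∀ κ : SpaceTime N → ℝ, ContDiff ℝ ∞ κ → HasCompactSupport κ →
      tsupport κ ⊆ Metric.closedBall 0 r → (∀ z, 0 ≤ κ z) →
      0 ≤ -(∫ z, fderiv ℝ κ z (0, 1) * U z) + ∫ z, κ z * F z := fun κ h1 h2 h3 h4 =>
    correlation_distributional (q := ENNReal.ofReal (p / (p - 1))) (p := ENNReal.ofReal p)
      (by simp) hu'2 hw2 ha'q hWp hwW hw0 hK₀c hwsupp hrO hsuper h1 h2 h3 h4
  -- convexity turns the time increments of `u` into those of `Φ(u)`
  have hincr : ∀ s : ℝ, 0 < s → s < t₁ - a → U 0 - U (0, -s) ≤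
      ∫ z : SpaceTime N, (χ (z.2 + s) * ξ (z + (0, s)) - χ z.2 * ξ z) * P z := by
    intro s hs hsa
    have hu's : MemLp (fun z => u' (z - (0, s))) 2 :=
      hu'2.comp_measurePreserving (measurePreserving_sub_right volume ((0 : Space N), s))
    have hPs : Integrable fun z => P (z - (0, s)) := hPi.comp_sub_right _
    have e1 : U (0, -s) = ∫ z, w z * u' (z - (0, s)) := by
      have e := integral_sub_right_eq_self (μ := volume)
        (fun z => inner ℝ (u' z) (w (z - (0, -s)))) ((0 : Space N), s)
      simp only [hU]
      rw [← e]
      refine integral_congr_ae (Eventually.of_forall fun z => ?_)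
      have : z - (0, s) - (0, -s) = z := by ext1 <;> simp
      simp [this]
    have e2 : U 0 = ∫ z, w z * u' z := by
      simp [hU]
    have i1 : Integrable fun z => w z * u' z := MemLp.integrable_mul (p := 2) (q := 2) hw2 hu'2
    have i2 : Integrable fun z => w z * u' (z - (0, s)) :=
      MemLp.integrable_mul (p := 2) (q := 2) hw2 hu's
    have hχξ : ∀ c : ℝ, ∀ {R : SpaceTime N → ℝ}, Integrable R →
        Integrable fun z : SpaceTime N => χ (z.2 + c) * ξ (z + (0, c)) * R z := by
      intro c R hR
      refine hR.bdd_mul (c := 1 * B) ((hχm.comp (measurable_snd.add_const c)).aestronglyMeasurable.mul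
        (hξ.continuous.comp (continuous_add_const _)).aestronglyMeasurable)
        (Eventually.of_forall fun z => ?_)
      rw [norm_mul]
      exact mul_le_mul (hχ1 _) (hBabs _) (norm_nonneg _) zero_le_one
    have i3 : Integrable fun z : SpaceTime N => χ z.2 * ξ z * P (z - (0, s)) := by
      have hz0 : ∀ z : SpaceTime N, z + (0, 0) = z := fun z => by ext1 <;> simp
      simpa [hz0] using hχξ 0 hPs
    have i4 : Integrable fun z : SpaceTime N => χ z.2 * ξ z * P z := by
      have hz0 : ∀ z : SpaceTime N, z + (0, 0) = z := fun z => by ext1 <;> simp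
      simpa [hz0] using hχξ 0 hPi
    have e3 : ∫ z : SpaceTime N, χ z.2 * ξ z * P (z - (0, s)) =
        ∫ z : SpaceTime N, χ (z.2 + s) * ξ (z + (0, s)) * P z := by
      rw [← integral_add_right_eq_self (μ := volume) _ ((0 : Space N), s)]
      refine integral_congr_ae (Eventually.of_forall fun z => ?_)
      simp
    have e4 : ∫ z : SpaceTime N, (χ (z.2 + s) * ξ (z + (0, s)) - χ z.2 * ξ z) * P z =
        ∫ z : SpaceTime N, (χ z.2 * ξ z * P (z - (0, s)) - χ z.2 * ξ z * P z) := by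
      rw [integral_sub i3 i4, e3, ← integral_sub (hχξ s hPi) i4]
      refine integral_congr_ae (Eventually.of_forall fun z => ?_)
      simp only []
      ring
    rw [e1, e2, e4, ← integral_sub i1 i2]
    refine integral_mono (i1.sub i2) (i3.sub i4) fun z => ?_
    simp only []
    by_cases hz : z ∈ Q ×ˢ Ioo t₁ τ
    · have hz1 : z ∈ K' := hQK' hz
      have hz2 : z - (0, s) ∈ K' := by
        have e : z - (0, s) = (z.1, z.2 - s) := by ext1 <;> simp
        rw [e]
        exact hQK _ hz.1 _ ⟨by linarith [hz.2.1], by linarith [hz.2.2]⟩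
      have hconv := mul_sub_le_integral_of_antitone hG (u (z - (0, s))) (u z)
      have hΦs : Φ (u (z - (0, s))) - Φ (u z) = ∫ r in u (z - (0, s))..u z, G r := by
        simp only [hΦ]
        rw [intervalIntegral.integral_interval_sub_interval_comm hG.intervalIntegrable
          hG.intervalIntegrable hG.intervalIntegrable, intervalIntegral.integral_same, sub_zero]
      simp only [hw, hu', hP, indicator_of_mem hz1, indicator_of_mem hz2]
      have := mul_le_mul_of_nonneg_left (hΦs ▸ hconv) (mul_nonneg (hχ0 z.2) (hξ0 z))
      linarith
    · have h0 := hw_off z hz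
      have h1 : χ z.2 * ξ z = 0 := by
        rcases hoff z hz with h | ⟨h, -⟩ <;> simp [h]
      simp [h0, h1]
  -- passage to the limit in the difference quotients
  set I : ℝ → ℝ := fun t => ∫ x in Q, ξ (x, t) * Φ (u (x, t)) with hI
  have hslice : ∀ t ∈ Icc a b, ∫ x, ξ (x, t) * P (x, t) = I t := by
    intro t ht
    simp only [hI]
    rw [setIntegral_eq_integral_of_forall_compl_eq_zero fun x hx => by simp [hξQ (x, t) hx]]
    refine integral_congr_ae (Eventually.of_forall fun x => ?_)
    by_cases hx : x ∈ Q
    · simp [hP, hQK x hx t ht]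
    · simp [hξQ (x, t) hx]
  have hcontI : ∀ t ∈ Ioo a b, ContinuousAt (fun t => ∫ x, ξ (x, t) * P (x, t)) t := by
    intro t ht
    have h1 := hu.continuous_L2.continuousAt_integral_slice hQ hQE hΦl hξ hBabs
      (hIcc (Ioo_subset_Icc_self ht))
    refine h1.congr ?_
    filter_upwards [isOpen_Ioo.mem_nhds ht] with s hs
    rw [hslice s (Ioo_subset_Icc_self hs)]
    simp only [hI]
    rw [setIntegral_eq_integral_of_forall_compl_eq_zero fun x hx => by
        simp [hξQ (x, s) fun hc => hx (subset_closure hc)],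
      setIntegral_eq_integral_of_forall_compl_eq_zero fun x hx => by simp [hξQ (x, s) hx]]
  have hlim := tendsto_timeQuotient hPi hξ hBabs htau.le
    (hcontI t₁ ⟨ha2, htau.trans hb1⟩) (hcontI τ ⟨ha2.trans htau, hb1⟩)
  rw [hslice t₁ ⟨ha2.le, (htau.trans hb1).le⟩, hslice τ ⟨(ha2.trans htau).le, hb1.le⟩] at hlim
  have hQm : MeasurableSet (Q ×ˢ Ioo t₁ τ) := hQo.measurableSet.prod measurableSet_Ioo
  have eT : ∫ z : SpaceTime N, χ z.2 * timeDeriv ξ z * P z =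
      ∫ z in Q ×ˢ Ioo t₁ τ, timeDeriv ξ z * Φ (u z) := by
    rw [← integral_indicator hQm]
    refine integral_congr_ae (Eventually.of_forall fun z => ?_)
    by_cases hz : z ∈ Q ×ˢ Ioo t₁ τ
    · rw [indicator_of_mem hz]
      simp only [hχ, hP, indicator_of_mem hz.2, indicator_of_mem (hQK' hz), Pi.one_apply, one_mul]
    · rw [indicator_of_notMem hz]
      rcases hoff z hz with h | ⟨h, -⟩
      · simp [h]
      · simp [timeDeriv_eq_zero_of_nonneg hξ0 h]
  have hJ : ∀ z ∈ Q ×ˢ Ioo t₁ τ, inner ℝ (a' z) (W z) =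
      inner ℝ (A z (u z) (gradU m p u V z))
        ((d (u z ^ alpha m p) * ξ z) • V z + G (u z) • spaceGrad ξ z) := by
    intro z hz
    simp only [hW, hχ, ha', indicator_of_mem hz.2, indicator_of_mem (hQK' hz), Pi.one_apply,
      one_smul]
  have eF : F 0 = ∫ z in Q ×ˢ Ioo t₁ τ, inner ℝ (A z (u z) (gradU m p u V z))
        ((d (u z ^ alpha m p) * ξ z) • V z + G (u z) • spaceGrad ξ z) := by
    rw [← integral_indicator hQm]
    refine integral_congr_ae (Eventually.of_forall fun z => ?_)
    simp only [sub_zero]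
    by_cases hz : z ∈ Q ×ˢ Ioo t₁ τ
    · rw [indicator_of_mem hz, hJ z hz]
    · rw [indicator_of_notMem hz, hW_off z hz, inner_zero_right]
  have hJi : IntegrableOn (fun z => inner ℝ (a' z) (W z)) (Q ×ˢ Ioo t₁ τ) := by
    refine Integrable.integrableOn ?_
    exact (MemLp.integrable_mul (f := fun z => ‖a' z‖) (g := fun z => ‖W z‖)
      (p := ENNReal.ofReal (p / (p - 1))) (q := ENNReal.ofReal p) ha'q.norm hWp.norm).mono'
      (ha'q.1.inner hWp.1) (Eventually.of_forall fun z => norm_inner_le_norm _ _)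
  refine ⟨hJi.congr_fun hJ hQm, ?_⟩
  rw [eT] at hlim
  rw [← eF]
  refine le_of_forall_pos_le_add fun ε hε => ?_
  have hev : ∀ᶠ s : ℝ in 𝓝[>] 0, -(F 0 + ε) ≤ s⁻¹ * ∫ z : SpaceTime N,
      (χ (z.2 + s) * ξ (z + (0, s)) - χ z.2 * ξ z) * P z := by
    filter_upwards [eventually_le_sub_of_distributional hUc hFc hr hdist hε,
      Ioo_mem_nhdsGT (sub_pos.2 ha2)] with s hs1 hs2
    rw [le_inv_mul_iff₀ hs2.1, mul_comm]
    exact hs1.trans (hincr s hs2.1 hs2.2)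
  have hfin := ge_of_tendsto hlim hev
  linarith

/-! ### Extension and powers of cutoff functions -/

/-- The extension of a cutoff function on `Q × [t₁, t₂]` to space-time: by zero in space, and by its
values at `t₁` and `t₂` in time. -/
noncomputable def extendCutoff (Q : Set (Space N)) {t₁ t₂ : ℝ} (ht : t₁ ≤ t₂)
    (ζ : SpaceTime N → ℝ) (z : SpaceTime N) : ℝ :=
  Q.indicator (fun x => ζ (x, projIcc t₁ t₂ ht z.2)) z.1

section Extension

variable {Q : Set (Space N)} {t₁ t₂ : ℝ} {ζ : SpaceTime N → ℝ} (ht : t₁ ≤ t₂)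

theorem extendCutoff_of_notMem {z : SpaceTime N} (hz : z.1 ∉ Q) : extendCutoff Q ht ζ z = 0 :=
  indicator_of_notMem hz _

theorem extendCutoff_of_mem {z : SpaceTime N} (hz : z ∈ Q ×ˢ Icc t₁ t₂) :
    extendCutoff Q ht ζ z = ζ z := by
  rw [extendCutoff, indicator_of_mem hz.1, projIcc_of_mem ht hz.2]

theorem IsCutoff.extendCutoff_nonneg (h : IsCutoff Q t₁ t₂ ζ) (z : SpaceTime N) :
    0 ≤ extendCutoff Q ht ζ z := by
  rw [extendCutoff]
  exact indicator_nonneg (s := Q) (f := fun x => ζ (x, projIcc t₁ t₂ ht z.2))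
    (fun x hx => h.nonneg (x, _) ⟨subset_closure hx, (projIcc t₁ t₂ ht z.2).2⟩) _

theorem IsCutoff.exists_lipschitzWith_extendCutoff (hQ : IsOpen Q) (h : IsCutoff Q t₁ t₂ ζ) :
    ∃ L : ℝ≥0, LipschitzWith L (extendCutoff Q ht ζ) := by
  obtain ⟨L, hL⟩ := h.lipschitz
  refine ⟨L, LipschitzWith.of_dist_le_mul fun z w => ?_⟩
  -- between a point of `Q` and a point outside lies a boundary point, where `ζ` vanishes
  have key : ∀ z w : SpaceTime N, z.1 ∈ Q → w.1 ∉ Q →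
      dist (extendCutoff Q ht ζ z) (extendCutoff Q ht ζ w) ≤ L * dist z w := by
    intro z w hz hw
    obtain ⟨y, hy1, hy2⟩ : (segment ℝ z.1 w.1 ∩ frontier Q).Nonempty := by
      by_contra hne
      rw [not_nonempty_iff_eq_empty, hQ.frontier_eq] at hne
      have hcl : segment ℝ z.1 w.1 ∩ closure Q ⊆ Q := fun y hy => by
        by_contra hyQ
        exact (hne ▸ (⟨hy.1, hy.2, hyQ⟩ : y ∈ segment ℝ z.1 w.1 ∩ (closure Q \ Q)) :
          y ∈ (∅ : Set (Space N)))
      rcases isPreconnected_iff_subset_of_disjoint.1 (convex_segment z.1 w.1).isPreconnected Q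
        (closure Q)ᶜ hQ isClosed_closure.isOpen_compl
        (fun y hy => (em (y ∈ closure Q)).imp (fun h => hcl ⟨hy, h⟩) id)
        (by ext y; simpa using fun _ h => subset_closure h) with h1 | h1
      · exact hw (h1 (right_mem_segment ℝ _ _))
      · exact h1 (left_mem_segment ℝ _ _) (subset_closure hz)
    set s := projIcc t₁ t₂ ht z.2
    have hy0 : ζ (y, s) = 0 := h.lateral (y, s) ⟨hy2, s.2⟩
    have h1 := hL.dist_le_mul (z.1, (s : ℝ)) ⟨subset_closure hz, s.2⟩ (y, (s : ℝ))
      ⟨frontier_subset_closure hy2, s.2⟩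
    have hd : dist z.1 y ≤ dist z.1 w.1 := by
      have := dist_add_dist_of_mem_segment hy1
      linarith [dist_nonneg (x := y) (y := w.1)]
    rw [extendCutoff_of_notMem ht hw, extendCutoff, indicator_of_mem hz, ← hy0]
    refine h1.trans (mul_le_mul_of_nonneg_left ?_ L.2)
    rw [Prod.dist_eq, dist_self, max_eq_left dist_nonneg]
    exact hd.trans (le_max_left _ _)
  by_cases hz : z.1 ∈ Q <;> by_cases hw : w.1 ∈ Q
  · rw [extendCutoff, extendCutoff, indicator_of_mem hz, indicator_of_mem hw]
    refine (hL.dist_le_mul (z.1, (projIcc t₁ t₂ ht z.2 : ℝ))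
      ⟨subset_closure hz, (projIcc t₁ t₂ ht z.2).2⟩ (w.1, (projIcc t₁ t₂ ht w.2 : ℝ))
      ⟨subset_closure hw, (projIcc t₁ t₂ ht w.2).2⟩).trans (mul_le_mul_of_nonneg_left ?_ L.2)
    rw [Prod.dist_eq, Prod.dist_eq]
    refine max_le_max le_rfl ?_
    have := LipschitzWith.projIcc ht |>.dist_le_mul z.2 w.2
    simpa [Subtype.dist_eq] using this
  · exact key z w hz hw
  · rw [dist_comm, dist_comm z w]
    exact key w z hw hz
  · rw [extendCutoff_of_notMem ht hz, extendCutoff_of_notMem ht hw, dist_self]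
    positivity

theorem IsCutoff.exists_extendCutoff_le (hQ : IsCompact (closure Q)) (h : IsCutoff Q t₁ t₂ ζ) :
    ∃ B : ℝ, ∀ z, extendCutoff Q ht ζ z ≤ B := by
  obtain ⟨L, hL⟩ := h.lipschitz
  obtain ⟨B, hB⟩ := (hQ.prod isCompact_Icc).exists_bound_of_continuousOn hL.continuousOn
  refine ⟨max B 0, fun z => ?_⟩
  by_cases hz : z.1 ∈ Q
  · rw [extendCutoff, indicator_of_mem hz]
    exact (le_abs_self _).trans ((hB (z.1, (projIcc t₁ t₂ ht z.2 : ℝ))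
      ⟨subset_closure hz, (projIcc t₁ t₂ ht z.2).2⟩).trans
      (le_max_left _ _))
  · rw [extendCutoff_of_notMem ht hz]
    exact le_max_right _ _

theorem extendCutoff_eventuallyEq (hQ : IsOpen Q) {z : SpaceTime N} (hz : z ∈ Q ×ˢ Ioo t₁ t₂) :
    extendCutoff Q ht ζ =ᶠ[𝓝 z] ζ := by
  filter_upwards [(hQ.prod isOpen_Ioo).mem_nhds hz] with w hw
  exact extendCutoff_of_mem ht ⟨hw.1, Ioo_subset_Icc_self hw.2⟩

end Extension

theorem timeDeriv_congr {f g : SpaceTime N → ℝ} {z : SpaceTime N} (h : f =ᶠ[𝓝 z] g) :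
    timeDeriv f z = timeDeriv g z := by
  have hc : Tendsto (fun s : ℝ => (z.1, s)) (𝓝 z.2) (𝓝 z) := by
    have : Continuous fun s : ℝ => (z.1, s) := by fun_prop
    exact this.tendsto z.2
  have h' : (fun s : ℝ => f (z.1, s)) =ᶠ[𝓝 z.2] fun s => g (z.1, s) := hc.eventually h
  exact h'.deriv_eq

theorem spaceGrad_congr {f g : SpaceTime N → ℝ} {z : SpaceTime N} (h : f =ᶠ[𝓝 z] g) :
    spaceGrad f z = spaceGrad g z := by
  have hc : Tendsto (fun y : Space N => (y, z.2)) (𝓝 z.1) (𝓝 z) := by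
    have : Continuous fun y : Space N => (y, z.2) := by fun_prop
    exact this.tendsto z.1
  have h' : (fun y : Space N => f (y, z.2)) =ᶠ[𝓝 z.1] fun y => g (y, z.2) := hc.eventually h
  rw [spaceGrad, spaceGrad, gradient, gradient, h'.fderiv_eq]

section Power

variable {ζ : SpaceTime N → ℝ} {p : ℝ}

theorem exists_lipschitzWith_rpow (hp : 1 ≤ p) {L : ℝ≥0} (hζ : LipschitzWith L ζ)
    (hζ0 : ∀ z, 0 ≤ ζ z) {B : ℝ} (hB : ∀ z, ζ z ≤ B) :
    ∃ L' : ℝ≥0, LipschitzWith L' fun z => ζ z ^ p := by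
  have hB0 : 0 ≤ B := (hζ0 0).trans (hB 0)
  have hC : 0 ≤ p * B ^ (p - 1) := by positivity
  refine ⟨(p * B ^ (p - 1)).toNNReal * L, LipschitzWith.of_dist_le_mul fun z w => ?_⟩
  have h1 : ‖ζ z ^ p - ζ w ^ p‖ ≤ p * B ^ (p - 1) * ‖ζ z - ζ w‖ := by
    refine Convex.norm_image_sub_le_of_norm_hasDerivWithin_le (s := Icc 0 B)
      (f := fun x : ℝ => x ^ p) (f' := fun x => p * x ^ (p - 1))
      (fun x _ => (Real.hasDerivAt_rpow_const (Or.inr hp)).hasDerivWithinAt) (fun x hx => ?_)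
      (convex_Icc 0 B) ⟨hζ0 w, hB w⟩ ⟨hζ0 z, hB z⟩
    rw [Real.norm_of_nonneg (mul_nonneg (by linarith) (Real.rpow_nonneg hx.1 _))]
    exact mul_le_mul_of_nonneg_left (Real.rpow_le_rpow hx.1 hx.2 (by linarith)) (by linarith)
  rw [dist_eq_norm]
  refine h1.trans ?_
  rw [NNReal.coe_mul, Real.coe_toNNReal _ hC, mul_assoc (p * B ^ (p - 1))]
  exact mul_le_mul_of_nonneg_left (hζ.dist_le_mul z w) hC

theorem spaceGrad_rpow (hp : 1 ≤ p) {z : SpaceTime N} (h : DifferentiableAt ℝ ζ z) :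
    spaceGrad (fun w => ζ w ^ p) z = (p * ζ z ^ (p - 1)) • spaceGrad ζ z := by
  refine ext_inner_right ℝ fun e => ?_
  have h1 := h.hasFDerivAt.rpow_const (p := p) (Or.inr hp)
  rw [inner_spaceGrad_eq_fderiv h1.differentiableAt, h1.fderiv, real_inner_smul_left,
    inner_spaceGrad_eq_fderiv h]
  simp

theorem timeDeriv_rpow (hp : 1 ≤ p) {z : SpaceTime N} (h : DifferentiableAt ℝ ζ z) :
    timeDeriv (fun w => ζ w ^ p) z = p * ζ z ^ (p - 1) * timeDeriv ζ z := by
  have h1 := h.hasFDerivAt.rpow_const (p := p) (Or.inr hp)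
  rw [timeDeriv_eq_fderiv h1.differentiableAt, h1.fderiv, timeDeriv_eq_fderiv h]
  simp

end Power

/-! ### Absorption of the gradient term -/

/-- The constant in Young's inequality `p Λ X^{p-1} Y ≤ (λ/2) X^p + C Y^p`. -/
noncomputable def youngConst (p lam Lam : ℝ) : ℝ := p * Lam * (2 * p * Lam / lam) ^ (p - 1)

theorem young_le {p lam Lam X Y : ℝ} (hp : 1 < p) (hlam : 0 < lam) (hLam : 0 < Lam) (hX : 0 ≤ X)
    (hY : 0 ≤ Y) :
    p * Lam * X ^ (p - 1) * Y ≤ lam / 2 * X ^ p + youngConst p lam Lam * Y ^ p := by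
  have hsplit : ∀ {x : ℝ}, 0 ≤ x → x ^ p = x ^ (p - 1) * x := fun {x} hx => by
    rw [← Real.rpow_add_one' hx (by linarith), sub_add_cancel]
  have hC : 0 ≤ youngConst p lam Lam := by unfold youngConst; positivity
  rcases le_total (p * Lam * Y) (lam / 2 * X) with h | h
  · have h1 := mul_le_mul_of_nonneg_left h (Real.rpow_nonneg hX (p - 1))
    have h2 : 0 ≤ youngConst p lam Lam * Y ^ p := by positivity
    rw [hsplit hX]
    linarith
  · have h1 : X ≤ 2 * p * Lam / lam * Y := by
      rw [div_mul_eq_mul_div, le_div_iff₀ hlam]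
      linarith
    have h2 := Real.rpow_le_rpow hX h1 (by linarith : 0 ≤ p - 1)
    rw [Real.mul_rpow (by positivity) hY] at h2
    have h3 := mul_le_mul_of_nonneg_left h2 (by positivity : 0 ≤ p * Lam * Y)
    have h4 : 0 ≤ lam / 2 * X ^ p := by positivity
    have h5 : youngConst p lam Lam * Y ^ p =
        p * Lam * Y * ((2 * p * Lam / lam) ^ (p - 1) * Y ^ (p - 1)) := by
      rw [hsplit hY, youngConst]
      ring
    linarith

/-- An integral inequality for `J ≤ R - e` bounds the integral of `e` in terms of that of `R`, which is
allowed to be infinite. -/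
theorem ofReal_add_lintegral_le {X : Type*} [MeasurableSpace X] {μ : Measure X} {J e R : X → ℝ}
    (hJ : Integrable J μ) (he : ∀ x, 0 ≤ e x) (hR0 : ∀ x, 0 ≤ R x) (hR : AEStronglyMeasurable R μ)
    (h : ∀ᵐ x ∂μ, J x ≤ R x - e x) {a b : ℝ} (ha : 0 ≤ a) (hab : a ≤ b + ∫ x, J x ∂μ) :
    ENNReal.ofReal a + ∫⁻ x, ENNReal.ofReal (e x) ∂μ ≤
      ENNReal.ofReal b + ∫⁻ x, ENNReal.ofReal (R x) ∂μ := by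
  rcases eq_or_ne (∫⁻ x, ENNReal.ofReal (R x) ∂μ) ⊤ with htop | htop
  · simp [htop]
  have hRi : Integrable R μ :=
    (lintegral_ofReal_ne_top_iff_integrable hR (Eventually.of_forall hR0)).1 htop
  have hle : ∀ᵐ x ∂μ, 0 ≤ R x - J x := h.mono fun x hx => by linarith [he x]
  have h1 : ∫⁻ x, ENNReal.ofReal (e x) ∂μ ≤ ENNReal.ofReal (∫ x, (R x - J x) ∂μ) := by
    have hRJ : Integrable (fun x => R x - J x) μ := hRi.sub hJ
    rw [ofReal_integral_eq_lintegral_ofReal hRJ hle]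
    exact lintegral_mono_ae (h.mono fun x hx => ENNReal.ofReal_le_ofReal (by linarith))
  rw [← ofReal_integral_eq_lintegral_ofReal hRi (Eventually.of_forall hR0)]
  refine (add_le_add_right h1 _).trans ?_
  rw [← ENNReal.ofReal_add ha (integral_nonneg_of_ae hle), integral_sub hRi hJ]
  refine (ENNReal.ofReal_le_ofReal ?_).trans ENNReal.ofReal_add_le
  linarith

theorem ofReal_integral_le_lintegral_abs {X : Type*} [MeasurableSpace X] {μ : Measure X}
    (f : X → ℝ) : ENNReal.ofReal (∫ x, f x ∂μ) ≤ ∫⁻ x, ENNReal.ofReal |f x| ∂μ := by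
  refine (ENNReal.ofReal_le_ofReal (le_abs_self _)).trans ?_
  rw [← Real.norm_eq_abs, ofReal_norm]
  refine (enorm_integral_le_lintegral_enorm f).trans (le_of_eq ?_)
  simp only [← Real.norm_eq_abs, ofReal_norm]

section TailIntegral

variable {c : ℝ → ℝ} {K : ℝ}

/-- The function `H(σ) = ∫_σ^K c` for `σ ≤ K`, and `H(σ) = 0` for `σ ≥ K`. -/
noncomputable def tailIntegral (c : ℝ → ℝ) (K σ : ℝ) : ℝ := ∫ r in min σ K..K, c r

theorem tailIntegral_of_le {σ : ℝ} (h : K ≤ σ) : tailIntegral c K σ = 0 := by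
  rw [tailIntegral, min_eq_right h, intervalIntegral.integral_same]

theorem tailIntegral_nonneg (hc0 : ∀ s, 0 ≤ c s) (σ : ℝ) : 0 ≤ tailIntegral c K σ :=
  intervalIntegral.integral_nonneg (min_le_right _ _) fun s _ => hc0 s

theorem antitone_tailIntegral (hc : Continuous c) (hc0 : ∀ s, 0 ≤ c s) :
    Antitone (tailIntegral c K) := by
  intro a b hab
  refine intervalIntegral.integral_mono_interval (min_le_min_right K hab) (min_le_right _ _) le_rfl
    (Eventually.of_forall hc0) (hc.intervalIntegrable _ _)

/-- `H` is the primitive, vanishing at `K`, of the truncated weight. -/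
theorem integral_ite_eq_tailIntegral (σ : ℝ) :
    ∫ r in K..σ, (if r ≤ K then -c r else 0) = tailIntegral c K σ := by
  rcases le_total K σ with h | h
  · rw [tailIntegral_of_le h]
    refine intervalIntegral.integral_zero_ae (Eventually.of_forall fun r hr => ?_)
    rw [uIoc_of_le h] at hr
    rw [if_neg (not_le.2 hr.1)]
  · rw [tailIntegral, min_eq_left h, intervalIntegral.integral_symm, ← intervalIntegral.integral_neg]
    refine intervalIntegral.integral_congr fun r hr => ?_
    rw [uIcc_of_le h] at hr
    simp [hr.2]

/-- The truncated weight is a bounded pointwise limit of continuous functions. -/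
theorem tendsto_cutoff_weight (s : ℝ) :
    Tendsto (fun n : ℕ => -c s * max 0 (1 - n * max 0 (s - K))) atTop
      (𝓝 (if s ≤ K then -c s else 0)) := by
  rcases le_or_gt s K with h | h
  · simp [h]
  · rw [if_neg (not_le.2 h), max_eq_right (sub_pos.2 h).le]
    refine tendsto_const_nhds.congr' ?_
    obtain ⟨n, hn⟩ := exists_nat_gt (1 / (s - K))
    filter_upwards [eventually_ge_atTop n] with i hi
    have h1 : (n : ℝ) ≤ i := by exact_mod_cast hi
    rw [div_lt_iff₀ (sub_pos.2 h)] at hn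
    have h2 := mul_le_mul_of_nonneg_right h1 (sub_pos.2 h).le
    rw [max_eq_left (by linarith), mul_zero]

end TailIntegral

/-- The truncation `H(s^α)` of a positive number `s`, decreasing and vanishing for `s ≥ k`. The
extension to negative numbers by a constant is immaterial. -/
noncomputable def levelFun (c : ℝ → ℝ) (α k s : ℝ) : ℝ := tailIntegral c (k ^ α) (max s 0 ^ α)

/-- The primitive `∫_s^k H(r^α) dr`, a convex function vanishing for `s ≥ k`. -/
noncomputable def levelEnergy (c : ℝ → ℝ) (α k s : ℝ) : ℝ := ∫ r in s..k, levelFun c α k r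

section LevelFun

variable {c : ℝ → ℝ} {α k : ℝ}

theorem levelFun_of_pos {s : ℝ} (hs : 0 < s) :
    levelFun c α k s = tailIntegral c (k ^ α) (s ^ α) := by rw [levelFun, max_eq_left hs.le]

theorem levelFun_of_le (hα : 0 < α) (hk : 0 < k) {s : ℝ} (h : k ≤ s) : levelFun c α k s = 0 := by
  rw [levelFun_of_pos (hk.trans_le h)]
  exact tailIntegral_of_le (Real.rpow_le_rpow hk.le h hα.le)

theorem antitone_levelFun (hα : 0 < α) (hc : Continuous c) (hc0 : ∀ s, 0 ≤ c s) :
    Antitone (levelFun c α k) := fun _ _ hab =>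
  antitone_tailIntegral hc hc0 (Real.rpow_le_rpow (le_max_right _ _)
    (max_le_max_right 0 hab) hα.le)

theorem levelFun_nonneg (hc0 : ∀ s, 0 ≤ c s) (s : ℝ) : 0 ≤ levelFun c α k s :=
  tailIntegral_nonneg hc0 _

theorem levelFun_le (hc : Continuous c) (hc0 : ∀ s, 0 ≤ c s) (s : ℝ) :
    levelFun c α k s ≤ tailIntegral c (k ^ α) 0 :=
  antitone_tailIntegral hc hc0 (Real.rpow_nonneg (le_max_right _ _) _)

theorem levelEnergy_of_le (hα : 0 < α) (hk : 0 < k) {s : ℝ} (h : k ≤ s) :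
    levelEnergy c α k s = 0 := by
  refine intervalIntegral.integral_zero_ae (Eventually.of_forall fun r hr => ?_)
  rw [uIoc_of_ge h] at hr
  exact levelFun_of_le hα hk hr.1.le

theorem levelEnergy_nonneg (hα : 0 < α) (hk : 0 < k) (hc0 : ∀ s, 0 ≤ c s) (s : ℝ) :
    0 ≤ levelEnergy c α k s := by
  rcases le_total k s with h | h
  · rw [levelEnergy_of_le hα hk h]
  · exact intervalIntegral.integral_nonneg h fun r _ => levelFun_nonneg hc0 r

end LevelFun

/-- The energy inequality for a positive supersolution tested with `ζ^p H(u^α)`, after absorption of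
a part of the gradient term by Young's inequality. -/
theorem IsPositiveWeakSupersolution.lintegral_energy_le {m p C₀ C₁ : ℝ} (hC₀ : 0 < C₀)
    (hC₁ : 0 < C₁) (hp : 1 < p) (hα : 0 < alpha m p) {E : Set (Space N)} (hE : IsOpen E)
    {T₁ T₂ : ℝ} {A : SpaceTime N → ℝ → Space N → Space N} {u : SpaceTime N → ℝ}
    {V : SpaceTime N → Space N} (hA : StructureConditions m p C₀ C₁ E T₁ T₂ A u V)
    (hu : IsPositiveWeakSupersolution m p E T₁ T₂ A u V)
    {Q : Set (Space N)} (hQo : IsOpen Q) (hQ : IsCompact (closure Q)) (hQE : closure Q ⊆ E)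
    {ζ : SpaceTime N → ℝ} {L : ℝ≥0} (hζ : LipschitzWith L ζ) (hζ0 : ∀ z, 0 ≤ ζ z)
    (hζQ : ∀ z : SpaceTime N, z.1 ∉ Q → ζ z = 0) {B : ℝ} (hB : ∀ z, ζ z ≤ B)
    {c : ℝ → ℝ} (hc : Continuous c) (hc0 : ∀ s, 0 < c s) {M : ℝ} (hcM : ∀ s, c s ≤ M)
    {k : ℝ} (hk : 0 < k) {t₁ τ : ℝ} (ht₁ : T₁ < t₁) (htau : t₁ < τ) (hτ : τ < T₂) :
    (∫⁻ x in Q, ENNReal.ofReal (ζ (x, τ) ^ p * levelEnergy c (alpha m p) k (u (x, τ)))) +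
      cylInt Q t₁ τ (fun z => {w : SpaceTime N | u w < k}.indicator (fun w =>
        c (u w ^ alpha m p) * (C₀ * alpha m p ^ (1 - p) / 2 * (ζ w * ‖V w‖) ^ p)) z) ≤
    (∫⁻ x in Q, ENNReal.ofReal (ζ (x, t₁) ^ p * levelEnergy c (alpha m p) k (u (x, t₁)))) +
      cylInt Q t₁ τ (fun z =>
        |timeDeriv (fun w => ζ w ^ p) z| * levelEnergy c (alpha m p) k (u z)) +
      cylInt Q t₁ τ (fun z => c (u z ^ alpha m p) *
        (youngConst p (C₀ * alpha m p ^ (1 - p)) (C₁ * alpha m p ^ (1 - p)) *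
          (levelFun c (alpha m p) k (u z) / c (u z ^ alpha m p) * ‖spaceGrad ζ z‖) ^ p)) := by
  set α := alpha m p with hα'
  set lam := C₀ * α ^ (1 - p) with hlam
  set Lam := C₁ * α ^ (1 - p) with hLam
  have hlam0 : 0 < lam := by positivity
  have hLam0 : 0 < Lam := by positivity
  have hY0 : 0 ≤ youngConst p lam Lam := by unfold youngConst; positivity
  have hc0' : ∀ s, 0 ≤ c s := fun s => (hc0 s).le
  set S : Set (SpaceTime N) := Q ×ˢ Ioo t₁ τ with hS
  have hSE : S ⊆ E ×ˢ Ioo T₁ T₂ := prod_mono (subset_closure.trans hQE)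
    fun t ht => ⟨ht₁.trans ht.1, ht.2.trans hτ⟩
  have hSm : MeasurableSet S := hQo.measurableSet.prod measurableSet_Ioo
  obtain ⟨L', hξ⟩ := exists_lipschitzWith_rpow hp.le hζ hζ0 hB
  have hξ0 : ∀ z, 0 ≤ ζ z ^ p := fun z => Real.rpow_nonneg (hζ0 z) p
  set D : ℝ≥0 := (tailIntegral c (k ^ α) 0).toNNReal with hD
  have hGD : ∀ s, levelFun c α k s ≤ D := fun s =>
    (levelFun_le hc hc0' s).trans (Real.le_coe_toNNReal _)
  have hGa : Antitone (levelFun c α k) := antitone_levelFun hα hc hc0'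
  have hG0 : ∀ s, 0 ≤ levelFun c α k s := levelFun_nonneg hc0'
  obtain ⟨hJ, hmain⟩ := hu.energy_inequality hp hα hE hA hQo hQ hQE hξ hξ0
    (fun z hz => by rw [hζQ z hz, Real.zero_rpow (by linarith)])
    (fun z => Real.rpow_le_rpow (hζ0 z) (hB z) (by linarith : 0 ≤ p))
    (d := fun s => if s ≤ k ^ α then -c s else 0)
    (dn := fun n s => -c s * max 0 (1 - n * max 0 (s - k ^ α))) (M := M)
    (fun n => by fun_prop)
    (fun n s => by
      have h1 : max 0 (1 - (n : ℝ) * max 0 (s - k ^ α)) ≤ 1 :=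
        max_le zero_le_one (by
          have : 0 ≤ (n : ℝ) * max 0 (s - k ^ α) := by positivity
          linarith)
      rw [abs_mul, abs_neg, abs_of_pos (hc0 s), abs_of_nonneg (le_max_left _ _)]
      exact (mul_le_of_le_one_right (hc0' s) h1).trans (hcM s))
    (fun s => tendsto_cutoff_weight s) (k ^ α)
    (fun s hs => by
      rw [integral_ite_eq_tailIntegral, levelFun_of_pos hs])
    hGa hG0 hGD k ht₁ htau hτ
  have hΦ : ∀ s, ∫ r in s..k, levelFun c α k r = levelEnergy c α k s := fun _ => rfl
  simp only [hΦ] at hmain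
  have hΦl : LipschitzWith D (levelEnergy c α k) :=
    lipschitzWith_integral_of_abs_le hGa (fun s => by rw [abs_of_nonneg (hG0 s)]; exact hGD s) k
  have hΦ0 : ∀ s, 0 ≤ levelEnergy c α k s := levelEnergy_nonneg hα hk hc0'
  have hslice : IntegrableOn (fun x => ζ (x, τ) ^ p * levelEnergy c α k (u (x, τ))) Q := by
    have h1 := (hu.continuous_L2.integrableOn_slice hQ hQE hΦl
      (⟨ht₁.trans htau, hτ⟩ : τ ∈ Ioo T₁ T₂)).mono_set subset_closure
    refine h1.bdd_mul (c := B ^ p)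
      (hξ.continuous.comp (by fun_prop : Continuous fun x : Space N => (x, τ))).aestronglyMeasurable
      (Eventually.of_forall fun x => ?_)
    rw [Real.norm_of_nonneg (hξ0 _)]
    exact Real.rpow_le_rpow (hζ0 _) (hB _) (by linarith)
  have hum : AEStronglyMeasurable u (volume.restrict S) := hu.measurable.mono_set hSE
  have hvm : AEMeasurable (fun z => u z ^ α) (volume.restrict S) := hum.aemeasurable.pow_const _
  have hcm : AEMeasurable (fun z => c (u z ^ α)) (volume.restrict S) :=
    hc.measurable.comp_aemeasurable hvm
  have hGm : AEMeasurable (fun z => levelFun c α k (u z)) (volume.restrict S) :=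
    hGa.measurable.comp_aemeasurable hum.aemeasurable
  have hRm : AEStronglyMeasurable (fun z => c (u z ^ α) * (youngConst p lam Lam *
      (levelFun c α k (u z) / c (u z ^ α) * ‖spaceGrad ζ z‖) ^ p)) (volume.restrict S) :=
    (hcm.mul ((((hGm.div hcm).mul
      (measurable_spaceGrad hζ.continuous).norm.aemeasurable).pow_const p).const_mul
      _)).aestronglyMeasurable
  have hpw : ∀ᵐ z ∂(volume.restrict S),
      inner ℝ (A z (u z) (gradU m p u V z))
        (((if u z ^ α ≤ k ^ α then -c (u z ^ α) else 0) * ζ z ^ p) • V z +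
          levelFun c α k (u z) • spaceGrad (fun w => ζ w ^ p) z) ≤
      c (u z ^ α) * (youngConst p lam Lam *
        (levelFun c α k (u z) / c (u z ^ α) * ‖spaceGrad ζ z‖) ^ p) -
      {w : SpaceTime N | u w < k}.indicator (fun w =>
        c (u w ^ α) * (lam / 2 * (ζ w * ‖V w‖) ^ p)) z := by
    filter_upwards [ae_restrict_of_ae_restrict_of_subset hSE (hA.norm_flux_le hu.pos hp hα),
      ae_restrict_of_ae_restrict_of_subset hSE (hA.le_inner_flux hu.pos hp hα),
      ae_restrict_of_ae_restrict_of_subset hSE hu.pos,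
      ae_restrict_of_ae (hζ.ae_differentiableAt (μ := volume))] with z h1 h2 hpos hdiff
    rw [spaceGrad_rpow hp.le hdiff, inner_add_right, real_inner_smul_right, real_inner_smul_right,
      real_inner_smul_right]
    set a := A z (u z) (gradU m p u V z)
    set cz := c (u z ^ α) with hcz
    have hcz0 : 0 < cz := hc0 _
    set g := levelFun c α k (u z) with hg
    have hg0 : 0 ≤ g := hG0 _
    have haV : 0 ≤ inner ℝ a (V z) := le_trans (by positivity) h2
    have hR0 : 0 ≤ cz * (youngConst p lam Lam * (g / cz * ‖spaceGrad ζ z‖) ^ p) := by positivity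
    -- on `u < k` Young's inequality is used with `X = ζ |V|` and `Y = (G / c) |Dζ|`; elsewhere
    -- `G(u) = 0` and the remaining term has a sign
    rcases lt_or_ge (u z) k with hlt | hge
    · rw [if_pos (Real.rpow_le_rpow hpos.le hlt.le hα.le),
        indicator_of_mem (show z ∈ {w : SpaceTime N | u w < k} from hlt)]
      have hY := young_le hp hlam0 hLam0 (mul_nonneg (hζ0 z) (norm_nonneg (V z)))
        (by positivity : 0 ≤ g / cz * ‖spaceGrad ζ z‖)
      have hY' := mul_le_mul_of_nonneg_left hY hcz0.le
      have e1 : (ζ z * ‖V z‖) ^ p = ζ z ^ p * ‖V z‖ ^ p :=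
        Real.mul_rpow (hζ0 z) (norm_nonneg _)
      have e2 : (ζ z * ‖V z‖) ^ (p - 1) = ζ z ^ (p - 1) * ‖V z‖ ^ (p - 1) :=
        Real.mul_rpow (hζ0 z) (norm_nonneg _)
      have e3 : cz * (p * Lam * (ζ z * ‖V z‖) ^ (p - 1) * (g / cz * ‖spaceGrad ζ z‖)) =
          g * (p * ζ z ^ (p - 1) * (Lam * ‖V z‖ ^ (p - 1) * ‖spaceGrad ζ z‖)) := by
        rw [e2]
        field_simp
      have h3 : inner ℝ a (spaceGrad ζ z) ≤ Lam * ‖V z‖ ^ (p - 1) * ‖spaceGrad ζ z‖ :=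
        (real_inner_le_norm _ _).trans (mul_le_mul_of_nonneg_right h1 (norm_nonneg _))
      have h4 : g * (p * ζ z ^ (p - 1) * inner ℝ a (spaceGrad ζ z)) ≤
          g * (p * ζ z ^ (p - 1) * (Lam * ‖V z‖ ^ (p - 1) * ‖spaceGrad ζ z‖)) := by
        have : 0 ≤ p * ζ z ^ (p - 1) := mul_nonneg (by linarith) (Real.rpow_nonneg (hζ0 z) _)
        gcongr
      have h5 : cz * (lam * (ζ z * ‖V z‖) ^ p) ≤ cz * ζ z ^ p * inner ℝ a (V z) := by
        rw [e1]
        have := mul_le_mul_of_nonneg_left h2 (mul_nonneg hcz0.le (hξ0 z))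
        linarith
      rw [e3] at hY'
      linarith
    · rw [indicator_of_notMem (show z ∉ {w : SpaceTime N | u w < k} from not_lt.2 hge), sub_zero,
        show g = 0 from levelFun_of_le hα hk hge, zero_mul, add_zero]
      rw [show g = 0 from levelFun_of_le hα hk hge] at hR0
      refine le_trans (mul_nonpos_of_nonpos_of_nonneg
        (mul_nonpos_of_nonpos_of_nonneg ?_ (hξ0 z)) haV) hR0
      split_ifs
      · linarith
      · exact le_rfl
  have hfin := ofReal_add_lintegral_le hJ
    (fun z => indicator_nonneg (s := {w : SpaceTime N | u w < k}) (f := fun w =>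
        c (u w ^ α) * (lam / 2 * (ζ w * ‖V w‖) ^ p)) (fun w _ => mul_nonneg (hc0' _)
          (mul_nonneg (by positivity) (Real.rpow_nonneg (mul_nonneg (hζ0 w) (norm_nonneg _)) _))) z)
    (fun z => mul_nonneg (hc0' _) (mul_nonneg hY0 (Real.rpow_nonneg (mul_nonneg
      (div_nonneg (hG0 _) (hc0' _)) (norm_nonneg _)) _))) hRm hpw
    (integral_nonneg fun x => mul_nonneg (hξ0 _) (hΦ0 _)) hmain
  rw [ofReal_integral_eq_lintegral_ofReal hslice
    (Eventually.of_forall fun x => mul_nonneg (hξ0 _) (hΦ0 _))] at hfin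
  refine hfin.trans (add_le_add_left ?_ _)
  refine ENNReal.ofReal_add_le.trans (add_le_add ?_ ?_)
  · refine (ofReal_integral_le_lintegral_abs _).trans (le_of_eq ?_)
    refine lintegral_congr fun x => ?_
    rw [abs_of_nonneg (mul_nonneg (hξ0 _) (hΦ0 _))]
  · refine (ofReal_integral_le_lintegral_abs _).trans (le_of_eq ?_)
    refine lintegral_congr fun z => ?_
    rw [abs_mul, abs_of_nonneg (hΦ0 _)]

/-! ### The energy inequality for cutoff functions on a cylinder -/

theorem cylInt_mono_ae {Q : Set (Space N)} {t₁ t₂ : ℝ} {f g : SpaceTime N → ℝ}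
    (h : ∀ᵐ z ∂(volume.restrict (Q ×ˢ Ioo t₁ t₂)), f z ≤ g z) :
    cylInt Q t₁ t₂ f ≤ cylInt Q t₁ t₂ g :=
  lintegral_mono_ae (h.mono fun _ hz => ENNReal.ofReal_le_ofReal hz)

theorem cylInt_congr {Q : Set (Space N)} (hQ : IsOpen Q) {t₁ t₂ : ℝ} {f g : SpaceTime N → ℝ}
    (h : ∀ z ∈ Q ×ˢ Ioo t₁ t₂, f z = g z) : cylInt Q t₁ t₂ f = cylInt Q t₁ t₂ g :=
  setLIntegral_congr_fun (hQ.measurableSet.prod measurableSet_Ioo) fun z hz => by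
    simp only [h z hz]

theorem cylInt_mono_right (Q : Set (Space N)) (t₁ : ℝ) {s t : ℝ} (hst : s ≤ t)
    (f : SpaceTime N → ℝ) : cylInt Q t₁ s f ≤ cylInt Q t₁ t f :=
  lintegral_mono_set (prod_mono le_rfl (Ioo_subset_Ioo_right hst))

theorem cylInt_const_mul {Q : Set (Space N)} {t₁ t₂ a : ℝ} (ha : 0 ≤ a) (f : SpaceTime N → ℝ) :
    cylInt Q t₁ t₂ (fun z => a * f z) = ENNReal.ofReal a * cylInt Q t₁ t₂ f := by
  simp only [cylInt, ENNReal.ofReal_mul ha]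
  exact lintegral_const_mul' _ _ ENNReal.ofReal_ne_top

theorem truncMinus_nonneg (s k : ℝ) : 0 ≤ truncMinus s k := le_max_right _ _

theorem truncMinus_of_le {s k : ℝ} (h : s ≤ k) : truncMinus s k = k - s := by
  rw [truncMinus, max_eq_left (by linarith), neg_sub]

theorem truncMinus_of_ge {s k : ℝ} (h : k ≤ s) : truncMinus s k = 0 := by
  rw [truncMinus, max_eq_right (by linarith)]

section Cutoff

variable {Q : Set (Space N)} {t₁ t₂ : ℝ} {ζ : SpaceTime N → ℝ}

theorem IsCutoff.ae_timeDeriv_rpow (h : IsCutoff Q t₁ t₂ ζ) (ht : t₁ ≤ t₂) (hQ : IsOpen Q) {p : ℝ}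
    (hp : 1 ≤ p) : ∀ᵐ z ∂(volume.restrict (Q ×ˢ Ioo t₁ t₂)),
      timeDeriv (fun w => ζ w ^ p) z = p * ζ z ^ (p - 1) * timeDeriv ζ z := by
  obtain ⟨L, hL⟩ := h.exists_lipschitzWith_extendCutoff ht hQ
  filter_upwards [ae_restrict_of_ae (hL.ae_differentiableAt (μ := volume)),
    ae_restrict_mem (hQ.measurableSet.prod measurableSet_Ioo)] with z hz hzQ
  exact timeDeriv_rpow hp (hz.congr_of_eventuallyEq (extendCutoff_eventuallyEq ht hQ hzQ).symm)

theorem IsCutoff.exists_norm_spaceGrad_le (h : IsCutoff Q t₁ t₂ ζ) (ht : t₁ ≤ t₂) (hQ : IsOpen Q) :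
    ∃ L : ℝ≥0, ∀ z ∈ Q ×ˢ Ioo t₁ t₂, ‖spaceGrad ζ z‖ ≤ L := by
  obtain ⟨L, hL⟩ := h.exists_lipschitzWith_extendCutoff ht hQ
  refine ⟨L, fun z hz => ?_⟩
  rw [← spaceGrad_congr (extendCutoff_eventuallyEq ht hQ hz)]
  exact norm_spaceGrad_le hL z

/-- `IsPositiveWeakSupersolution.lintegral_energy_le` for a cutoff function that is
only given on the closed cylinder, up to any time `τ` in the interval. -/
theorem IsCutoff.lintegral_energy_le {m p C₀ C₁ : ℝ} (hC₀ : 0 < C₀)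
    (hC₁ : 0 < C₁) (hp : 1 < p) (hα : 0 < alpha m p) {E : Set (Space N)} (hE : IsOpen E)
    {T₁ T₂ : ℝ} {A : SpaceTime N → ℝ → Space N → Space N} {u : SpaceTime N → ℝ}
    {V : SpaceTime N → Space N} (hA : StructureConditions m p C₀ C₁ E T₁ T₂ A u V)
    (hu : IsPositiveWeakSupersolution m p E T₁ T₂ A u V)
    (hQo : IsOpen Q) (hQ : IsCompact (closure Q)) (hQE : closure Q ⊆ E)
    (hζ : IsCutoff Q t₁ t₂ ζ)
    {c : ℝ → ℝ} (hc : Continuous c) (hc0 : ∀ s, 0 < c s) {M : ℝ} (hcM : ∀ s, c s ≤ M)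
    {k : ℝ} (hk : 0 < k) {τ : ℝ} (ht₁ : T₁ < t₁) (ht₂ : t₂ < T₂) (htau : τ ∈ Ioc t₁ t₂) :
    (∫⁻ x in Q, ENNReal.ofReal (ζ (x, τ) ^ p * levelEnergy c (alpha m p) k (u (x, τ)))) +
      cylInt Q t₁ τ (fun z => {w : SpaceTime N | u w < k}.indicator (fun w =>
        c (u w ^ alpha m p) * (C₀ * alpha m p ^ (1 - p) / 2 * (ζ w * ‖V w‖) ^ p)) z) ≤
    (∫⁻ x in Q, ENNReal.ofReal (ζ (x, t₁) ^ p * levelEnergy c (alpha m p) k (u (x, t₁)))) +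
      cylInt Q t₁ τ (fun z =>
        |timeDeriv (fun w => ζ w ^ p) z| * levelEnergy c (alpha m p) k (u z)) +
      cylInt Q t₁ τ (fun z => c (u z ^ alpha m p) *
        (youngConst p (C₀ * alpha m p ^ (1 - p)) (C₁ * alpha m p ^ (1 - p)) *
          (levelFun c (alpha m p) k (u z) / c (u z ^ alpha m p) * ‖spaceGrad ζ z‖) ^ p)) := by
  have ht : t₁ ≤ t₂ := (htau.1.trans_le htau.2).le
  obtain ⟨L, hL⟩ := hζ.exists_lipschitzWith_extendCutoff ht hQo
  obtain ⟨B, hB⟩ := hζ.exists_extendCutoff_le ht hQ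
  have h := hu.lintegral_energy_le hC₀ hC₁ hp hα hE hA hQo hQ hQE hL (hζ.extendCutoff_nonneg ht)
    (fun z hz => extendCutoff_of_notMem ht hz) hB hc hc0 hcM hk ht₁ htau.1
    (htau.2.trans_lt ht₂)
  have hsl : ∀ s ∈ Icc t₁ t₂,
      ∫⁻ x in Q, ENNReal.ofReal (extendCutoff Q ht ζ (x, s) ^ p *
        levelEnergy c (alpha m p) k (u (x, s))) =
      ∫⁻ x in Q, ENNReal.ofReal (ζ (x, s) ^ p * levelEnergy c (alpha m p) k (u (x, s))) :=
    fun s hs => setLIntegral_congr_fun hQo.measurableSet fun x hx => by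
      simp only [extendCutoff_of_mem ht (z := (x, s)) ⟨hx, hs⟩]
  have hmem : ∀ z ∈ Q ×ˢ Ioo t₁ τ, z ∈ Q ×ˢ Ioo t₁ t₂ := fun z hz =>
    ⟨hz.1, hz.2.1, hz.2.2.trans_le htau.2⟩
  have heq : ∀ z ∈ Q ×ˢ Ioo t₁ τ, extendCutoff Q ht ζ =ᶠ[𝓝 z] ζ := fun z hz =>
    extendCutoff_eventuallyEq ht hQo (hmem z hz)
  rw [hsl τ ⟨htau.1.le, htau.2⟩, hsl t₁ ⟨le_rfl, ht⟩] at h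
  refine le_of_eq_of_le ?_ (h.trans (le_of_eq ?_))
  · congr 1
    refine cylInt_congr hQo fun z hz => ?_
    by_cases hzk : z ∈ {w : SpaceTime N | u w < k}
    · rw [indicator_of_mem hzk, indicator_of_mem hzk, (heq z hz).eq_of_nhds]
    · rw [indicator_of_notMem hzk, indicator_of_notMem hzk]
  · congr 1
    · congr 1
      refine cylInt_congr hQo fun z hz => ?_
      have e : (fun w => extendCutoff Q ht ζ w ^ p) =ᶠ[𝓝 z] fun w => ζ w ^ p :=
        (heq z hz).fun_comp (· ^ p)
      rw [timeDeriv_congr e]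
    · refine cylInt_congr hQo fun z hz => ?_
      rw [spaceGrad_congr (heq z hz)]

end Cutoff

theorem integral_mul_sub (a s k : ℝ) : ∫ r in s..k, a * (k - r) = a * (k - s) ^ 2 / 2 := by
  rw [intervalIntegral.integral_const_mul, intervalIntegral.integral_sub
    intervalIntegrable_const intervalIntegral.intervalIntegrable_id, integral_id]
  simp only [intervalIntegral.integral_const, smul_eq_mul]
  ring

theorem le_levelEnergy {c : ℝ → ℝ} {α k a s : ℝ} (hG : Antitone (levelFun c α k)) (hs : s ≤ k)
    (h : ∀ r ∈ Icc s k, a * (k - r) ≤ levelFun c α k r) :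
    a * (k - s) ^ 2 / 2 ≤ levelEnergy c α k s := by
  rw [← integral_mul_sub, levelEnergy]
  exact intervalIntegral.integral_mono_on hs (Continuous.intervalIntegrable (by fun_prop) _ _)
    hG.intervalIntegrable h

theorem levelEnergy_le {c : ℝ → ℝ} {α k a s : ℝ} (hG : Antitone (levelFun c α k)) (hs : s ≤ k)
    (h : ∀ r ∈ Icc s k, levelFun c α k r ≤ a * (k - r)) :
    levelEnergy c α k s ≤ a * (k - s) ^ 2 / 2 := by
  rw [← integral_mul_sub, levelEnergy]
  exact intervalIntegral.integral_mono_on hs hG.intervalIntegrable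
    (Continuous.intervalIntegrable (by fun_prop) _ _) h

theorem levelEnergy_le_mul_truncMinus {c : ℝ → ℝ} {α k D : ℝ} (hα : 0 < α) (hk : 0 < k)
    (hG : Antitone (levelFun c α k)) (hD : ∀ r, levelFun c α k r ≤ D) (s : ℝ) :
    levelEnergy c α k s ≤ D * truncMinus s k := by
  rcases le_total s k with hs | hs
  · rw [truncMinus_of_le hs]
    have h := intervalIntegral.integral_mono_on (μ := volume) hs hG.intervalIntegrable
      (intervalIntegrable_const (c := D)) fun r _ => hD r
    simp only [intervalIntegral.integral_const, smul_eq_mul] at h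
    rw [levelEnergy]
    linarith
  · rw [truncMinus_of_ge hs, levelEnergy_of_le hα hk hs, mul_zero]

/-- The slices of a supersolution are positive for almost every time. -/
theorem IsPositiveWeakSupersolution.ae_slice_pos {m p : ℝ} {E : Set (Space N)} {T₁ T₂ : ℝ}
    {A : SpaceTime N → ℝ → Space N → Space N} {u : SpaceTime N → ℝ} {V : SpaceTime N → Space N}
    (hu : IsPositiveWeakSupersolution m p E T₁ T₂ A u V) (hE : IsOpen E) :
    ∀ᵐ t : ℝ, t ∈ Ioo T₁ T₂ → ∀ᵐ x, x ∈ E → 0 < u (x, t) := by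
  have h := hu.pos
  rw [ae_restrict_iff' (hE.measurableSet.prod measurableSet_Ioo)] at h
  filter_upwards [ae_ae_slice h] with t ht htT
  filter_upwards [ht] with x hx hxE using hx ⟨hxE, htT⟩

theorem norm_gradTruncMinus_rpow {m p k : ℝ} {u : SpaceTime N → ℝ} {V : SpaceTime N → Space N}
    (hα : 0 < alpha m p) {z : SpaceTime N} (hpos : 0 < u z) (hk : u z < k) :
    ‖gradTruncMinus m p u V k z‖ ^ p =
      alpha m p ^ (-p) * (u z ^ ((1 - alpha m p) * p) * ‖V z‖ ^ p) := by
  rw [gradTruncMinus, indicator_of_mem (show z ∈ {w : SpaceTime N | u w < k} from hk), norm_neg,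
    gradU, norm_smul, Real.norm_of_nonneg (by positivity),
    Real.mul_rpow (by positivity) (norm_nonneg _), Real.mul_rpow (by positivity) (by positivity),
    ← Real.rpow_mul hpos.le, Real.inv_rpow hα.le, ← Real.rpow_neg hα.le, mul_assoc]

theorem gradTruncMinus_of_ge {m p k : ℝ} {u : SpaceTime N → ℝ} {V : SpaceTime N → Space N}
    {z : SpaceTime N} (hk : k ≤ u z) : gradTruncMinus m p u V k z = 0 :=
  indicator_of_notMem (show z ∉ {w : SpaceTime N | u w < k} from not_lt.2 hk) _

theorem alpha_mul_sub_one {m p : ℝ} (hp : 1 < p) : alpha m p * (p - 1) = m + p - 2 := by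
  rw [alpha, div_mul_cancel₀]
  linarith

/-! ### The singular range -/

section ConstantWeight

variable {α k : ℝ}

theorem levelFun_const_of_le (hα : 0 < α) {a s : ℝ} (hs : 0 < s) (h : s ≤ k) :
    levelFun (fun _ => a) α k s = a * (k ^ α - s ^ α) := by
  rw [levelFun_of_pos hs, tailIntegral, min_eq_left (Real.rpow_le_rpow hs.le h hα.le)]
  simp [mul_comm]

theorem levelFun_const_le (hk : 0 < k) (s : ℝ) :
    levelFun (fun _ => k ^ (1 - α)) α k s ≤ k := by
  have h0 : ∀ s : ℝ, 0 ≤ (fun _ : ℝ => k ^ (1 - α)) s := fun _ => by positivity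
  refine (levelFun_le continuous_const h0 s).trans (le_of_eq ?_)
  rw [tailIntegral, min_eq_left (by positivity)]
  simp only [intervalIntegral.integral_const, sub_zero, smul_eq_mul]
  rw [← Real.rpow_add hk]
  simp

/-- Concavity of `r ↦ r^α`. -/
theorem mul_sub_le_levelFun_const (hα : 0 < α) (hα1 : α ≤ 1) {s : ℝ} (hs : 0 < s) (h : s ≤ k) :
    α * (k - s) ≤ levelFun (fun _ => k ^ (1 - α)) α k s := by
  have hk : 0 < k := hs.trans_le h
  rw [levelFun_const_of_le hα hs h]
  have h1 := rpow_one_add_le_one_add_mul_self (s := s / k - 1) (p := α)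
    (by have : 0 < s / k := by positivity
        linarith) hα.le hα1
  rw [add_sub_cancel, Real.div_rpow hs.le hk.le, div_le_iff₀ (by positivity)] at h1
  have h2 := mul_le_mul_of_nonneg_left h1 (by positivity : 0 ≤ k ^ (1 - α))
  have e : k ^ (1 - α) * k ^ α = k := by rw [← Real.rpow_add hk]; simp
  have e2 : k ^ (1 - α) * ((1 + α * (s / k - 1)) * k ^ α) = k + α * (s - k) := by
    rw [mul_left_comm, e]
    field_simp
  rw [e2] at h2
  rw [mul_sub (k ^ (1 - α)), e]
  linarith

end ConstantWeight

/-- The energy estimate in the singular range `m < 1`, at a fixed time. The first term is restricted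
to the points of positivity of the slice, which form a set of full measure for almost every time. -/
theorem IsCutoff.singular_energy_le {m p C₀ C₁ : ℝ} (hC₀ : 0 < C₀) (hC₁ : 0 < C₁) (hm : m < 1)
    (hmp : 3 < m + p) {E : Set (Space N)} (hE : IsOpen E)
    {T₁ T₂ : ℝ} {A : SpaceTime N → ℝ → Space N → Space N} {u : SpaceTime N → ℝ}
    {V : SpaceTime N → Space N} (hA : StructureConditions m p C₀ C₁ E T₁ T₂ A u V)
    (hu : IsPositiveWeakSupersolution m p E T₁ T₂ A u V) {Q : Set (Space N)} {t₁ t₂ : ℝ}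
    {ζ : SpaceTime N → ℝ} (hQo : IsOpen Q) (hQ : IsCompact (closure Q)) (hQE : closure Q ⊆ E)
    (hζ : IsCutoff Q t₁ t₂ ζ) {k : ℝ} (hk : 0 < k) {τ : ℝ} (ht₁ : T₁ < t₁) (ht₂ : t₂ < T₂)
    (htau : τ ∈ Ioc t₁ t₂) :
    ENNReal.ofReal (alpha m p / 2) * (∫⁻ x in Q, ENNReal.ofReal
        ({x | 0 < u (x, τ)}.indicator (fun x => truncMinus (u (x, τ)) k ^ 2 * ζ (x, τ) ^ p) x)) +
      ENNReal.ofReal (C₀ * alpha m p / 2 * k ^ (m - 1)) * cylInt Q t₁ τ (fun z =>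
        ‖gradTruncMinus m p u V k z‖ ^ p * ζ z ^ p) ≤
    ENNReal.ofReal k * sliceEnergy 1 p k Q u ζ t₁ +
      ENNReal.ofReal (k * p) * cylInt Q t₁ t₂ (fun z =>
        truncMinus (u z) k * ζ z ^ (p - 1) * |timeDeriv ζ z|) +
      ENNReal.ofReal (youngConst p (C₀ * alpha m p ^ (1 - p)) (C₁ * alpha m p ^ (1 - p)) *
        k ^ (m + p - 1)) * cylInt Q t₁ t₂ (fun z =>
          {w : SpaceTime N | u w ≤ k}.indicator (fun _ => (1 : ℝ)) z * ‖spaceGrad ζ z‖ ^ p) := by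
  have hp : 1 < p := by linarith
  have hα : 0 < alpha m p := div_pos (by linarith) (by linarith)
  have hα1 : alpha m p ≤ 1 := by
    rw [alpha, div_le_one (by linarith)]
    linarith
  have ht : t₁ ≤ t₂ := (htau.1.trans_le htau.2).le
  set α := alpha m p with hα'
  have eα : α * (p - 1) = m + p - 2 := alpha_mul_sub_one hp
  set C := youngConst p (C₀ * α ^ (1 - p)) (C₁ * α ^ (1 - p)) with hC
  have hC0 : 0 ≤ C := by
    rw [hC, youngConst]
    positivity
  have hk0 : 0 < k ^ (1 - α) := by positivity
  have hG := antitone_levelFun (k := k) hα (continuous_const (y := k ^ (1 - α))) fun _ => hk0.le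
  have hΦk := levelEnergy_le_mul_truncMinus hα hk hG (levelFun_const_le hk)
  have hζ0 : ∀ z ∈ Q ×ˢ Icc t₁ t₂, 0 ≤ ζ z := fun z hz =>
    hζ.nonneg z ⟨subset_closure hz.1, hz.2⟩
  have hcylsub : Q ×ˢ Ioo t₁ τ ⊆ E ×ˢ Ioo T₁ T₂ := prod_mono (subset_closure.trans hQE)
    (Ioo_subset_Ioo ht₁.le (htau.2.trans ht₂.le))
  have hcylmem : ∀ z ∈ Q ×ˢ Ioo t₁ τ, z ∈ Q ×ˢ Icc t₁ t₂ := fun z hz =>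
    ⟨hz.1, hz.2.1.le, hz.2.2.le.trans htau.2⟩
  have hpos := ae_restrict_of_ae_restrict_of_subset hcylsub hu.pos
  have hmem : ∀ᵐ z ∂(volume.restrict (Q ×ˢ Ioo t₁ τ)), z ∈ Q ×ˢ Ioo t₁ τ :=
    ae_restrict_mem (hQo.measurableSet.prod measurableSet_Ioo)
  have htd := ae_restrict_of_ae_restrict_of_subset
    (prod_mono le_rfl (Ioo_subset_Ioo_right htau.2)) (hζ.ae_timeDeriv_rpow ht hQo hp.le)
  refine le_trans (add_le_add ?_ ?_) ((hζ.lintegral_energy_le hC₀ hC₁ hp hα hE hA hu hQo hQ hQE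
    (continuous_const (y := k ^ (1 - α))) (fun _ => hk0) (fun _ => le_rfl) hk ht₁ ht₂ htau).trans
    (add_le_add (add_le_add ?_ ?_) ?_))
  · rw [← lintegral_const_mul' _ _ ENNReal.ofReal_ne_top]
    refine setLIntegral_mono' hQo.measurableSet fun x hx => ?_
    rw [← ENNReal.ofReal_mul (by positivity)]
    refine ENNReal.ofReal_le_ofReal ?_
    have hz0 : 0 ≤ ζ (x, τ) ^ p := Real.rpow_nonneg (hζ0 _ ⟨hx, htau.1.le, htau.2⟩) _
    have hΦ0 : 0 ≤ levelEnergy (fun _ => k ^ (1 - α)) α k (u (x, τ)) :=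
      levelEnergy_nonneg hα hk (fun _ => hk0.le) _
    by_cases hx0 : 0 < u (x, τ)
    · rw [indicator_of_mem (show x ∈ {x | 0 < u (x, τ)} from hx0)]
      rcases le_total (u (x, τ)) k with h | h
      · have h1 := le_levelEnergy hG h fun r hr =>
          mul_sub_le_levelFun_const hα hα1 (hx0.trans_le hr.1) hr.2
        have h2 := mul_le_mul_of_nonneg_left h1 hz0
        rw [truncMinus_of_le h]
        linarith
      · rw [truncMinus_of_ge h]
        simpa using mul_nonneg hz0 hΦ0
    · rw [indicator_of_notMem (show x ∉ {x | 0 < u (x, τ)} from hx0), mul_zero]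
      exact mul_nonneg hz0 hΦ0
  · rw [← cylInt_const_mul (by positivity)]
    refine cylInt_mono_ae ?_
    filter_upwards [hpos, hmem] with z hz hzQ
    have hz0 : 0 ≤ ζ z := hζ0 z (hcylmem z hzQ)
    rcases lt_or_ge (u z) k with h | h
    · rw [norm_gradTruncMinus_rpow hα hz h,
        indicator_of_mem (show z ∈ {w : SpaceTime N | u w < k} from h),
        Real.mul_rpow hz0 (norm_nonneg _)]
      have h1 : u z ^ ((1 - α) * p) ≤ k ^ ((1 - α) * p) :=
        Real.rpow_le_rpow hz.le h.le (mul_nonneg (by linarith) (by linarith))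
      have e1 : k ^ (m - 1) * k ^ ((1 - α) * p) = k ^ (1 - α) := by
        rw [← Real.rpow_add hk]
        congr 1
        linarith
      have e2 : α * α ^ (-p) = α ^ (1 - p) := by
        rw [sub_eq_add_neg, Real.rpow_add hα, Real.rpow_one]
      calc C₀ * α / 2 * k ^ (m - 1) * (α ^ (-p) * (u z ^ ((1 - α) * p) * ‖V z‖ ^ p) * ζ z ^ p)
          ≤ C₀ * α / 2 * k ^ (m - 1) *
            (α ^ (-p) * (k ^ ((1 - α) * p) * ‖V z‖ ^ p) * ζ z ^ p) := by gcongr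
        _ = (k ^ (m - 1) * k ^ ((1 - α) * p)) *
            (C₀ * (α * α ^ (-p)) / 2 * (ζ z ^ p * ‖V z‖ ^ p)) := by ring
        _ = _ := by rw [e1, e2]
    · rw [gradTruncMinus_of_ge h, norm_zero, Real.zero_rpow (by linarith), zero_mul, mul_zero,
        indicator_of_notMem (show z ∉ {w : SpaceTime N | u w < k} from not_lt.2 h)]
  · rw [sliceEnergy, ← lintegral_const_mul' _ _ ENNReal.ofReal_ne_top]
    refine setLIntegral_mono' hQo.measurableSet fun x hx => ?_
    rw [← ENNReal.ofReal_mul hk.le, Real.rpow_one]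
    refine ENNReal.ofReal_le_ofReal ?_
    have := mul_le_mul_of_nonneg_left (hΦk (u (x, t₁)))
      (Real.rpow_nonneg (hζ0 (x, t₁) ⟨hx, le_rfl, ht⟩) p)
    linarith
  · rw [← cylInt_const_mul (by positivity)]
    refine (cylInt_mono_ae ?_).trans (cylInt_mono_right Q t₁ htau.2 _)
    filter_upwards [htd, hmem] with z hz hzQ
    have hz0 : 0 ≤ ζ z ^ (p - 1) := Real.rpow_nonneg (hζ0 z (hcylmem z hzQ)) _
    rw [hz, abs_mul, abs_of_nonneg (mul_nonneg (by linarith) hz0)]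
    have := mul_le_mul_of_nonneg_left (hΦk (u z))
      (by positivity : 0 ≤ p * ζ z ^ (p - 1) * |timeDeriv ζ z|)
    linarith
  · rw [← cylInt_const_mul (by positivity)]
    refine (cylInt_mono_ae ?_).trans (cylInt_mono_right Q t₁ htau.2 _)
    filter_upwards [hpos] with z hz
    rcases le_or_gt (u z) k with h | h
    · rw [indicator_of_mem (show z ∈ {w : SpaceTime N | u w ≤ k} from h), one_mul,
        levelFun_const_of_le hα hz h, mul_div_cancel_left₀ _ hk0.ne']
      have h1 : k ^ α - u z ^ α ≤ k ^ α := by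
        have : 0 ≤ u z ^ α := by positivity
        linarith
      have h0 : 0 ≤ k ^ α - u z ^ α := sub_nonneg.2 (Real.rpow_le_rpow hz.le h hα.le)
      have e1 : k ^ (1 - α) * (k ^ α) ^ p = k ^ (m + p - 1) := by
        rw [← Real.rpow_mul hk.le, ← Real.rpow_add hk]
        congr 1
        linarith
      calc k ^ (1 - α) * (C * ((k ^ α - u z ^ α) * ‖spaceGrad ζ z‖) ^ p)
          ≤ k ^ (1 - α) * (C * (k ^ α * ‖spaceGrad ζ z‖) ^ p) := by gcongr
        _ = C * (k ^ (1 - α) * (k ^ α) ^ p) * ‖spaceGrad ζ z‖ ^ p := by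
          rw [Real.mul_rpow (by positivity) (norm_nonneg _)]
          ring
        _ = _ := by rw [e1]
    · rw [levelFun_of_le hα hk h.le, zero_div, zero_mul, Real.zero_rpow (by linarith), mul_zero,
        mul_zero, indicator_of_notMem (show z ∉ {w : SpaceTime N | u w ≤ k} from not_le.2 h),
        zero_mul, mul_zero]

/-! ### The degenerate range -/

/-- The weight `(1/α) σ^{1/α - 1}`, for which `H(s^α) = k - s`, made bounded near `σ = 0`. -/
noncomputable def powerWeight (α ε σ : ℝ) : ℝ := α⁻¹ * max σ ε ^ (α⁻¹ - 1)

section PowerWeight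

variable {α ε k : ℝ}

theorem continuous_powerWeight (hε : 0 < ε) : Continuous (powerWeight α ε) := by
  unfold powerWeight
  refine continuous_const.mul ((continuous_id.max continuous_const).rpow_const fun s => Or.inl ?_)
  exact (lt_max_of_lt_right hε).ne'

theorem powerWeight_pos (hα : 0 < α) (hε : 0 < ε) (σ : ℝ) : 0 < powerWeight α ε σ := by
  have : 0 < max σ ε := lt_max_of_lt_right hε
  unfold powerWeight
  positivity

theorem powerWeight_le (hα : 1 < α) {a : ℝ} (ha : 0 < a) {σ : ℝ} (h : a ≤ max σ ε) :
    powerWeight α ε σ ≤ α⁻¹ * a ^ (α⁻¹ - 1) := by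
  have h1 : α⁻¹ - 1 ≤ 0 := sub_nonpos.2 (inv_le_one_of_one_le₀ hα.le)
  have := Real.rpow_le_rpow_of_nonpos ha h h1
  unfold powerWeight
  gcongr

theorem integral_rpow_inv_sub_one (hα : 0 < α) (a b : ℝ) :
    ∫ r in a..b, α⁻¹ * r ^ (α⁻¹ - 1) = b ^ α⁻¹ - a ^ α⁻¹ := by
  have hi : 0 < α⁻¹ := by positivity
  rw [intervalIntegral.integral_const_mul, integral_rpow (Or.inl (by linarith)), sub_add_cancel]
  field_simp

theorem levelFun_powerWeight_le (hα : 1 < α) (hε : 0 < ε) (hk : 0 < k) {s : ℝ} (h : s ≤ k) :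
    levelFun (powerWeight α ε) α k s ≤ k - s := by
  have hα0 : 0 < α := by linarith
  have h0 : 0 ≤ max s 0 := le_max_right _ _
  have hle : max s 0 ^ α ≤ k ^ α := Real.rpow_le_rpow h0 (max_le h hk.le) hα0.le
  have h1 : levelFun (powerWeight α ε) α k s ≤ ∫ r in max s 0 ^ α..k ^ α, α⁻¹ * r ^ (α⁻¹ - 1) := by
    rw [levelFun, tailIntegral, min_eq_left hle]
    refine intervalIntegral.integral_mono_on_of_le_Ioo hle
      ((continuous_powerWeight hε).intervalIntegrable _ _)
      ((intervalIntegral.intervalIntegrable_rpow' (by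
        have : 0 < α⁻¹ := by positivity
        linarith)).const_mul _) fun r hr => ?_
    exact powerWeight_le hα ((Real.rpow_nonneg h0 α).trans_lt hr.1) (le_max_left _ _)
  rw [integral_rpow_inv_sub_one hα0, Real.rpow_rpow_inv hk.le hα0.ne',
    Real.rpow_rpow_inv h0 hα0.ne'] at h1
  linarith [le_max_left s 0]

theorem levelFun_powerWeight (hα : 0 < α) {δ : ℝ} (hδ : 0 < δ) {s : ℝ} (hs : δ ≤ s) (h : s ≤ k) :
    levelFun (powerWeight α (δ ^ α)) α k s = k - s := by
  have hs0 : 0 < s := hδ.trans_le hs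
  have hle : s ^ α ≤ k ^ α := Real.rpow_le_rpow hs0.le h hα.le
  rw [levelFun_of_pos hs0, tailIntegral, min_eq_left hle]
  have e : ∫ r in s ^ α..k ^ α, powerWeight α (δ ^ α) r =
      ∫ r in s ^ α..k ^ α, α⁻¹ * r ^ (α⁻¹ - 1) := by
    refine intervalIntegral.integral_congr fun r hr => ?_
    rw [uIcc_of_le hle] at hr
    simp only [powerWeight]
    rw [max_eq_left ((Real.rpow_le_rpow hδ.le hs hα.le).trans hr.1)]
  rw [e, integral_rpow_inv_sub_one hα, Real.rpow_rpow_inv (hs0.le.trans h) hα.ne',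
    Real.rpow_rpow_inv hs0.le hα.ne']

theorem levelEnergy_powerWeight_le (hα : 1 < α) (hε : 0 < ε) (hk : 0 < k) (s : ℝ) :
    levelEnergy (powerWeight α ε) α k s ≤ truncMinus s k ^ 2 / 2 := by
  have hα0 : 0 < α := by linarith
  rcases le_total s k with h | h
  · rw [truncMinus_of_le h]
    have := levelEnergy_le (a := 1) (antitone_levelFun (k := k) hα0 (continuous_powerWeight hε)
      fun σ => (powerWeight_pos hα0 hε σ).le) h fun r hr => by
        rw [one_mul]
        exact levelFun_powerWeight_le hα hε hk hr.2
    rwa [one_mul] at this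
  · rw [levelEnergy_of_le hα0 hk h]
    positivity

theorem le_levelEnergy_powerWeight (hα : 0 < α) (hk : 0 < k) {δ : ℝ} (hδ : 0 < δ) {s : ℝ}
    (hs : δ ≤ s) : truncMinus s k ^ 2 / 2 ≤ levelEnergy (powerWeight α (δ ^ α)) α k s := by
  have hε : 0 < δ ^ α := by positivity
  rcases le_total s k with h | h
  · rw [truncMinus_of_le h]
    have := le_levelEnergy (a := 1) (antitone_levelFun (k := k) hα (continuous_powerWeight hε)
      fun σ => (powerWeight_pos hα hε σ).le) h fun r hr => by
        rw [one_mul]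
        exact (levelFun_powerWeight hα hδ (hs.trans hr.1) hr.2).ge
    rwa [one_mul] at this
  · rw [levelEnergy_of_le hα hk h, truncMinus_of_ge h]
    simp

end PowerWeight

/-- The error term of the bounded weight: `c (G/c)^p = c^{1-p} G^p` with
`c^{1-p} ≤ α^{p-1} (s^{m-1} + δ^{m-1})`. -/
theorem powerWeight_mul_rpow_le {m p δ k s Y : ℝ} (hm : 1 < m) (hp : 1 < p) (hδ : 0 < δ)
    (hk : 0 < k) (hs : 0 < s) (hY : 0 ≤ Y) :
    powerWeight (alpha m p) (δ ^ alpha m p) (s ^ alpha m p) *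
      (levelFun (powerWeight (alpha m p) (δ ^ alpha m p)) (alpha m p) k s /
        powerWeight (alpha m p) (δ ^ alpha m p) (s ^ alpha m p) * Y) ^ p ≤
    alpha m p ^ (p - 1) * ((s ^ (m - 1) + δ ^ (m - 1)) * (truncMinus s k ^ p * Y ^ p)) := by
  have hα : 1 < alpha m p := by
    rw [alpha, lt_div_iff₀ (by linarith)]
    linarith
  have eα := alpha_mul_sub_one (m := m) hp
  set α := alpha m p
  have hα0 : 0 < α := by linarith
  have hε : 0 < δ ^ α := by positivity
  set c := powerWeight α (δ ^ α) (s ^ α) with hc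
  have hc0 : 0 < c := powerWeight_pos hα0 hε _
  set g := levelFun (powerWeight α (δ ^ α)) α k s
  have hg0 : 0 ≤ g := levelFun_nonneg (fun σ => (powerWeight_pos hα0 hε σ).le) _
  have hg : g ≤ truncMinus s k := by
    rcases le_total s k with h | h
    · rw [truncMinus_of_le h]
      exact levelFun_powerWeight_le hα hε hk h
    · rw [truncMinus_of_ge h]
      exact (levelFun_of_le hα0 hk h).le
  have e1 : c * (g / c * Y) ^ p = c ^ (1 - p) * (g ^ p * Y ^ p) := by
    rw [Real.mul_rpow (by positivity) hY, Real.div_rpow hg0 hc0.le, Real.rpow_sub hc0,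
      Real.rpow_one]
    ring
  have e2 : ∀ r : ℝ, 0 < r → ((r ^ α) ^ (α⁻¹ - 1)) ^ (1 - p) = r ^ (m - 1) := fun r hr => by
    rw [← Real.rpow_mul hr.le, ← Real.rpow_mul hr.le]
    congr 1
    have : α * (α⁻¹ - 1) = 1 - α := by field_simp
    rw [this]
    linarith
  have e3 : c ^ (1 - p) = α ^ (p - 1) * max s δ ^ (m - 1) := by
    have hmax : 0 < max s δ := lt_max_of_lt_left hs
    have hmx : max (s ^ α) (δ ^ α) = max s δ ^ α :=
      ((Real.monotoneOn_rpow_Ici_of_exponent_nonneg hα0.le).map_max hs.le hδ.le).symm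
    rw [hc, powerWeight, hmx, Real.mul_rpow (by positivity) (by positivity), e2 _ hmax,
      Real.inv_rpow hα0.le, ← Real.rpow_neg hα0.le, neg_sub]
  have e4 : max s δ ^ (m - 1) ≤ s ^ (m - 1) + δ ^ (m - 1) := by
    have h1 : 0 ≤ s ^ (m - 1) := by positivity
    have h2 : 0 ≤ δ ^ (m - 1) := by positivity
    rcases max_choice s δ with h | h <;> rw [h] <;> linarith
  rw [e1, e3, mul_assoc]
  have := truncMinus_nonneg s k
  gcongr

/-- Monotone convergence of the sets `g ≥ 1 / (n + 1)` to `g > 0`. -/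
theorem tendsto_lintegral_indicator_le {X : Type*} [MeasurableSpace X] {μ : Measure X} {g h : X → ℝ}
    (hg : AEMeasurable g μ) (hh : AEMeasurable h μ) :
    Tendsto (fun n : ℕ => ∫⁻ x, ENNReal.ofReal ({x | 1 / ((n : ℝ) + 1) ≤ g x}.indicator h x) ∂μ)
      atTop (𝓝 (∫⁻ x, ENNReal.ofReal ({x | 0 < g x}.indicator h x) ∂μ)) := by
  refine lintegral_tendsto_of_tendsto_of_monotone (fun n => ?_) (Eventually.of_forall fun x => ?_)
    (Eventually.of_forall fun x => ?_)
  · exact (hh.indicator₀ (nullMeasurableSet_le aemeasurable_const hg)).ennreal_ofReal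
  · intro a b hab
    simp only
    by_cases hx : x ∈ {x | 1 / ((a : ℝ) + 1) ≤ g x}
    · have hx' : x ∈ {x | 1 / ((b : ℝ) + 1) ≤ g x} :=
        le_trans (Nat.one_div_le_one_div hab) (mem_ofPred.1 hx)
      rw [indicator_of_mem hx, indicator_of_mem hx']
    · rw [indicator_of_notMem hx, ENNReal.ofReal_zero]
      exact zero_le
  · refine tendsto_const_nhds.congr' ?_
    by_cases hx : 0 < g x
    · filter_upwards [tendsto_one_div_add_atTop_nhds_zero_nat.eventually (gt_mem_nhds hx)] with n hn
      rw [indicator_of_mem (show x ∈ {x | 0 < g x} from hx),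
        indicator_of_mem (show x ∈ {x | 1 / ((n : ℝ) + 1) ≤ g x} from hn.le)]
    · refine Eventually.of_forall fun n => ?_
      have hx' : x ∉ {x | 1 / ((n : ℝ) + 1) ≤ g x} := fun hc =>
        hx (lt_of_lt_of_le Nat.one_div_pos_of_nat (mem_ofPred.1 hc))
      rw [indicator_of_notMem (show x ∉ {x | 0 < g x} from hx)]
      simp only [indicator_of_notMem hx']

theorem one_half_eq_ofReal : (1 / 2 : ℝ≥0∞) = ENNReal.ofReal (1 / 2) := by
  rw [ENNReal.ofReal_div_of_pos two_pos, ENNReal.ofReal_one, ENNReal.ofReal_ofNat]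

/-- The energy estimate in the degenerate range `m > 1`, at a fixed time. The first term is
restricted to the points of positivity of the slice, which form a set of full measure for almost
every time. -/
theorem IsCutoff.degenerate_energy_le {m p C₀ C₁ : ℝ} (hC₀ : 0 < C₀) (hC₁ : 0 < C₁) (hm : 1 < m)
    (hp : 1 < p) {E : Set (Space N)} (hE : IsOpen E)
    {T₁ T₂ : ℝ} {A : SpaceTime N → ℝ → Space N → Space N} {u : SpaceTime N → ℝ}
    {V : SpaceTime N → Space N} (hA : StructureConditions m p C₀ C₁ E T₁ T₂ A u V)
    (hu : IsPositiveWeakSupersolution m p E T₁ T₂ A u V) {Q : Set (Space N)} {t₁ t₂ : ℝ}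
    {ζ : SpaceTime N → ℝ} (hQo : IsOpen Q) (hQ : IsCompact (closure Q)) (hQE : closure Q ⊆ E)
    (hζ : IsCutoff Q t₁ t₂ ζ) {k : ℝ} (hk : 0 < k) {τ : ℝ} (ht₁ : T₁ < t₁) (ht₂ : t₂ < T₂)
    (htau : τ ∈ Ioc t₁ t₂) :
    1 / 2 * (∫⁻ x in Q, ENNReal.ofReal
        ({x | 0 < u (x, τ)}.indicator (fun x => truncMinus (u (x, τ)) k ^ 2 * ζ (x, τ) ^ p) x)) +
      ENNReal.ofReal (C₀ / 2) * cylInt Q t₁ τ (fun z =>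
        u z ^ (m - 1) * ‖gradTruncMinus m p u V k z‖ ^ p * ζ z ^ p) ≤
    1 / 2 * cylInt Q t₁ t₂ (fun z =>
        truncMinus (u z) k ^ 2 * |timeDeriv (fun w => ζ w ^ p) z|) +
      1 / 2 * sliceEnergy 2 p k Q u ζ t₁ +
      ENNReal.ofReal (youngConst p (C₀ * alpha m p ^ (1 - p)) (C₁ * alpha m p ^ (1 - p)) *
        alpha m p ^ (p - 1)) * cylInt Q t₁ t₂ (fun z =>
          u z ^ (m - 1) * truncMinus (u z) k ^ p * ‖spaceGrad ζ z‖ ^ p) := by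
  have hα1 : 1 < alpha m p := by
    rw [alpha, lt_div_iff₀ (by linarith)]
    linarith
  have hα : 0 < alpha m p := by linarith
  have ht : t₁ ≤ t₂ := (htau.1.trans_le htau.2).le
  have eα : alpha m p * (p - 1) = m + p - 2 := alpha_mul_sub_one hp
  set α := alpha m p with hα'
  set C := youngConst p (C₀ * α ^ (1 - p)) (C₁ * α ^ (1 - p)) * α ^ (p - 1) with hC
  have hY0 : 0 ≤ youngConst p (C₀ * α ^ (1 - p)) (C₁ * α ^ (1 - p)) := by
    unfold youngConst
    positivity
  have hC0 : 0 ≤ C := by positivity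
  have hζ0 : ∀ z ∈ Q ×ˢ Icc t₁ t₂, 0 ≤ ζ z := fun z hz =>
    hζ.nonneg z ⟨subset_closure hz.1, hz.2⟩
  have hcylsub : Q ×ˢ Ioo t₁ τ ⊆ E ×ˢ Ioo T₁ T₂ := prod_mono (subset_closure.trans hQE)
    (Ioo_subset_Ioo ht₁.le (htau.2.trans ht₂.le))
  have hcylmem : ∀ z ∈ Q ×ˢ Ioo t₁ τ, z ∈ Q ×ˢ Icc t₁ t₂ := fun z hz =>
    ⟨hz.1, hz.2.1.le, hz.2.2.le.trans htau.2⟩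
  have hpos := ae_restrict_of_ae_restrict_of_subset hcylsub hu.pos
  have hQm : MeasurableSet (Q ×ˢ Ioo t₁ τ) := hQo.measurableSet.prod measurableSet_Ioo
  have hmem : ∀ᵐ z ∂(volume.restrict (Q ×ˢ Ioo t₁ τ)), z ∈ Q ×ˢ Ioo t₁ τ := ae_restrict_mem hQm
  obtain ⟨L, hL⟩ := hζ.exists_norm_spaceGrad_le ht hQo
  have hζc : ContinuousOn ζ (closure Q ×ˢ Icc t₁ t₂) := by
    obtain ⟨L, hL⟩ := hζ.lipschitz
    exact hL.continuousOn
  -- the two terms on the left, restricted to `u ≥ δ`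
  set f : Space N → ℝ := fun x => truncMinus (u (x, τ)) k ^ 2 * ζ (x, τ) ^ p with hf
  set F : SpaceTime N → ℝ := fun z =>
    u z ^ (m - 1) * ‖gradTruncMinus m p u V k z‖ ^ p * ζ z ^ p with hF
  set δ : ℕ → ℝ := fun n => 1 / ((n : ℝ) + 1) with hδ
  have hδ0 : ∀ n, 0 < δ n := fun n => Nat.one_div_pos_of_nat
  have hδa : Antitone δ := fun a b hab => Nat.one_div_le_one_div hab
  have hδlim : Tendsto δ atTop (𝓝 0) := tendsto_one_div_add_atTop_nhds_zero_nat
  set err : ℕ → ℝ≥0∞ := fun n =>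
    ENNReal.ofReal (C * (δ n ^ (m - 1) * (k ^ p * L ^ p))) * volume (Q ×ˢ Ioo t₁ τ) with herr
  -- where `u ≥ δ n` the weight bounded at the level `(δ n)^α` is the exact one
  have hstep : ∀ n,
      1 / 2 * (∫⁻ x in Q, ENNReal.ofReal ({x | δ n ≤ u (x, τ)}.indicator f x)) +
        ENNReal.ofReal (C₀ / 2) * cylInt Q t₁ τ ({z | δ n ≤ u z}.indicator F) ≤
      1 / 2 * cylInt Q t₁ t₂ (fun z =>
          truncMinus (u z) k ^ 2 * |timeDeriv (fun w => ζ w ^ p) z|) +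
        1 / 2 * sliceEnergy 2 p k Q u ζ t₁ +
        ENNReal.ofReal C * cylInt Q t₁ t₂ (fun z =>
            u z ^ (m - 1) * truncMinus (u z) k ^ p * ‖spaceGrad ζ z‖ ^ p) + err n := by
    intro n
    have hε : 0 < δ n ^ α := Real.rpow_pos_of_pos (hδ0 n) α
    have hc0 := powerWeight_pos hα hε
    have hΦ0 : ∀ s, 0 ≤ levelEnergy (powerWeight α (δ n ^ α)) α k s :=
      levelEnergy_nonneg hα hk fun σ => (hc0 σ).le
    have hΦ := levelEnergy_powerWeight_le hα1 hε hk
    refine le_trans (add_le_add ?_ ?_) ((hζ.lintegral_energy_le hC₀ hC₁ hp hα hE hA hu hQo hQ hQE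
      (continuous_powerWeight hε) hc0 (fun σ => powerWeight_le hα1 hε (le_max_right _ _)) hk ht₁
      ht₂ htau).trans ?_)
    · rw [one_half_eq_ofReal, ← lintegral_const_mul' _ _ ENNReal.ofReal_ne_top]
      refine setLIntegral_mono' hQo.measurableSet fun x hx => ?_
      rw [← ENNReal.ofReal_mul (by norm_num)]
      refine ENNReal.ofReal_le_ofReal ?_
      have hz0 : 0 ≤ ζ (x, τ) ^ p := Real.rpow_nonneg (hζ0 _ ⟨hx, htau.1.le, htau.2⟩) _
      by_cases hx0 : x ∈ {x | δ n ≤ u (x, τ)}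
      · rw [indicator_of_mem hx0]
        have := mul_le_mul_of_nonneg_left (le_levelEnergy_powerWeight hα hk (hδ0 n) hx0) hz0
        simp only [hf]
        linarith
      · rw [indicator_of_notMem hx0, mul_zero]
        exact mul_nonneg hz0 (hΦ0 _)
    · rw [← cylInt_const_mul (by positivity)]
      refine cylInt_mono_ae ?_
      filter_upwards [hpos, hmem] with z hz hzQ
      have hz0 : 0 ≤ ζ z := hζ0 z (hcylmem z hzQ)
      have hr0 : 0 ≤ {w : SpaceTime N | u w < k}.indicator (fun w =>
          powerWeight α (δ n ^ α) (u w ^ α) *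
            (C₀ * α ^ (1 - p) / 2 * (ζ w * ‖V w‖) ^ p)) z := by
        refine indicator_apply_nonneg fun _ => mul_nonneg (hc0 _).le (mul_nonneg (by positivity) ?_)
        exact Real.rpow_nonneg (mul_nonneg hz0 (norm_nonneg _)) _
      by_cases hzδ : z ∈ {z | δ n ≤ u z}
      swap
      · rwa [indicator_of_notMem hzδ, mul_zero]
      rw [indicator_of_mem hzδ]
      rcases lt_or_ge (u z) k with h | h
      · rw [indicator_of_mem (show z ∈ {w : SpaceTime N | u w < k} from h)]
        simp only [hF]
        have hmax : max (u z ^ α) (δ n ^ α) = u z ^ α :=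
          max_eq_left (Real.rpow_le_rpow (hδ0 n).le hzδ hα.le)
        rw [norm_gradTruncMinus_rpow hα hz h, powerWeight, hmax, Real.mul_rpow hz0 (norm_nonneg _),
          ← Real.rpow_mul hz.le]
        have e1 : u z ^ (m - 1) * u z ^ ((1 - α) * p) = u z ^ (α * (α⁻¹ - 1)) := by
          rw [← Real.rpow_add hz]
          congr 1
          have : α * (α⁻¹ - 1) = 1 - α := by field_simp
          rw [this]
          linarith
        have e2 : α⁻¹ * α ^ (1 - p) = α ^ (-p) := by
          rw [← Real.rpow_neg_one, ← Real.rpow_add hα]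
          congr 1
          ring
        refine le_of_eq ?_
        rw [← e1, ← e2]
        ring
      · simp only [hF]
        rw [gradTruncMinus_of_ge h, norm_zero, Real.zero_rpow (by linarith), mul_zero, zero_mul,
          mul_zero]
        exact hr0
    · rw [add_assoc (_ + _), add_comm (1 / 2 * cylInt _ _ _ _)]
      refine add_le_add (add_le_add ?_ ?_) ?_
      · rw [sliceEnergy, one_half_eq_ofReal, ← lintegral_const_mul' _ _ ENNReal.ofReal_ne_top]
        refine setLIntegral_mono' hQo.measurableSet fun x hx => ?_
        rw [← ENNReal.ofReal_mul (by norm_num), Real.rpow_two]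
        refine ENNReal.ofReal_le_ofReal ?_
        have := mul_le_mul_of_nonneg_left (hΦ (u (x, t₁)))
          (Real.rpow_nonneg (hζ0 (x, t₁) ⟨hx, le_rfl, ht⟩) p)
        linarith
      · rw [one_half_eq_ofReal, ← cylInt_const_mul (by norm_num)]
        refine (cylInt_mono_ae (Eventually.of_forall fun z => ?_)).trans
          (cylInt_mono_right Q t₁ htau.2 _)
        have := mul_le_mul_of_nonneg_left (hΦ (u z))
          (abs_nonneg (timeDeriv (fun w => ζ w ^ p) z))
        linarith
      · rw [← cylInt_const_mul hC0]
        refine le_trans ?_ (add_le_add_left (cylInt_mono_right Q t₁ htau.2 _) _)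
        simp only [herr, cylInt]
        rw [← setLIntegral_const, ← lintegral_add_right _ measurable_const]
        refine lintegral_mono_ae ?_
        filter_upwards [hpos, hmem] with z hz hzQ
        have htr : truncMinus (u z) k ≤ k := max_le (by linarith) hk.le
        have hLz := hL z ⟨hzQ.1, hzQ.2.1, hzQ.2.2.trans_le htau.2⟩
        have htr0 := truncMinus_nonneg (u z) k
        have hδm : 0 ≤ δ n ^ (m - 1) := Real.rpow_nonneg (hδ0 n).le _
        rw [← ENNReal.ofReal_add (by positivity) (by positivity)]
        refine ENNReal.ofReal_le_ofReal ?_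
        have h1 := mul_le_mul_of_nonneg_left (powerWeight_mul_rpow_le hm hp (hδ0 n) hk hz
          (norm_nonneg (spaceGrad ζ z))) hY0
        have h2 : C * (δ n ^ (m - 1) * (truncMinus (u z) k ^ p * ‖spaceGrad ζ z‖ ^ p)) ≤
            C * (δ n ^ (m - 1) * (k ^ p * L ^ p)) := by gcongr
        refine le_trans (le_trans (le_of_eq ?_) h1) (le_trans (le_of_eq ?_)
          (add_le_add_right h2 _))
        · ring
        · rw [hC]
          ring
  -- measurability of the two integrands, needed for the limit `n → ∞`
  have huτ : AEMeasurable (fun x => u (x, τ)) (volume.restrict Q) :=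
    (((hu.continuous_L2 _ hQ hQE).1 τ ⟨ht₁.trans htau.1, htau.2.trans_lt ht₂⟩).1.mono_measure
      (Measure.restrict_mono subset_closure le_rfl)).aemeasurable
  have htrunc : Continuous fun s : ℝ => truncMinus s k := by
    unfold truncMinus
    fun_prop
  have hfm : AEMeasurable f (volume.restrict Q) := by
    refine ((htrunc.measurable.comp_aemeasurable huτ).pow_const 2).mul (AEMeasurable.pow_const ?_ p)
    refine (hζc.comp (f := fun x : Space N => (x, τ)) (s := Q) (by fun_prop)
      fun x hx => ⟨subset_closure hx, htau.1.le, htau.2⟩).aemeasurable hQo.measurableSet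
  have hum : AEMeasurable u (volume.restrict (Q ×ˢ Ioo t₁ τ)) :=
    (hu.measurable.mono_set hcylsub).aemeasurable
  have hsubK : Q ×ˢ Ioo t₁ τ ⊆ closure Q ×ˢ Icc t₁ t₂ := fun z hz =>
    ⟨subset_closure (hcylmem z hz).1, (hcylmem z hz).2⟩
  have hVm : AEMeasurable V (volume.restrict (Q ×ˢ Ioo t₁ τ)) :=
    ((hu.power_mem.memLp_grad _ hQ hQE t₁ t₂ ht₁ ht₂).1.mono_set hsubK).aemeasurable
  have hFm : AEMeasurable F (volume.restrict (Q ×ˢ Ioo t₁ τ)) := by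
    have hgr : AEMeasurable (gradTruncMinus m p u V k) (volume.restrict (Q ×ˢ Ioo t₁ τ)) :=
      AEMeasurable.indicator₀ ((((hum.pow_const _).const_mul _).smul hVm).neg)
        (nullMeasurableSet_lt hum aemeasurable_const)
    refine ((hum.pow_const _).mul (hgr.norm.pow_const p)).mul (AEMeasurable.pow_const ?_ p)
    exact (hζc.mono hsubK).aemeasurable hQm
  have hlim1 := tendsto_lintegral_indicator_le huτ hfm
  have hlim2 := tendsto_lintegral_indicator_le hum hFm
  have hFeq : ∫⁻ z in Q ×ˢ Ioo t₁ τ, ENNReal.ofReal ({z | 0 < u z}.indicator F z) =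
      cylInt Q t₁ τ F := by
    refine lintegral_congr_ae ?_
    filter_upwards [hpos] with z hz
    rw [indicator_of_mem (show z ∈ {z | 0 < u z} from hz)]
  rw [hFeq] at hlim2
  have hvol : volume (Q ×ˢ Ioo t₁ τ) ≠ ⊤ := ne_top_of_le_ne_top
    (hQ.prod (isCompact_Icc (a := t₁) (b := τ))).measure_lt_top.ne
    (measure_mono (prod_mono subset_closure Ioo_subset_Icc_self))
  have herr0 : Tendsto err atTop (𝓝 0) := by
    have h1 : Tendsto (fun n => C * (δ n ^ (m - 1) * (k ^ p * L ^ p))) atTop (𝓝 0) := by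
      have h2 := (hδlim.rpow_const (p := m - 1) (Or.inr (by linarith)))
      rw [Real.zero_rpow (by linarith)] at h2
      simpa using (h2.mul_const (k ^ p * (L : ℝ) ^ p)).const_mul C
    have h3 := ENNReal.Tendsto.mul_const (ENNReal.tendsto_ofReal h1) (Or.inr hvol)
    rwa [ENNReal.ofReal_zero, zero_mul] at h3
  refine le_of_tendsto_of_tendsto' ((ENNReal.Tendsto.const_mul hlim1 (Or.inr (by simp))).add
    (ENNReal.Tendsto.const_mul hlim2 (Or.inr ENNReal.ofReal_ne_top))) ?_ hstep
  simpa using tendsto_const_nhds.add herr0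

/-! ### The energy estimates -/

/-- For almost every time, the energy over the points of positivity is the energy of the full slice. -/
theorem ae_setLIntegral_indicator_pos {m p : ℝ} {E : Set (Space N)} {T₁ T₂ : ℝ}
    {A : SpaceTime N → ℝ → Space N → Space N} {u : SpaceTime N → ℝ} {V : SpaceTime N → Space N}
    (hu : IsPositiveWeakSupersolution m p E T₁ T₂ A u V) (hE : IsOpen E) {Q : Set (Space N)}
    (hQ : IsOpen Q) (hQE : Q ⊆ E) {t₁ t₂ : ℝ} (ht₁ : T₁ < t₁) (ht₂ : t₂ < T₂)
    (k : ℝ) (ζ : SpaceTime N → ℝ) :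
    ∀ᵐ τ ∂(volume.restrict (Icc t₁ t₂)), τ ∈ Ioc t₁ t₂ ∧
      ∫⁻ x in Q, ENNReal.ofReal ({x | 0 < u (x, τ)}.indicator
        (fun x => truncMinus (u (x, τ)) k ^ 2 * ζ (x, τ) ^ p) x) = sliceEnergy 2 p k Q u ζ τ := by
  have hne : ∀ᵐ τ : ℝ, τ ≠ t₁ := by simp [ae_iff]
  filter_upwards [ae_restrict_mem measurableSet_Icc, ae_restrict_of_ae hne,
    ae_restrict_of_ae (hu.ae_slice_pos hE)] with τ hτ hτ1 hpos
  refine ⟨⟨lt_of_le_of_ne hτ.1 hτ1.symm, hτ.2⟩, ?_⟩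
  have h := hpos ⟨ht₁.trans_le hτ.1, hτ.2.trans_lt ht₂⟩
  refine lintegral_congr_ae ((ae_restrict_iff' hQ.measurableSet).2 ?_)
  filter_upwards [h] with x hx hxQ
  rw [indicator_of_mem (show x ∈ {x | 0 < u (x, τ)} from hx (hQE hxQ)), Real.rpow_two]

theorem le_ofReal_mul_of_ofReal_mul_le {a b : ℝ} (ha : 0 < a) (hab : a * b = 1) {x y : ℝ≥0∞}
    (h : ENNReal.ofReal a * x ≤ y) : x ≤ ENNReal.ofReal b * y := by
  calc x = ENNReal.ofReal b * (ENNReal.ofReal a * x) := by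
        rw [← mul_assoc, ← ENNReal.ofReal_mul' ha.le, mul_comm b a, hab, ENNReal.ofReal_one,
          one_mul]
    _ ≤ _ := by gcongr

/-- The bounds at a fixed time are used at almost every `τ` for the supremum, and at `τ = t₂` for the
gradient term on the whole cylinder. -/
theorem degenerate_energy_estimate {m p C₀ C₁ : ℝ} (hC₀ : 0 < C₀) (hC₁ : 0 < C₁) (hm : 1 < m)
    (hp : 1 < p) {γ : ℝ}
    (hγ : γ = (1 + 2 / C₀) * (1 + youngConst p (C₀ * alpha m p ^ (1 - p))
      (C₁ * alpha m p ^ (1 - p)) * alpha m p ^ (p - 1)))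
    {E : Set (Space N)} (hE : IsOpen E)
    {T₁ T₂ : ℝ} {A : SpaceTime N → ℝ → Space N → Space N} {u : SpaceTime N → ℝ}
    {V : SpaceTime N → Space N} (hA : StructureConditions m p C₀ C₁ E T₁ T₂ A u V)
    (hu : IsPositiveWeakSupersolution m p E T₁ T₂ A u V) {Q : Set (Space N)} {t₁ t₂ : ℝ}
    {ζ : SpaceTime N → ℝ} (hQo : IsOpen Q) (hQ : IsCompact (closure Q)) (hQE : closure Q ⊆ E)
    (hζ : IsCutoff Q t₁ t₂ ζ) {k : ℝ} (hk : 0 < k) (ht₁ : T₁ < t₁) (ht : t₁ < t₂) (ht₂ : t₂ < T₂) :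
    (essSup (fun τ : ℝ => (1 / 2) * sliceEnergy 2 p k Q u ζ τ +
        ENNReal.ofReal (C₀ / 2) * cylInt Q t₁ τ (fun z =>
          u z ^ (m - 1) * ‖gradTruncMinus m p u V k z‖ ^ p * ζ z ^ p))
        (volume.restrict (Icc t₁ t₂)) ≤
      (1 / 2) * cylInt Q t₁ t₂ (fun z =>
          truncMinus (u z) k ^ 2 * |timeDeriv (fun w => ζ w ^ p) z|) +
        (1 / 2) * sliceEnergy 2 p k Q u ζ t₁ +
        ENNReal.ofReal γ * cylInt Q t₁ t₂ (fun z =>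
          u z ^ (m - 1) * truncMinus (u z) k ^ p * ‖spaceGrad ζ z‖ ^ p)) ∧
    ((1 / 2) * essSup (fun τ : ℝ => sliceEnergy 2 p k Q u ζ τ) (volume.restrict (Icc t₁ t₂)) +
        cylInt Q t₁ t₂ (fun z =>
          u z ^ (m - 1) * ‖gradTruncMinus m p u V k z‖ ^ p * ζ z ^ p) ≤
      ENNReal.ofReal γ *
        ((1 / 2) * cylInt Q t₁ t₂ (fun z =>
            truncMinus (u z) k ^ 2 * |timeDeriv (fun w => ζ w ^ p) z|) +
          (1 / 2) * sliceEnergy 2 p k Q u ζ t₁ +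
          cylInt Q t₁ t₂ (fun z =>
            u z ^ (m - 1) * truncMinus (u z) k ^ p * ‖spaceGrad ζ z‖ ^ p))) := by
  have hα : 0 < alpha m p := div_pos (by linarith) (by linarith)
  set γ₀ := youngConst p (C₀ * alpha m p ^ (1 - p)) (C₁ * alpha m p ^ (1 - p)) *
    alpha m p ^ (p - 1) with hγ₀
  have hγ₀0 : 0 ≤ γ₀ := by
    rw [hγ₀, youngConst]
    positivity
  have hC₀' : 0 < 2 / C₀ := by positivity
  have hγle : γ₀ ≤ γ := by nlinarith
  have hmain := fun τ (hτ : τ ∈ Ioc t₁ t₂) =>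
    hζ.degenerate_energy_le hC₀ hC₁ hm hp hE hA hu hQo hQ hQE hk (τ := τ) ht₁ ht₂ hτ
  rw [← hγ₀] at hmain
  have hslice := ae_setLIntegral_indicator_pos hu hE hQo (subset_closure.trans hQE) ht₁ ht₂ k ζ
  set a := (1 / 2 : ℝ≥0∞) * cylInt Q t₁ t₂ (fun z =>
    truncMinus (u z) k ^ 2 * |timeDeriv (fun w => ζ w ^ p) z|)
  set b := (1 / 2 : ℝ≥0∞) * sliceEnergy 2 p k Q u ζ t₁
  set c := cylInt Q t₁ t₂ (fun z => u z ^ (m - 1) * truncMinus (u z) k ^ p * ‖spaceGrad ζ z‖ ^ p)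
  have hX : a + b + ENNReal.ofReal γ₀ * c ≤ ENNReal.ofReal (1 + γ₀) * (a + b + c) := by
    rw [mul_add]
    gcongr
    · refine le_mul_of_one_le_left zero_le ?_
      rw [ENNReal.one_le_ofReal]
      linarith
    · linarith
  refine ⟨essSup_le_of_ae_le _ (hslice.mono fun τ hτ => ?_), ?_⟩
  · have h := hmain τ hτ.1
    rw [hτ.2] at h
    exact h.trans (add_le_add le_rfl (mul_le_mul' (ENNReal.ofReal_le_ofReal hγle) le_rfl))
  · rw [← ENNReal.essSup_const_mul]
    have h1 : essSup (fun τ => 1 / 2 * sliceEnergy 2 p k Q u ζ τ) (volume.restrict (Icc t₁ t₂)) ≤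
        a + b + ENNReal.ofReal γ₀ * c := by
      refine essSup_le_of_ae_le _ (hslice.mono fun τ hτ => ?_)
      have h := hmain τ hτ.1
      rw [hτ.2] at h
      exact le_self_add.trans h
    have h2 := le_ofReal_mul_of_ofReal_mul_le (b := 2 / C₀) (by positivity : 0 < C₀ / 2)
      (by field_simp) (le_add_self.trans (hmain t₂ ⟨ht, le_rfl⟩))
    refine (add_le_add h1 h2).trans ?_
    rw [hγ, ENNReal.ofReal_mul (p := 1 + 2 / C₀) (by positivity), mul_assoc (ENNReal.ofReal (1 + _)),
      ENNReal.ofReal_add zero_le_one hC₀'.le,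
      ENNReal.ofReal_one, add_mul, one_mul]
    gcongr

/-- The bounds at a fixed time are used at almost every `τ` for the supremum, and at `τ = t₂` for the
gradient term on the whole cylinder. -/
theorem singular_energy_estimate {m p C₀ C₁ : ℝ} (hC₀ : 0 < C₀) (hC₁ : 0 < C₁) (hm : m < 1)
    (hmp : 3 < m + p) {γ : ℝ}
    (hγ : γ = (2 / alpha m p + 2 / (C₀ * alpha m p)) *
      (1 + p + youngConst p (C₀ * alpha m p ^ (1 - p)) (C₁ * alpha m p ^ (1 - p))))
    {E : Set (Space N)} (hE : IsOpen E)
    {T₁ T₂ : ℝ} {A : SpaceTime N → ℝ → Space N → Space N} {u : SpaceTime N → ℝ}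
    {V : SpaceTime N → Space N} (hA : StructureConditions m p C₀ C₁ E T₁ T₂ A u V)
    (hu : IsPositiveWeakSupersolution m p E T₁ T₂ A u V) {Q : Set (Space N)} {t₁ t₂ : ℝ}
    {ζ : SpaceTime N → ℝ} (hQo : IsOpen Q) (hQ : IsCompact (closure Q)) (hQE : closure Q ⊆ E)
    (hζ : IsCutoff Q t₁ t₂ ζ) {k : ℝ} (hk : 0 < k) (ht₁ : T₁ < t₁) (ht : t₁ < t₂) (ht₂ : t₂ < T₂) :
    essSup (fun τ : ℝ => sliceEnergy 2 p k Q u ζ τ) (volume.restrict (Icc t₁ t₂)) +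
        ENNReal.ofReal (k ^ (m - 1)) * cylInt Q t₁ t₂ (fun z =>
          ‖gradTruncMinus m p u V k z‖ ^ p * ζ z ^ p) ≤
      ENNReal.ofReal (γ * k) * sliceEnergy 1 p k Q u ζ t₁ +
        ENNReal.ofReal (γ * k) * cylInt Q t₁ t₂ (fun z =>
          truncMinus (u z) k * ζ z ^ (p - 1) * |timeDeriv ζ z|) +
        ENNReal.ofReal (γ * k ^ (m + p - 1)) * cylInt Q t₁ t₂ (fun z =>
          {w : SpaceTime N | u w ≤ k}.indicator (fun _ => (1 : ℝ)) z * ‖spaceGrad ζ z‖ ^ p) := by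
  have hp : 1 < p := by linarith
  have hα : 0 < alpha m p := div_pos (by linarith) (by linarith)
  set C := youngConst p (C₀ * alpha m p ^ (1 - p)) (C₁ * alpha m p ^ (1 - p)) with hC
  have hC0 : 0 ≤ C := by
    rw [hC, youngConst]
    positivity
  have hmain := fun τ (hτ : τ ∈ Ioc t₁ t₂) =>
    hζ.singular_energy_le hC₀ hC₁ hm hmp hE hA hu hQo hQ hQE hk (τ := τ) ht₁ ht₂ hτ
  rw [← hC] at hmain
  have hslice := ae_setLIntegral_indicator_pos hu hE hQo (subset_closure.trans hQE) ht₁ ht₂ k ζ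
  set a := sliceEnergy 1 p k Q u ζ t₁
  set b := cylInt Q t₁ t₂ (fun z => truncMinus (u z) k * ζ z ^ (p - 1) * |timeDeriv ζ z|)
  set c := cylInt Q t₁ t₂ (fun z =>
    {w : SpaceTime N | u w ≤ k}.indicator (fun _ => (1 : ℝ)) z * ‖spaceGrad ζ z‖ ^ p)
  have h1 : essSup (fun τ => sliceEnergy 2 p k Q u ζ τ) (volume.restrict (Icc t₁ t₂)) ≤
      ENNReal.ofReal (2 / alpha m p) * (ENNReal.ofReal k * a + ENNReal.ofReal (k * p) * b +
        ENNReal.ofReal (C * k ^ (m + p - 1)) * c) := by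
    refine essSup_le_of_ae_le _ (hslice.mono fun τ hτ => ?_)
    have h := hmain τ hτ.1
    rw [hτ.2] at h
    exact le_ofReal_mul_of_ofReal_mul_le (by positivity : 0 < alpha m p / 2) (by field_simp)
      (le_self_add.trans h)
  have h2 : ENNReal.ofReal (k ^ (m - 1)) * cylInt Q t₁ t₂ (fun z =>
        ‖gradTruncMinus m p u V k z‖ ^ p * ζ z ^ p) ≤
      ENNReal.ofReal (2 / (C₀ * alpha m p)) * (ENNReal.ofReal k * a + ENNReal.ofReal (k * p) * b +
        ENNReal.ofReal (C * k ^ (m + p - 1)) * c) := by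
    refine le_ofReal_mul_of_ofReal_mul_le (by positivity : 0 < C₀ * alpha m p / 2)
      (by field_simp) ?_
    rw [← mul_assoc, ← ENNReal.ofReal_mul (by positivity)]
    exact le_add_self.trans (hmain t₂ ⟨ht, le_rfl⟩)
  set β := 2 / alpha m p + 2 / (C₀ * alpha m p) with hβ
  have hβ0 : 0 ≤ β := by positivity
  refine (add_le_add h1 h2).trans ?_
  rw [← add_mul, ← ENNReal.ofReal_add (by positivity) (by positivity), ← hβ, mul_add, mul_add,
    ← mul_assoc, ← mul_assoc, ← mul_assoc, ← ENNReal.ofReal_mul hβ0, ← ENNReal.ofReal_mul hβ0,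
    ← ENNReal.ofReal_mul hβ0, hγ]
  have hkp : 0 < k ^ (m + p - 1) := by positivity
  gcongr ENNReal.ofReal ?_ * _ + ENNReal.ofReal ?_ * _ + ENNReal.ofReal ?_ * _
  · nlinarith [mul_nonneg (mul_nonneg hβ0 hk.le) hC0, mul_nonneg hβ0 hk.le]
  · nlinarith [mul_nonneg (mul_nonneg hβ0 hk.le) hC0, mul_nonneg hβ0 hk.le]
  · nlinarith [mul_nonneg hβ0 hkp.le]

end DoublyDegenerate

theorem mainTheorem7 (m p C₀ C₁ : ℝ) (hC₀ : 0 < C₀) (hC₁ : 0 < C₁) :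
    -- the case `m > 1`, `p > 2`
    (1 < m → 2 < p → ∃ γ : ℝ, 0 < γ ∧
      ∀ (N : ℕ) (_ : 1 ≤ N) (E : Set (DoublyDegenerate.Space N)) (T₁ T₂ : ℝ)
        (A : DoublyDegenerate.SpaceTime N → ℝ → DoublyDegenerate.Space N →
          DoublyDegenerate.Space N)
        (u : DoublyDegenerate.SpaceTime N → ℝ)
        (V : DoublyDegenerate.SpaceTime N → DoublyDegenerate.Space N),
        IsOpen E →
        DoublyDegenerate.StructureConditions m p C₀ C₁ E T₁ T₂ A u V →
        DoublyDegenerate.IsPositiveWeakSupersolution m p E T₁ T₂ A u V →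
        ∀ (Q : Set (DoublyDegenerate.Space N)) (T : ℝ),
          IsOpen Q → IsCompact (closure Q) → closure Q ⊆ E → T₁ < 0 → 0 < T → T < T₂ →
        ∀ (t₁ t₂ k : ℝ) (ζ : DoublyDegenerate.SpaceTime N → ℝ),
          0 ≤ t₁ → t₁ < t₂ → t₂ ≤ T → 0 < k → DoublyDegenerate.IsCutoff Q t₁ t₂ ζ →
          -- sharp form, with both terms on the left taken up to the same time
          (essSup (fun τ : ℝ =>
              (1 / 2) * DoublyDegenerate.sliceEnergy 2 p k Q u ζ τ +
              ENNReal.ofReal (C₀ / 2) * DoublyDegenerate.cylInt Q t₁ τ (fun z =>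
                u z ^ (m - 1) * ‖DoublyDegenerate.gradTruncMinus m p u V k z‖ ^ p * ζ z ^ p))
              (volume.restrict (Icc t₁ t₂)) ≤
            (1 / 2) * DoublyDegenerate.cylInt Q t₁ t₂ (fun z =>
                DoublyDegenerate.truncMinus (u z) k ^ 2 *
                  |DoublyDegenerate.timeDeriv (fun w => ζ w ^ p) z|) +
              (1 / 2) * DoublyDegenerate.sliceEnergy 2 p k Q u ζ t₁ +
              ENNReal.ofReal γ * DoublyDegenerate.cylInt Q t₁ t₂ (fun z =>
                u z ^ (m - 1) * DoublyDegenerate.truncMinus (u z) k ^ p *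
                  ‖DoublyDegenerate.spaceGrad ζ z‖ ^ p)) ∧
          -- additive form
          ((1 / 2) * essSup (fun τ : ℝ => DoublyDegenerate.sliceEnergy 2 p k Q u ζ τ)
                (volume.restrict (Icc t₁ t₂)) +
              DoublyDegenerate.cylInt Q t₁ t₂ (fun z =>
                u z ^ (m - 1) * ‖DoublyDegenerate.gradTruncMinus m p u V k z‖ ^ p * ζ z ^ p) ≤
            ENNReal.ofReal γ *
              ((1 / 2) * DoublyDegenerate.cylInt Q t₁ t₂ (fun z =>
                  DoublyDegenerate.truncMinus (u z) k ^ 2 *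
                    |DoublyDegenerate.timeDeriv (fun w => ζ w ^ p) z|) +
                (1 / 2) * DoublyDegenerate.sliceEnergy 2 p k Q u ζ t₁ +
                DoublyDegenerate.cylInt Q t₁ t₂ (fun z =>
                  u z ^ (m - 1) * DoublyDegenerate.truncMinus (u z) k ^ p *
                    ‖DoublyDegenerate.spaceGrad ζ z‖ ^ p)))) ∧
    -- the case `0 < m < 1`, `m + p > 3`
    (0 < m → m < 1 → 3 < m + p → ∃ γ : ℝ, 0 < γ ∧
      ∀ (N : ℕ) (_ : 1 ≤ N) (E : Set (DoublyDegenerate.Space N)) (T₁ T₂ : ℝ)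
        (A : DoublyDegenerate.SpaceTime N → ℝ → DoublyDegenerate.Space N →
          DoublyDegenerate.Space N)
        (u : DoublyDegenerate.SpaceTime N → ℝ)
        (V : DoublyDegenerate.SpaceTime N → DoublyDegenerate.Space N),
        IsOpen E →
        DoublyDegenerate.StructureConditions m p C₀ C₁ E T₁ T₂ A u V →
        DoublyDegenerate.IsPositiveWeakSupersolution m p E T₁ T₂ A u V →
        ∀ (Q : Set (DoublyDegenerate.Space N)) (T : ℝ),
          IsOpen Q → IsCompact (closure Q) → closure Q ⊆ E → T₁ < 0 → 0 < T → T < T₂ →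
        ∀ (t₁ t₂ k : ℝ) (ζ : DoublyDegenerate.SpaceTime N → ℝ),
          0 ≤ t₁ → t₁ < t₂ → t₂ ≤ T → 0 < k → DoublyDegenerate.IsCutoff Q t₁ t₂ ζ →
          -- arbitrary nonnegative cutoff functions
          (essSup (fun τ : ℝ => DoublyDegenerate.sliceEnergy 2 p k Q u ζ τ)
                (volume.restrict (Icc t₁ t₂)) +
              ENNReal.ofReal (k ^ (m - 1)) * DoublyDegenerate.cylInt Q t₁ t₂ (fun z =>
                ‖DoublyDegenerate.gradTruncMinus m p u V k z‖ ^ p * ζ z ^ p) ≤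
            ENNReal.ofReal (γ * k) * DoublyDegenerate.sliceEnergy 1 p k Q u ζ t₁ +
              ENNReal.ofReal (γ * k) * DoublyDegenerate.cylInt Q t₁ t₂ (fun z =>
                DoublyDegenerate.truncMinus (u z) k * ζ z ^ (p - 1) *
                  |DoublyDegenerate.timeDeriv ζ z|) +
              ENNReal.ofReal (γ * k ^ (m + p - 1)) * DoublyDegenerate.cylInt Q t₁ t₂ (fun z =>
                {w : DoublyDegenerate.SpaceTime N | u w ≤ k}.indicator (fun _ => (1 : ℝ)) z *
                  ‖DoublyDegenerate.spaceGrad ζ z‖ ^ p)) ∧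
          -- cutoff functions with values in `[0, 1]`
          ((∀ z ∈ closure Q ×ˢ Icc t₁ t₂, ζ z ≤ 1) →
            essSup (fun τ : ℝ => DoublyDegenerate.sliceEnergy 2 p k Q u ζ τ)
                (volume.restrict (Icc t₁ t₂)) +
              ENNReal.ofReal (k ^ (m - 1)) * DoublyDegenerate.cylInt Q t₁ t₂ (fun z =>
                ‖DoublyDegenerate.gradTruncMinus m p u V k z‖ ^ p * ζ z ^ p) ≤
            ENNReal.ofReal (γ * k) * DoublyDegenerate.sliceEnergy 1 p k Q u ζ t₁ +
              ENNReal.ofReal (γ * k) * DoublyDegenerate.cylInt Q t₁ t₂ (fun z =>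
                DoublyDegenerate.truncMinus (u z) k * |DoublyDegenerate.timeDeriv ζ z|) +
              ENNReal.ofReal (γ * k ^ (m + p - 1)) * DoublyDegenerate.cylInt Q t₁ t₂ (fun z =>
                {w : DoublyDegenerate.SpaceTime N | u w ≤ k}.indicator (fun _ => (1 : ℝ)) z *
                  ‖DoublyDegenerate.spaceGrad ζ z‖ ^ p))) := by
  refine ⟨fun hm hp => ?_, fun hm0 hm hmp => ?_⟩
  · have hα : 0 < DoublyDegenerate.alpha m p := div_pos (by linarith) (by linarith)
    refine ⟨(1 + 2 / C₀) * (1 + DoublyDegenerate.youngConst p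
      (C₀ * DoublyDegenerate.alpha m p ^ (1 - p)) (C₁ * DoublyDegenerate.alpha m p ^ (1 - p)) *
        DoublyDegenerate.alpha m p ^ (p - 1)), ?_, fun N _ E T₁ T₂ A u V hE hA hu Q T hQo hQ hQE hT₁ hT hT₂ t₁ t₂ k ζ ht₁ ht ht₂ hk
      hζ => DoublyDegenerate.degenerate_energy_estimate hC₀ hC₁ hm (by linarith) rfl hE hA hu hQo hQ
        hQE hζ hk (hT₁.trans_le ht₁) ht (ht₂.trans_lt hT₂)⟩
    rw [DoublyDegenerate.youngConst]
    positivity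
  · have hp : 1 < p := by linarith
    have hα : 0 < DoublyDegenerate.alpha m p := div_pos (by linarith) (by linarith)
    refine ⟨(2 / DoublyDegenerate.alpha m p + 2 / (C₀ * DoublyDegenerate.alpha m p)) * (1 + p +
      DoublyDegenerate.youngConst p (C₀ * DoublyDegenerate.alpha m p ^ (1 - p))
        (C₁ * DoublyDegenerate.alpha m p ^ (1 - p))), ?_, fun N _ E T₁ T₂ A u V hE hA hu Q T hQo hQ hQE hT₁ hT hT₂ t₁ t₂ k ζ ht₁ ht ht₂ hk
      hζ => ?_⟩
    rotate_left
    · have h := DoublyDegenerate.singular_energy_estimate hC₀ hC₁ hm hmp rfl hE hA hu hQo hQ hQE hζ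
        hk (hT₁.trans_le ht₁) ht (ht₂.trans_lt hT₂)
      refine ⟨h, fun hζ1 => h.trans ?_⟩
      refine add_le_add (add_le_add le_rfl (mul_le_mul' le_rfl ?_)) le_rfl
      refine DoublyDegenerate.cylInt_mono_ae ((ae_restrict_mem
        (hQo.measurableSet.prod measurableSet_Ioo)).mono fun z hz => ?_)
      have hz' : z ∈ closure Q ×ˢ Icc t₁ t₂ := ⟨subset_closure hz.1, Ioo_subset_Icc_self hz.2⟩
      have h1 : ζ z ^ (p - 1) ≤ 1 := Real.rpow_le_one (hζ.nonneg z hz') (hζ1 z hz') (by linarith)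
      gcongr
      exact mul_le_of_le_one_right (DoublyDegenerate.truncMinus_nonneg _ _) h1
    · rw [DoublyDegenerate.youngConst]
      positivity
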